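/- **Theorem 5.1.** For every constant $c$ there are a randomized algorithm that makes $2$ passes over its input stream and constants $C,k$ such that the following holds for all integers $n\ge 2$ and $T\ge 1$, every simple undirected graph $G$ with $n$ vertices $0,\dots,n-1$ and $m$ edges, and every stream that lists each edge of $G$ exactly once, in arbitrary order (the same in both passes). The algorithm is given $n$ and $T$, but not $m$. - The space that the algorithm uses is at most $C(\log n)^k\,\bigl(\tfrac{m}{\sqrt T}+1\bigr)=\widetilde O\bigl(\tfrac{m}{\sqrt T}+1\bigr)$ bits, for every outcome of its random choices. - If $G$ contains no four-cycle, then the algorithm answers "no" with probability at least $1-n^{-c}$. - If $G$ contains at least $T$ four-cycles (subgraphs isomorphic to the cycle $C_4$, not necessarily induced), then the algorithm answers "yes" with probability at least $1-n^{-c}$. Here a streaming algorithm is a single procedure with computable transition rules. It carries nothing from one stream item to the next but its memory content, a finite list of natural numbers, and it may draw a fresh uniform random integer from a range that depends computably on $(n,T)$ at the start and at every item; random numbers that are needed again must be kept in memory. Its space is the maximum, over the start and the times after each stream item, of the size in bits of the memory content, where a stored number costs its binary length plus one bit. -/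

import Mathlib

/-- Number of bits of a memory content, which is a finite list of natural numbers: the binary
length of every stored number, plus one bit per number for separating it from the next one. -/
def memBits (M : List ℕ) : ℕ := (M.map fun w => Nat.size w + 1).sum

/-- A uniform randomized streaming algorithm for streams of pairs of natural numbers (the edges of
a graph). It knows an input parameter `x : ι` from the start, and nothing else about the stream.

* `init x r` is the memory content before the first stream item;
* `update x i e M r` is the memory content after the item `e` arrives during pass number `i`
  (counted from `0`), when the memory content before was `M`;
* `answer x M` is the answer when the memory content after the last pass is `M`.

The argument `r` is a fresh uniformly random element of `{0, …, coin x}`, drawn independently at the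
initialization and at every item. Nothing is carried over from one item to the next one except
the memory: old items and old random numbers are lost unless they are written there (in
particular, hash functions that are used more than once have to be stored). All four maps are
computable, so that this is one algorithm for all parameters. -/
structure StreamingAlgorithm (ι : Type) [Primcodable ι] where
  coin : ι → ℕ
  init : ι → ℕ → List ℕ
  update : ι → ℕ → ℕ × ℕ → List ℕ → ℕ → List ℕ
  answer : ι → List ℕ → Bool
  computable_coin : Computable coin
  computable_init : Computable fun a : ι × ℕ => init a.1 a.2
  computable_update : Computable fun a : (ι × ℕ) × (ℕ × ℕ) × List ℕ × ℕ =>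
    update a.1.1 a.1.2 a.2.1 a.2.2.1 a.2.2.2
  computable_answer : Computable fun a : ι × List ℕ => answer a.1 a.2

namespace StreamingAlgorithm

variable {ι : Type} [Primcodable ι] (A : StreamingAlgorithm ι)

/-- A uniformly random element of `{0, …, coin x}`. -/
noncomputable def draw (x : ι) : PMF ℕ :=
  (PMF.uniformOfFintype (Fin (A.coin x + 1))).map fun r => (r : ℕ)

/-- The initial memory content, together with its number of bits. -/
noncomputable def start (x : ι) : PMF (List ℕ × ℕ) :=
  (A.draw x).map fun r => (A.init x r, memBits (A.init x r))

/-- Processing of the item `e` in pass `i`. The second component of the state is not visible to the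
algorithm; it records the largest number of bits that the memory has had so far. -/
noncomputable def step (x : ι) (i : ℕ) (e : ℕ × ℕ) (s : List ℕ × ℕ) : PMF (List ℕ × ℕ) :=
  (A.draw x).map fun r =>
    (A.update x i e s.1 r, max s.2 (memBits (A.update x i e s.1 r)))

/-- Pass number `i` over the stream `es`, from a random state distributed as `μ`. -/
noncomputable def pass (x : ι) (es : List (ℕ × ℕ)) (μ : PMF (List ℕ × ℕ)) (i : ℕ) :
    PMF (List ℕ × ℕ) :=
  es.foldl (fun ν e => ν.bind (A.step x i e)) μ

/-- The joint distribution of the answer and of the space (the largest number of bits that the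
memory has at any time) of the algorithm with parameter `x` when it makes `p` passes over the
stream `es`. -/
noncomputable def run (p : ℕ) (x : ι) (es : List (ℕ × ℕ)) : PMF (Bool × ℕ) :=
  ((List.range p).foldl (A.pass x es) (A.start x)).map fun s => (A.answer x s.1, s.2)

/-- The probability that the answer is `b`. -/
noncomputable def probAnswer (p : ℕ) (x : ι) (es : List (ℕ × ℕ)) (b : Bool) : ℝ :=
  (((A.run p x es).map Prod.fst) b).toReal

end StreamingAlgorithm

/-- `es` lists every edge of `G` exactly once, in any order and with any order of its endpoints. -/
def IsEdgeStream {n : ℕ} (G : SimpleGraph (Fin n)) (es : List (Fin n × Fin n)) : Prop :=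
  (es.map fun e => s(e.1, e.2)).Nodup ∧ ∀ u v, s(u, v) ∈ (es.map fun e => s(e.1, e.2)) ↔ G.Adj u v

/-- The stream as the algorithm sees it: the vertices are the numbers `0, …, n - 1`. -/
def streamItems {n : ℕ} (es : List (Fin n × Fin n)) : List (ℕ × ℕ) :=
  es.map fun e => ((e.1 : ℕ), (e.2 : ℕ))

/-- The number of four-cycles of `G`: its subgraphs isomorphic to the cycle of length four. -/
noncomputable def numFourCycles {n : ℕ} (G : SimpleGraph (Fin n)) : ℕ :=
  G.copyCount (SimpleGraph.cycleGraph 4)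

/-! Sampling. One copy of the procedure picks random vertex sets X and Y of rates x and y by
pairwise independent hashing. It keeps an edge if it joins X to Y, or if it meets X and a coin of
rate y succeeds, or if it meets Y and a coin of rate x succeeds. An edge is kept with probability at
most 6xy, so xy = polylog / √T fits the space. A labelled four-cycle (a, b, c, d) is found in the
second pass, through its edge bc, once the path b, a, d, c is stored. For this it suffices that a ∈
X, d ∈ Y and the coins of ab and dc succeed, which has probability x²y². All stored edges belong to
the graph, so "yes" is never wrong.

Second moments. For a family F of four-cycles, the correlation of two members depends only on
whether they agree in a, d, ab and cd. Expanding the second moment gives nine terms, one for each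
pattern of agreement. `RateBounds` says that each of them is at most the square of the first moment,
and then some path of F is sampled with probability at least 1/9 (`le_pr_exists_pathSampled`).

Regular families. In general no rates work for the family of all N labelled four-cycles, because of
edges in too many of them. Call an edge heavy if it lies in more than λ ≈ √N of them, up to a
constant factor. There are at most N/λ heavy pairs. Hence few cycles have two opposite heavy edges,
since these determine the cycle, and few have two adjacent ones, by Cauchy–Schwarz
(`card_adjacent_heavy_sq_le`). So a constant fraction of the cycles is light on all sides, or has bc
as its only heavy side (`card_light_or_heavyBC`). A dyadic pigeonhole argument makes the relevant
degrees nearly constant at the cost of a polylogarithmic factor, and counting bounds four products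
of these degrees (`exists_isRegular_c4s`). Exactly these products decide whether the lower bounds
needed for x and for y are compatible with a prescribed size s of xy (`IsRegular.exists_rates`). The
right ratio x : y depends on the graph, but a logarithmic number of powers of two covers all ratios;
these are the levels.

Amplification and space. Each level is run in Θ(c log n) independent copies. A copy refuses edges
beyond a fixed fraction of the number of items seen so far, which bounds the space for every
outcome. By Markov's inequality at dyadic times (`pr_exists_prefix_le`), the refusal rule interferes
with probability at most 1/32, so a copy of the good level succeeds with probability at least 1/32.
-/

namespace FourCycle

/-! ### Parameters -/

/-- The binary length of `n` if `n ≠ 0`. -/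
def bitLen (n : ℕ) : ℕ := Nat.findGreatest (fun k => 2 ^ k ≤ n) n + 1

/-- The size of the prime field in which vertices are hashed. -/
def fieldSize (n : ℕ) : ℕ := Nat.findGreatest Nat.Prime (2 * (16 * n ^ 2))

/-- The polylogarithmic loss of the regularization of a family of four-cycles. -/
def regLoss (n : ℕ) : ℕ := 16 * (4 * bitLen n) ^ 4

/-- The polylogarithmic factor by which the sampling rate exceeds `1 / √T`. -/
def boost (n : ℕ) : ℕ := 160 * regLoss n ^ 3

/-- The number of ratios between the sampling rates of the two vertex sets that are tried. -/
def levels (n : ℕ) : ℕ := 2 * bitLen n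

/-- The number of independent copies of the sampling procedure. -/
def copies (c n : ℕ) : ℕ := levels n * (32 * c * bitLen n)

/-- At level `i`, a hash value below this threshold puts a vertex into the first vertex set. -/
def xThr (n i : ℕ) : ℕ := min (fieldSize n) (fieldSize n / 2 ^ i + 1)

/-- At level `i`, a hash value below this threshold puts a vertex into the second vertex set. -/
def yThr (n T i : ℕ) : ℕ :=
  min (fieldSize n) (2 * boost n * fieldSize n * 2 ^ i / Nat.sqrt T + 1)

/-- A copy stores at most `capFactor n / Nat.sqrt T` times as many edges as have arrived. -/
def capFactor (n : ℕ) : ℕ := 6144 * (bitLen n + 1) * boost n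

/-! ### The algorithm -/

/-- The digit number `k` of `r` in base `q`. -/
def digit (q r k : ℕ) : ℕ := r / q ^ k % q

/-- The sampling rule of one copy: `h` are the coefficients of the two hash functions, `c` are
four fresh coins for the edge `{u, v}`, and `x` and `y` are the two thresholds. -/
def KeepEdge (q x y : ℕ) (h c : ℕ → ℕ) (u v : ℕ) : Prop :=
  ((h 0 * u + h 1) % q < x ∧ (h 2 * v + h 3) % q < y) ∨
  ((h 0 * v + h 1) % q < x ∧ (h 2 * u + h 3) % q < y) ∨
  ((h 0 * u + h 1) % q < x ∧ c 0 < y) ∨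
  ((h 0 * v + h 1) % q < x ∧ c 1 < y) ∨
  ((h 2 * u + h 3) % q < y ∧ c 2 < x) ∨
  ((h 2 * v + h 3) % q < y ∧ c 3 < x)

instance (q x y : ℕ) (h c : ℕ → ℕ) (u v : ℕ) : Decidable (KeepEdge q x y h c u v) := by
  unfold KeepEdge; infer_instance

/-- The sampling rule of copy `j`, for the random key `key` and the fresh random number `r`. -/
def Keep (n T j key r u v : ℕ) : Prop :=
  KeepEdge (fieldSize n) (xThr n (j % levels n)) (yThr n T (j % levels n))
    (fun k => digit (fieldSize n) key (k + 4 * j)) (fun k => digit (fieldSize n) r (k + 4 * j)) u v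

instance (n T j key r u v : ℕ) : Decidable (Keep n T j key r u v) := by
  unfold Keep; infer_instance

/-- A mixed radix numeral: for `u, v < n`, division by `n * n` recovers the copy, and the last two
digits in base `n` are the endpoints. -/
def encodeEdge (n j u v : ℕ) : ℕ := j * (n * n) + u * n + v

def storedIn (n : ℕ) (codes : List ℕ) (j : ℕ) : ℕ :=
  (codes.filter fun z => z / (n * n) = j).length

/-- Whether copy `j` stores the edge `{u, v}`, which is item number `m` of the stream. -/
def Stores (n T m key : ℕ) (codes : List ℕ) (r u v j : ℕ) : Prop :=
  Keep n T j key r u v ∧ (storedIn n codes j + 1) * Nat.sqrt T ≤ capFactor n * (m + 1)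

instance (n T m key : ℕ) (codes : List ℕ) (r u v j : ℕ) :
    Decidable (Stores n T m key codes r u v j) := by
  unfold Stores; infer_instance

def collect (c n T m key : ℕ) (codes : List ℕ) (r u v : ℕ) : List ℕ :=
  ((List.range (copies c n)).filter fun j => Stores n T m key codes r u v j).map
    (fun j => encodeEdge n j u v) ++ codes

/-- The copy number is ignored. Paths may combine edges of different copies, which is harmless
because all stored edges are edges of the graph. -/
def StoredAdj (n : ℕ) (codes : List ℕ) (u v : ℕ) : Prop :=
  ∃ z ∈ codes, (z / n % n = u ∧ z % n = v) ∨ (z / n % n = v ∧ z % n = u)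

instance (n : ℕ) (codes : List ℕ) (u v : ℕ) : Decidable (StoredAdj n codes u v) := by
  unfold StoredAdj; infer_instance

/-- The edge `{u, v}` closes a stored path with three edges to a four-cycle. -/
def Closes (n : ℕ) (codes : List ℕ) (u v : ℕ) : Prop :=
  ∃ a < n, ∃ d < n, a ≠ v ∧ d ≠ u ∧
    StoredAdj n codes u a ∧ StoredAdj n codes a d ∧ StoredAdj n codes d v

instance (n : ℕ) (codes : List ℕ) (u v : ℕ) : Decidable (Closes n codes u v) := by
  unfold Closes; infer_instance

/-- A nonempty memory has the form `m :: key :: codes`, where `m` counts the items of the first pass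
and `key` contains all hash coefficients. The count is needed for the capacity test, as the length
of the stream is unknown. The empty memory is absorbing and means "yes". -/
def update (c : ℕ) (x : ℕ × ℕ) (i : ℕ) (e : ℕ × ℕ) (M : List ℕ) (r : ℕ) : List ℕ :=
  if M = [] then []
  else if i = 0 then
    (M.headI + 1) :: M.tail.headI ::
      collect c x.1 x.2 M.headI M.tail.headI M.tail.tail r e.1 e.2
  else if Closes x.1 M.tail.tail e.1 e.2 then [] else M

/-! ### Computability -/

section Computability

variable {α : Type*} [Primcodable α]

theorem primrec_pow {f g : α → ℕ} (hf : Primrec f) (hg : Primrec g) :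
    Primrec fun a => f a ^ g a :=
  (Primrec₂.unpaired'.1 Nat.Primrec.pow).comp hf hg

theorem primrec_add {f g : α → ℕ} (hf : Primrec f) (hg : Primrec g) :
    Primrec fun a => f a + g a := Primrec.nat_add.comp hf hg

theorem primrec_mul {f g : α → ℕ} (hf : Primrec f) (hg : Primrec g) :
    Primrec fun a => f a * g a := Primrec.nat_mul.comp hf hg

theorem primrec_div {f g : α → ℕ} (hf : Primrec f) (hg : Primrec g) :
    Primrec fun a => f a / g a := Primrec.nat_div.comp hf hg

theorem primrec_mod {f g : α → ℕ} (hf : Primrec f) (hg : Primrec g) :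
    Primrec fun a => f a % g a := Primrec.nat_mod.comp hf hg

theorem primrec_min {f g : α → ℕ} (hf : Primrec f) (hg : Primrec g) :
    Primrec fun a => min (f a) (g a) := Primrec.nat_min.comp hf hg

theorem primrecPred_lt {f g : α → ℕ} (hf : Primrec f) (hg : Primrec g) :
    PrimrecPred fun a => f a < g a := Primrec.nat_lt.comp hf hg

theorem primrecPred_le {f g : α → ℕ} (hf : Primrec f) (hg : Primrec g) :
    PrimrecPred fun a => f a ≤ g a := Primrec.nat_le.comp hf hg

theorem primrecPred_eq {f g : α → ℕ} (hf : Primrec f) (hg : Primrec g) :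
    PrimrecPred fun a => f a = g a := Primrec.eq.comp hf hg

theorem primrecPred_exists_lt {b : α → ℕ} {p : α → ℕ → Prop} (hb : Primrec b)
    (hp : PrimrecRel p) : PrimrecPred fun a => ∃ x < b a, p a x := by
  have h : PrimrecRel fun (L : List ℕ) a => ∃ x ∈ L, p a x :=
    PrimrecRel.exists_mem_list (hp.comp Primrec.snd Primrec.fst)
  exact (h.comp (Primrec.list_range.comp hb) Primrec.id).of_eq fun a => by simp

theorem primrecPred_prime : PrimrecPred Nat.Prime := by
  have h : PrimrecPred fun p : ℕ => 2 ≤ p ∧ ¬ ∃ m < p, 2 ≤ m ∧ p % m = 0 := by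
    refine (primrecPred_le (.const 2) .id).and (.not (primrecPred_exists_lt .id ?_))
    exact (primrecPred_le (.const 2) .snd).and
      (primrecPred_eq (primrec_mod .fst .snd) (.const 0))
  refine h.of_eq fun p => ?_
  rw [Nat.prime_def_lt']
  simp only [not_exists, not_and, Nat.dvd_iff_mod_eq_zero]
  exact and_congr_right fun _ => ⟨fun h m h2 hm => h m hm h2, fun h m hm h2 => h m h2 hm⟩

theorem primrec_bitLen : Primrec bitLen := by
  refine primrec_add (Primrec.nat_findGreatest (p := fun n k => 2 ^ k ≤ n) .id ?_) (.const 1)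
  exact primrecPred_le (primrec_pow (.const 2) .snd) .fst

theorem primrec_fieldSize : Primrec fieldSize := by
  refine Primrec.nat_findGreatest (p := fun _ k => Nat.Prime k) ?_ (primrecPred_prime.comp .snd)
  exact primrec_mul (.const 2) (primrec_mul (.const 16) (primrec_pow .id (.const 2)))

theorem primrec_regLoss : Primrec regLoss :=
  primrec_mul (.const 16) (primrec_pow (primrec_mul (.const 4) primrec_bitLen) (.const 4))

theorem primrec_boost : Primrec boost :=
  primrec_mul (.const 160) (primrec_pow primrec_regLoss (.const 3))

theorem primrec_levels : Primrec levels := primrec_mul (.const 2) primrec_bitLen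

theorem primrec_copies (c : ℕ) : Primrec (copies c) :=
  primrec_mul primrec_levels (primrec_mul (.const (32 * c)) primrec_bitLen)

theorem primrec_xThr {n i : α → ℕ} (hn : Primrec n) (hi : Primrec i) :
    Primrec fun a => xThr (n a) (i a) :=
  primrec_min (primrec_fieldSize.comp hn) (primrec_add
    (primrec_div (primrec_fieldSize.comp hn) (primrec_pow (.const 2) hi)) (.const 1))

theorem primrec_yThr {n T i : α → ℕ} (hn : Primrec n) (hT : Primrec T) (hi : Primrec i) :
    Primrec fun a => yThr (n a) (T a) (i a) :=
  primrec_min (primrec_fieldSize.comp hn) (primrec_add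
    (primrec_div (primrec_mul (primrec_mul (primrec_mul (.const 2) (primrec_boost.comp hn))
      (primrec_fieldSize.comp hn)) (primrec_pow (.const 2) hi)) (Primrec.nat_sqrt.comp hT))
    (.const 1))

theorem primrec_capFactor : Primrec capFactor :=
  primrec_mul (primrec_mul (.const 6144) (primrec_add primrec_bitLen (.const 1))) primrec_boost

theorem primrec_digit {q r k : α → ℕ} (hq : Primrec q) (hr : Primrec r) (hk : Primrec k) :
    Primrec fun a => digit (q a) (r a) (k a) :=
  primrec_mod (primrec_div hr (primrec_pow hq hk)) hq

theorem primrecPred_keepEdge {q x y u v : α → ℕ} {h c : α → ℕ → ℕ} (hq : Primrec q)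
    (hx : Primrec x) (hy : Primrec y) (hh : ∀ k, Primrec fun a => h a k)
    (hc : ∀ k, Primrec fun a => c a k) (hu : Primrec u) (hv : Primrec v) :
    PrimrecPred fun a => KeepEdge (q a) (x a) (y a) (h a) (c a) (u a) (v a) := by
  have key : ∀ (i j : ℕ) {w t : α → ℕ}, Primrec w → Primrec t →
      PrimrecPred fun a => (h a i * w a + h a j) % q a < t a := fun i j w t hw ht =>
    primrecPred_lt (primrec_mod (primrec_add (primrec_mul (hh i) hw) (hh j)) hq) ht
  have coin : ∀ (i : ℕ) {t : α → ℕ}, Primrec t → PrimrecPred fun a => c a i < t a :=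
    fun i t ht => primrecPred_lt (hc i) ht
  exact ((key 0 1 hu hx).and (key 2 3 hv hy)).or <| ((key 0 1 hv hx).and (key 2 3 hu hy)).or <|
    ((key 0 1 hu hx).and (coin 0 hy)).or <| ((key 0 1 hv hx).and (coin 1 hy)).or <|
    ((key 2 3 hu hy).and (coin 2 hx)).or ((key 2 3 hv hy).and (coin 3 hx))

theorem primrecPred_keep {n T j key r u v : α → ℕ} (hn : Primrec n) (hT : Primrec T)
    (hj : Primrec j) (hkey : Primrec key) (hr : Primrec r) (hu : Primrec u) (hv : Primrec v) :
    PrimrecPred fun a => Keep (n a) (T a) (j a) (key a) (r a) (u a) (v a) := by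
  have hl := primrec_mod hj (primrec_levels.comp hn)
  have hq := primrec_fieldSize.comp hn
  exact primrecPred_keepEdge hq (primrec_xThr hn hl) (primrec_yThr hn hT hl)
    (fun k => primrec_digit hq hkey (primrec_add (.const k) (primrec_mul (.const 4) hj)))
    (fun k => primrec_digit hq hr (primrec_add (.const k) (primrec_mul (.const 4) hj))) hu hv

theorem primrec_encodeEdge {n j u v : α → ℕ} (hn : Primrec n) (hj : Primrec j)
    (hu : Primrec u) (hv : Primrec v) :
    Primrec fun a => encodeEdge (n a) (j a) (u a) (v a) :=
  primrec_add (primrec_add (primrec_mul hj (primrec_mul hn hn)) (primrec_mul hu hn)) hv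

theorem primrec_storedIn {n j : α → ℕ} {codes : α → List ℕ} (hn : Primrec n)
    (hcodes : Primrec codes) (hj : Primrec j) :
    Primrec fun a => storedIn (n a) (codes a) (j a) := by
  have h : Primrec₂ fun (L : List ℕ) (b : ℕ × ℕ) => L.filter fun z => z / (b.1 * b.1) = b.2 :=
    PrimrecRel.listFilter (R := fun z (b : ℕ × ℕ) => z / (b.1 * b.1) = b.2) <|
      primrecPred_eq (primrec_div .fst (primrec_mul (Primrec.fst.comp .snd)
        (Primrec.fst.comp .snd))) (Primrec.snd.comp .snd)
  exact Primrec.list_length.comp (h.comp hcodes (hn.pair hj))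

theorem primrecPred_stores {n T m key r u v j : α → ℕ} {codes : α → List ℕ} (hn : Primrec n)
    (hT : Primrec T) (hm : Primrec m) (hkey : Primrec key) (hcodes : Primrec codes)
    (hr : Primrec r) (hu : Primrec u) (hv : Primrec v) (hj : Primrec j) :
    PrimrecPred fun a =>
      Stores (n a) (T a) (m a) (key a) (codes a) (r a) (u a) (v a) (j a) :=
  (primrecPred_keep hn hT hj hkey hr hu hv).and <| primrecPred_le
    (primrec_mul (primrec_add (primrec_storedIn hn hcodes hj) (.const 1))
      (Primrec.nat_sqrt.comp hT))
    (primrec_mul (primrec_capFactor.comp hn) (primrec_add hm (.const 1)))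

theorem primrec_collect (c : ℕ) {n T m key r u v : α → ℕ} {codes : α → List ℕ}
    (hn : Primrec n) (hT : Primrec T) (hm : Primrec m) (hkey : Primrec key)
    (hcodes : Primrec codes) (hr : Primrec r) (hu : Primrec u) (hv : Primrec v) :
    Primrec fun a => collect c (n a) (T a) (m a) (key a) (codes a) (r a) (u a) (v a) := by
  have h : Primrec₂ fun (L : List ℕ) (a : α) => L.filter fun j =>
      Stores (n a) (T a) (m a) (key a) (codes a) (r a) (u a) (v a) j :=
    PrimrecRel.listFilter (R := fun j a =>
      Stores (n a) (T a) (m a) (key a) (codes a) (r a) (u a) (v a) j) <|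
      primrecPred_stores (hn.comp .snd) (hT.comp .snd) (hm.comp .snd) (hkey.comp .snd)
        (hcodes.comp .snd) (hr.comp .snd) (hu.comp .snd) (hv.comp .snd) .fst
  refine Primrec.list_append.comp (Primrec.list_map
    (h.comp (Primrec.list_range.comp ((primrec_copies c).comp hn)) .id) ?_) hcodes
  exact primrec_encodeEdge (hn.comp .fst) .snd (hu.comp .fst) (hv.comp .fst)

theorem primrecPred_storedAdj {n u v : α → ℕ} {codes : α → List ℕ} (hn : Primrec n)
    (hcodes : Primrec codes) (hu : Primrec u) (hv : Primrec v) :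
    PrimrecPred fun a => StoredAdj (n a) (codes a) (u a) (v a) := by
  have h1 : Primrec fun p : ℕ × α => p.1 / n p.2 % n p.2 :=
    primrec_mod (primrec_div .fst (hn.comp .snd)) (hn.comp .snd)
  have h2 : Primrec fun p : ℕ × α => p.1 % n p.2 := primrec_mod .fst (hn.comp .snd)
  have h : PrimrecRel fun (z : ℕ) (a : α) =>
      (z / n a % n a = u a ∧ z % n a = v a) ∨ (z / n a % n a = v a ∧ z % n a = u a) :=
    ((primrecPred_eq h1 (hu.comp .snd)).and (primrecPred_eq h2 (hv.comp .snd))).or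
      ((primrecPred_eq h1 (hv.comp .snd)).and (primrecPred_eq h2 (hu.comp .snd)))
  exact h.exists_mem_list.comp hcodes .id

theorem primrecPred_closes {n u v : α → ℕ} {codes : α → List ℕ} (hn : Primrec n)
    (hcodes : Primrec codes) (hu : Primrec u) (hv : Primrec v) :
    PrimrecPred fun a => Closes (n a) (codes a) (u a) (v a) := by
  refine primrecPred_exists_lt hn ?_
  refine primrecPred_exists_lt (hn.comp .fst) ?_
  have h1 : Primrec fun p : (α × ℕ) × ℕ => p.1.1 := Primrec.fst.comp .fst
  have h2 : Primrec fun p : (α × ℕ) × ℕ => p.1.2 := Primrec.snd.comp .fst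
  have adj : ∀ {s t : (α × ℕ) × ℕ → ℕ}, Primrec s → Primrec t →
      PrimrecPred fun p => StoredAdj (n p.1.1) (codes p.1.1) (s p) (t p) := fun hs ht =>
    primrecPred_storedAdj (hn.comp h1) (hcodes.comp h1) hs ht
  exact (primrecPred_eq h2 (hv.comp h1)).not.and <|
    (primrecPred_eq .snd (hu.comp h1)).not.and <|
    (adj (hu.comp h1) h2).and ((adj h2 .snd).and (adj .snd (hv.comp h1)))

theorem primrec_update (c : ℕ) : Primrec fun a : ((ℕ × ℕ) × ℕ) × (ℕ × ℕ) × List ℕ × ℕ =>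
    update c a.1.1 a.1.2 a.2.1 a.2.2.1 a.2.2.2 := by
  have hn : Primrec fun a : ((ℕ × ℕ) × ℕ) × (ℕ × ℕ) × List ℕ × ℕ => a.1.1.1 :=
    Primrec.fst.comp (Primrec.fst.comp .fst)
  have hT : Primrec fun a : ((ℕ × ℕ) × ℕ) × (ℕ × ℕ) × List ℕ × ℕ => a.1.1.2 :=
    Primrec.snd.comp (Primrec.fst.comp .fst)
  have hi : Primrec fun a : ((ℕ × ℕ) × ℕ) × (ℕ × ℕ) × List ℕ × ℕ => a.1.2 :=
    Primrec.snd.comp .fst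
  have hu : Primrec fun a : ((ℕ × ℕ) × ℕ) × (ℕ × ℕ) × List ℕ × ℕ => a.2.1.1 :=
    Primrec.fst.comp (Primrec.fst.comp .snd)
  have hv : Primrec fun a : ((ℕ × ℕ) × ℕ) × (ℕ × ℕ) × List ℕ × ℕ => a.2.1.2 :=
    Primrec.snd.comp (Primrec.fst.comp .snd)
  have hM : Primrec fun a : ((ℕ × ℕ) × ℕ) × (ℕ × ℕ) × List ℕ × ℕ => a.2.2.1 :=
    Primrec.fst.comp (Primrec.snd.comp .snd)
  have hr : Primrec fun a : ((ℕ × ℕ) × ℕ) × (ℕ × ℕ) × List ℕ × ℕ => a.2.2.2 :=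
    Primrec.snd.comp (Primrec.snd.comp .snd)
  have hm := Primrec.list_headI.comp hM
  have hM' := Primrec.list_tail.comp hM
  have hkey := Primrec.list_headI.comp hM'
  have hcodes := Primrec.list_tail.comp hM'
  refine Primrec.ite (Primrec.eq.comp hM (.const [])) (.const [])
    (Primrec.ite (primrecPred_eq hi (.const 0)) ?_
      (Primrec.ite (primrecPred_closes hn hcodes hu hv) (.const []) hM))
  exact Primrec.list_cons.comp (primrec_add hm (.const 1)) (Primrec.list_cons.comp hkey
    (primrec_collect c hn hT hm hkey hcodes hr hu hv))

end Computability

/-- The first pass samples edges, and the second one looks for an edge that closes a sampled path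
with three edges to a four-cycle. The memory is empty once a four-cycle was found. -/
def algorithm (c : ℕ) : StreamingAlgorithm (ℕ × ℕ) where
  -- One draw supplies four base `fieldSize` digits to every copy: hash coefficients at the start,
  -- coins at an item.
  coin x := fieldSize x.1 ^ (copies c x.1 * 4) - 1
  init _ r := [0, r]
  update := update c
  answer _ M := decide (M = [])
  computable_coin := by
    refine Primrec.to_comp ?_
    exact Primrec.nat_sub.comp (primrec_pow (primrec_fieldSize.comp .fst)
      (primrec_mul ((primrec_copies c).comp .fst) (.const 4))) (.const 1)
  computable_init := by
    refine Primrec.to_comp ?_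
    exact Primrec.list_cons.comp (.const 0) (Primrec.list_cons.comp .snd (.const []))
  computable_update := (primrec_update c).to_comp
  computable_answer := by
    refine Primrec.to_comp ?_
    have h : PrimrecPred fun a : (ℕ × ℕ) × List ℕ => a.2 = [] :=
      Primrec.eq.comp .snd (.const [])
    exact h.decide

end FourCycle

/-! ### Drawing all random numbers of a run in advance -/

theorem PMF.uniformOfFintype_pi_succ (α : Type*) [Fintype α] [Nonempty α] (k : ℕ) :
    PMF.uniformOfFintype (Fin (k + 1) → α) = (PMF.uniformOfFintype α).bind fun a =>
      (PMF.uniformOfFintype (Fin k → α)).map fun w => (Fin.cons a w : Fin (k + 1) → α) := by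
  classical
  ext f
  simp only [PMF.bind_apply, PMF.map_apply, PMF.uniformOfFintype_apply, tsum_fintype]
  rw [Finset.sum_eq_single (f 0)]
  · rw [Finset.sum_eq_single (Fin.tail f)]
    · rw [if_pos (Fin.cons_self_tail f).symm, ← ENNReal.mul_inv (by simp) (by simp)]
      congr 1
      simp [pow_succ, mul_comm]
    · intro w _ hw
      rw [if_neg]
      rintro h
      exact hw (by rw [h, Fin.tail_cons])
    · simp
  · intro a _ ha
    refine mul_eq_zero_of_right _ (Finset.sum_eq_zero fun w _ => if_neg ?_)
    rintro h
    exact ha (by rw [h, Fin.cons_zero])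
  · simp

theorem PMF.toReal_map_uniformOfFintype {α β : Type*} [Fintype α] [Nonempty α] [DecidableEq β]
    (f : α → β) (b : β) :
    (((PMF.uniformOfFintype α).map f) b).toReal =
      ((Finset.univ.filter fun a => f a = b).card : ℝ) / Fintype.card α := by
  classical
  have h : ((PMF.uniformOfFintype α).map f) b =
      ((Finset.univ.filter fun a => f a = b).card : ENNReal) * (Fintype.card α : ENNReal)⁻¹ := by
    simp only [PMF.map_apply, PMF.uniformOfFintype_apply, tsum_fintype]
    rw [← Finset.sum_filter, Finset.sum_const, nsmul_eq_mul]
    congr 3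
    ext a
    simp [eq_comm]
  rw [h, ENNReal.toReal_mul, ENNReal.toReal_inv, div_eq_mul_inv]
  simp

namespace StreamingAlgorithm

variable {ι : Type} [Primcodable ι] (A : StreamingAlgorithm ι)

theorem draw_eq_map (x : ι) :
    A.draw x = (PMF.uniformOfFintype (Fin (A.coin x + 1))).map Fin.val := by
  unfold draw
  exact PMF.map_id _

/-- One step with a given random number: `p` consists of the pass number, the item, and the random
number. -/
def detStep (x : ι) (s : List ℕ × ℕ) (p : (ℕ × ℕ × ℕ) × ℕ) : List ℕ × ℕ :=
  (A.update x p.1.1 p.1.2 s.1 p.2, max s.2 (memBits (A.update x p.1.1 p.1.2 s.1 p.2)))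

/-- The last state for the items `its` and the random numbers `rs`, where the first random number
is that of the initialization. -/
def detRun (x : ι) (its : List (ℕ × ℕ × ℕ)) (rs : List ℕ) : List ℕ × ℕ :=
  (its.zip rs.tail).foldl (A.detStep x) (A.init x rs.headI, memBits (A.init x rs.headI))

/-- Every step uses a fresh random number, so the numbers may be drawn together as a uniform vector,
after which the run is a deterministic fold. Probabilities of answers thereby become proportions of
vectors. -/
theorem foldl_bind_step (x : ι) (its : List (ℕ × ℕ × ℕ)) (μ : PMF (List ℕ × ℕ)) :
    its.foldl (fun ν it => ν.bind (A.step x it.1 it.2)) μ =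
      μ.bind fun s => (PMF.uniformOfFintype (Fin its.length → Fin (A.coin x + 1))).map fun w =>
        (its.zip (List.ofFn fun t => (w t : ℕ))).foldl (A.detStep x) s := by
  induction its generalizing μ with
  | nil =>
    have h (s : List ℕ × ℕ) : (PMF.uniformOfFintype (Fin 0 → Fin (A.coin x + 1))).map
        (fun _ => s) = PMF.pure s := PMF.map_const _ _
    simp [h]
  | cons it its ih =>
    rw [List.foldl_cons, ih, PMF.bind_bind]
    congr 1
    funext s
    simp only [List.length_cons]
    rw [PMF.uniformOfFintype_pi_succ, PMF.map_bind]
    simp only [step, draw_eq_map, PMF.map_comp, PMF.bind_map]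
    congr 1
    funext a
    simp only [Function.comp_def, List.ofFn_succ, List.zip_cons_cons, List.foldl_cons,
      Fin.cons_zero, Fin.cons_succ, detStep]

theorem run_two (x : ι) (es : List (ℕ × ℕ)) :
    A.run 2 x es = (PMF.uniformOfFintype (Fin ((es.map (Prod.mk 0) ++
        es.map (Prod.mk 1)).length + 1) → Fin (A.coin x + 1))).map fun w =>
      (fun s : List ℕ × ℕ => (A.answer x s.1, s.2))
        (A.detRun x (es.map (Prod.mk 0) ++ es.map (Prod.mk 1)) (List.ofFn fun t => (w t : ℕ))) := by
  have h : (List.range 2).foldl (A.pass x es) (A.start x) =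
      (es.map (Prod.mk 0) ++ es.map (Prod.mk 1)).foldl
        (fun ν (it : ℕ × ℕ × ℕ) => ν.bind (A.step x it.1 it.2)) (A.start x) := by
    simp [List.range_succ, pass, List.foldl_append, List.foldl_map]
  rw [run, h, foldl_bind_step, PMF.uniformOfFintype_pi_succ, PMF.map_bind, PMF.map_bind]
  simp only [start, draw_eq_map, PMF.map_comp, PMF.bind_map]
  congr 1
  funext a
  simp only [Function.comp_def, detRun, List.ofFn_succ, Fin.cons_zero, Fin.cons_succ,
    List.headI_cons, List.tail_cons]

theorem probAnswer_two (x : ι) (es : List (ℕ × ℕ)) (b : Bool) :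
    A.probAnswer 2 x es b =
      ((Finset.univ.filter fun w : Fin ((es.map (Prod.mk 0) ++ es.map (Prod.mk 1)).length + 1) →
        Fin (A.coin x + 1) => A.answer x (A.detRun x (es.map (Prod.mk 0) ++ es.map (Prod.mk 1))
          (List.ofFn fun t => (w t : ℕ))).1 = b).card : ℝ) /
      Fintype.card (Fin ((es.map (Prod.mk 0) ++ es.map (Prod.mk 1)).length + 1) →
        Fin (A.coin x + 1)) := by
  rw [probAnswer, run_two, PMF.map_comp]
  exact PMF.toReal_map_uniformOfFintype _ _

end StreamingAlgorithm

/-! ### The two passes as deterministic functions of the random numbers -/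

namespace FourCycle

/-- The codes of the edges that are stored after the first pass; `l` consists of the items and of
the random numbers drawn for them, the last item first. -/
def sampled (c n T key : ℕ) : List ((ℕ × ℕ) × ℕ) → List ℕ
  | [] => []
  | p :: l => collect c n T l.length key (sampled c n T key l) p.2 p.1.1 p.1.2

def memory (c n T key : ℕ) (l : List ((ℕ × ℕ) × ℕ)) : List ℕ :=
  l.length :: key :: sampled c n T key l

theorem update_memory_zero (c n T key r : ℕ) (e : ℕ × ℕ) (l : List ((ℕ × ℕ) × ℕ)) :
    update c (n, T) 0 e (memory c n T key l) r = memory c n T key ((e, r) :: l) := by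
  simp [update, memory, sampled]

/-- The processed items are listed with the last one first, so the intermediate memories belong to
the suffixes of the final list. This is why the space hypothesis `hB` ranges over suffixes. -/
theorem foldl_first_pass (c n T key B : ℕ) (es : List (ℕ × ℕ)) (rs : List ℕ)
    (l : List ((ℕ × ℕ) × ℕ)) (b : ℕ)
    (hlen : es.length = rs.length)
    (hB : ∀ l', l' <:+ (es.zip rs).reverse ++ l → memBits (memory c n T key l') ≤ B)
    (hb : b ≤ B) :
    (((es.map (Prod.mk 0)).zip rs).foldl ((algorithm c).detStep (n, T))
      (memory c n T key l, b)).1 = memory c n T key ((es.zip rs).reverse ++ l) ∧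
    (((es.map (Prod.mk 0)).zip rs).foldl ((algorithm c).detStep (n, T))
      (memory c n T key l, b)).2 ≤ B := by
  induction es generalizing rs l b with
  | nil => simpa using hb
  | cons e es ih =>
    cases rs with
    | nil => simp at hlen
    | cons r rs =>
      simp only [List.map_cons, List.zip_cons_cons, List.foldl_cons, List.reverse_cons,
        List.append_assoc, List.singleton_append] at hB ⊢
      have h : (algorithm c).detStep (n, T) (memory c n T key l, b) ((0, e), r) =
          (memory c n T key ((e, r) :: l), max b (memBits (memory c n T key ((e, r) :: l)))) := by
        simp only [StreamingAlgorithm.detStep, algorithm, update_memory_zero]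
      rw [h]
      exact ih rs _ _ (by simpa using hlen) hB
        (max_le hb (hB _ (List.suffix_append _ _)))

theorem update_one (c n T r : ℕ) (e : ℕ × ℕ) (M : List ℕ) (hM : M ≠ []) :
    update c (n, T) 1 e M r = if Closes n M.tail.tail e.1 e.2 then [] else M := by
  simp [update, hM]

theorem foldl_second_pass_nil (c n T : ℕ) (l : List ((ℕ × ℕ × ℕ) × ℕ)) (b : ℕ) :
    l.foldl ((algorithm c).detStep (n, T)) ([], b) = ([], b) := by
  induction l with
  | nil => rfl
  | cons p l ih =>
    have h : (algorithm c).detStep (n, T) ([], b) p = ([], b) := by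
      simp [StreamingAlgorithm.detStep, algorithm, update, memBits]
    rw [List.foldl_cons, h, ih]

theorem foldl_second_pass (c n T : ℕ) (es : List (ℕ × ℕ)) (rs : List ℕ) (M : List ℕ)
    (hM : M ≠ []) (b : ℕ) (hlen : es.length = rs.length) :
    (((es.map (Prod.mk 1)).zip rs).foldl ((algorithm c).detStep (n, T)) (M, b)).1 =
      (if ∃ e ∈ es, Closes n M.tail.tail e.1 e.2 then [] else M) ∧
    (((es.map (Prod.mk 1)).zip rs).foldl ((algorithm c).detStep (n, T)) (M, b)).2 ≤
      max b (memBits M) := by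
  induction es generalizing rs b with
  | nil => simp
  | cons e es ih =>
    cases rs with
    | nil => simp at hlen
    | cons r rs =>
      simp only [List.map_cons, List.zip_cons_cons, List.foldl_cons]
      have h : (algorithm c).detStep (n, T) (M, b) ((1, e), r) =
          (if Closes n M.tail.tail e.1 e.2 then [] else M,
            max b (memBits (if Closes n M.tail.tail e.1 e.2 then [] else M))) := by
        simp only [StreamingAlgorithm.detStep, algorithm, update_one _ _ _ _ _ _ hM]
      rw [h]
      by_cases hc : Closes n M.tail.tail e.1 e.2
      · simp only [hc, if_true]
        rw [foldl_second_pass_nil]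
        simp [hc, memBits]
      · simp only [hc, if_false]
        have := ih rs (max b (memBits M)) (by simpa using hlen)
        refine ⟨this.1.trans ?_, this.2.trans (by simp)⟩
        simp only [List.mem_cons, exists_eq_or_imp, hc, false_or]

theorem detRun_algorithm (c n T B : ℕ) (es : List (ℕ × ℕ)) (key : ℕ) (rs : List ℕ)
    (hlen : rs.length = es.length + es.length)
    (hB : ∀ l', l' <:+ (es.zip rs).reverse → memBits (memory c n T key l') ≤ B) :
    ((algorithm c).detRun (n, T) (es.map (Prod.mk 0) ++ es.map (Prod.mk 1)) (key :: rs)).1 =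
      (if ∃ e ∈ es, Closes n (sampled c n T key (es.zip rs).reverse) e.1 e.2 then []
        else memory c n T key (es.zip rs).reverse) ∧
    ((algorithm c).detRun (n, T) (es.map (Prod.mk 0) ++ es.map (Prod.mk 1)) (key :: rs)).2 ≤
      B := by
  obtain ⟨r1, r2, rfl, h1⟩ : ∃ r1 r2, rs = r1 ++ r2 ∧ es.length = r1.length :=
    ⟨rs.take es.length, rs.drop es.length, (List.take_append_drop _ _).symm, by simp [hlen]⟩
  have h2 : es.length = r2.length := by
    rw [List.length_append] at hlen; omega
  -- `zip` truncates: the random numbers drawn in the second pass play no role.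
  have hz : es.zip (r1 ++ r2) = es.zip r1 := by
    have := List.zip_append (l₁ := es) (l₂ := r1) (r₁ := []) (r₂ := r2) h1
    simpa using this
  rw [hz] at hB ⊢
  have h0 : ((algorithm c).init (n, T) key, memBits ((algorithm c).init (n, T) key)) =
    (memory c n T key [], memBits (memory c n T key [])) := rfl
  unfold StreamingAlgorithm.detRun
  rw [List.tail_cons, List.headI_cons, List.zip_append (by simpa using h1), List.foldl_append, h0]
  obtain ⟨hf1, hf2⟩ := foldl_first_pass c n T key B es r1 [] (memBits (memory c n T key [])) h1
    (by simpa using hB) (hB _ (List.nil_suffix))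
  rw [List.append_nil] at hf1
  generalize ((es.map (Prod.mk 0)).zip r1).foldl ((algorithm c).detStep (n, T))
    (memory c n T key [], memBits (memory c n T key [])) = s at hf1 hf2
  obtain ⟨M, b⟩ := s
  simp only at hf1 hf2
  subst hf1
  obtain ⟨hs1, hs2⟩ := foldl_second_pass c n T es r2 (memory c n T key (es.zip r1).reverse)
    (by simp [memory]) b h2
  exact ⟨by rw [hs1]; rfl, hs2.trans (max_le hf2 (hB _ List.suffix_rfl))⟩

/-! ### The stored edges -/

theorem encodeEdge_div {n u v : ℕ} (j : ℕ) (hu : u < n) (hv : v < n) :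
    encodeEdge n j u v / (n * n) = j := by
  have h : u * n + v < n * n := by nlinarith
  rw [encodeEdge, add_assoc, mul_comm j, Nat.mul_add_div (by omega), Nat.div_eq_of_lt h, add_zero]

theorem encodeEdge_mod {n v : ℕ} (j u : ℕ) (hv : v < n) : encodeEdge n j u v % n = v := by
  have h : encodeEdge n j u v = v + n * (j * n + u) := by unfold encodeEdge; ring
  rw [h, Nat.add_mul_mod_self_left, Nat.mod_eq_of_lt hv]

theorem encodeEdge_div_mod {n u v : ℕ} (j : ℕ) (hu : u < n) (hv : v < n) :
    encodeEdge n j u v / n % n = u := by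
  have h : encodeEdge n j u v = n * (j * n + u) + v := by unfold encodeEdge; ring
  rw [h, Nat.mul_add_div (by omega), Nat.div_eq_of_lt hv, add_zero, mul_comm j,
    Nat.mul_add_mod, Nat.mod_eq_of_lt hu]

theorem storedIn_collect {c n T m key r u v j : ℕ} (codes : List ℕ) (hu : u < n) (hv : v < n) :
    storedIn n (collect c n T m key codes r u v) j =
      (if j < copies c n ∧ Stores n T m key codes r u v j then 1 else 0) + storedIn n codes j := by
  unfold storedIn collect
  rw [List.filter_append, List.length_append, List.filter_map, List.length_map,
    List.filter_filter]
  congr 1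
  rw [← List.countP_eq_length_filter]
  have : ∀ a, ((((fun z => decide (z / (n * n) = j)) ∘ fun j => encodeEdge n j u v) a &&
      decide (Stores n T m key codes r u v a)) = true) ↔
      ((fun a => a == j && decide (Stores n T m key codes r u v j)) a = true) := by
    intro a
    simp only [Function.comp, encodeEdge_div a hu hv, Bool.and_eq_true, decide_eq_true_eq,
      beq_iff_eq]
    constructor
    · rintro ⟨rfl, h⟩; exact ⟨rfl, h⟩
    · rintro ⟨rfl, h⟩; exact ⟨rfl, h⟩
  rw [List.countP_congr (fun a _ => this a)]
  by_cases hS : Stores n T m key codes r u v j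
  · simp only [hS, decide_true, Bool.and_true, and_true]
    have := List.nodup_range (n := copies c n)
    rw [show List.countP (fun a => a == j) (List.range (copies c n)) =
      List.count j (List.range (copies c n)) from rfl]
    rw [List.Nodup.count this]
    simp
  · simp [hS]

/-- All items of `l` are pairs of numbers below `n`. -/
def InRange (n : ℕ) (l : List ((ℕ × ℕ) × ℕ)) : Prop := ∀ p ∈ l, p.1.1 < n ∧ p.1.2 < n

theorem InRange.of_cons {n : ℕ} {p : (ℕ × ℕ) × ℕ} {l : List ((ℕ × ℕ) × ℕ)}
    (h : InRange n (p :: l)) : InRange n l := fun q hq => h q (List.mem_cons_of_mem _ hq)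

/-- When an edge is stored, this is the capacity test; otherwise only the right side grows. No
randomness enters, so the space bound holds for every outcome. -/
theorem storedIn_sampled_mul_sqrt_le {c n T key : ℕ} {l : List ((ℕ × ℕ) × ℕ)} (hl : InRange n l)
    (j : ℕ) : storedIn n (sampled c n T key l) j * Nat.sqrt T ≤ capFactor n * l.length := by
  induction l with
  | nil => simp [sampled, storedIn]
  | cons p l ih =>
    obtain ⟨hu, hv⟩ := hl p (by simp)
    rw [sampled, storedIn_collect _ hu hv, List.length_cons]
    split_ifs with h
    · rw [add_comm]; exact h.2.2
    · rw [zero_add]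
      exact (ih hl.of_cons).trans (Nat.mul_le_mul_left _ (Nat.le_succ _))

theorem mem_sampled {c n T key : ℕ} {l : List ((ℕ × ℕ) × ℕ)} {z : ℕ}
    (hz : z ∈ sampled c n T key l) :
    ∃ p ∈ l, ∃ j < copies c n, z = encodeEdge n j p.1.1 p.1.2 := by
  induction l with
  | nil => simp [sampled] at hz
  | cons p l ih =>
    rw [sampled, collect, List.mem_append, List.mem_map] at hz
    rcases hz with ⟨j, hj, rfl⟩ | hz
    · rw [List.mem_filter, List.mem_range] at hj
      exact ⟨p, by simp, j, hj.1, rfl⟩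
    · obtain ⟨q, hq, h⟩ := ih hz
      exact ⟨q, by simp [hq], h⟩

theorem length_sampled_mul_sqrt_le {c n T key : ℕ} {l : List ((ℕ × ℕ) × ℕ)} (hl : InRange n l) :
    (sampled c n T key l).length * Nat.sqrt T ≤ copies c n * (capFactor n * l.length) := by
  have h : (sampled c n T key l).length =
      ∑ j ∈ Finset.range (copies c n), storedIn n (sampled c n T key l) j := by
    have hmap : ∀ z ∈ sampled c n T key l, z / (n * n) < copies c n := by
      intro z hz
      obtain ⟨p, hp, j, hj, rfl⟩ := mem_sampled hz
      obtain ⟨hu, hv⟩ := hl p hp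
      rwa [encodeEdge_div j hu hv]
    generalize sampled c n T key l = L at hmap
    induction L with
    | nil => simp [storedIn]
    | cons z L ih =>
      have hz := hmap z (by simp)
      rw [List.length_cons, ih fun y hy => hmap y (by simp [hy])]
      have : ∀ j, storedIn n (z :: L) j =
          storedIn n L j + if z / (n * n) = j then 1 else 0 := by
        intro j
        unfold storedIn
        rw [List.filter_cons]
        by_cases h : z / (n * n) = j <;> simp [h]
      simp only [this, Finset.sum_add_distrib]
      simp [hz]
  rw [h, Finset.sum_mul]
  calc _ ≤ ∑ _j ∈ Finset.range (copies c n), capFactor n * l.length :=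
        Finset.sum_le_sum fun j _ => storedIn_sampled_mul_sqrt_le hl j
    _ = _ := by simp

theorem storedAdj_sampled {c n T key : ℕ} {l : List ((ℕ × ℕ) × ℕ)} (hl : InRange n l) {u v : ℕ}
    (h : StoredAdj n (sampled c n T key l) u v) :
    ∃ p ∈ l, (p.1.1 = u ∧ p.1.2 = v) ∨ (p.1.1 = v ∧ p.1.2 = u) := by
  obtain ⟨z, hz, h⟩ := h
  obtain ⟨p, hp, j, -, rfl⟩ := mem_sampled hz
  obtain ⟨hu, hv⟩ := hl p hp
  rw [encodeEdge_div_mod j hu hv, encodeEdge_mod j _ hv] at h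
  exact ⟨p, hp, h⟩

/-- The items that copy `j` would store if there were no bound on their number. -/
def kept (n T j key : ℕ) (l : List ((ℕ × ℕ) × ℕ)) : List ((ℕ × ℕ) × ℕ) :=
  l.filter fun p => Keep n T j key p.2 p.1.1 p.1.2

theorem storedIn_sampled_le {c n T j key : ℕ} {l : List ((ℕ × ℕ) × ℕ)} (hl : InRange n l) :
    storedIn n (sampled c n T key l) j ≤ (kept n T j key l).length := by
  induction l with
  | nil => simp [sampled, storedIn]
  | cons p l ih =>
    obtain ⟨hu, hv⟩ := hl p (by simp)
    rw [sampled, storedIn_collect _ hu hv, kept, List.filter_cons]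
    have := ih hl.of_cons
    rw [kept] at this
    split_ifs with h1 h2 h2
    · rw [List.length_cons]; omega
    · exact absurd h1.2.1 (by simpa using h2)
    · rw [List.length_cons]; omega
    · omega

/-- A copy never stores more than it would without a capacity. If the unrestricted procedure stays
within the capacity at all times, the test therefore never rejects an edge. -/
theorem mem_sampled_of_keep {c n T j key : ℕ} {l : List ((ℕ × ℕ) × ℕ)} (hl : InRange n l)
    (hj : j < copies c n)
    (hcap : ∀ l', l' <:+ l → (kept n T j key l').length * Nat.sqrt T ≤ capFactor n * l'.length)
    {p : (ℕ × ℕ) × ℕ} (hp : p ∈ l) (hk : Keep n T j key p.2 p.1.1 p.1.2) :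
    encodeEdge n j p.1.1 p.1.2 ∈ sampled c n T key l := by
  induction l with
  | nil => simp at hp
  | cons q l ih =>
    rw [sampled, collect, List.mem_append]
    rw [List.mem_cons] at hp
    rcases hp with rfl | hp
    · left
      rw [List.mem_map]
      refine ⟨j, ?_, rfl⟩
      rw [List.mem_filter, List.mem_range]
      refine ⟨hj, ?_⟩
      have h := hcap _ List.suffix_rfl
      rw [kept, List.filter_cons_of_pos (by simpa using hk), List.length_cons] at h
      refine decide_eq_true ⟨hk, le_trans (Nat.mul_le_mul_right _ ?_) h⟩
      exact Nat.succ_le_succ (storedIn_sampled_le hl.of_cons)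
    · right
      exact ih hl.of_cons (fun l' hl' => hcap l' (hl'.trans (List.suffix_cons _ _))) hp

theorem storedAdj_of_keep {c n T j key : ℕ} {l : List ((ℕ × ℕ) × ℕ)} (hl : InRange n l)
    (hj : j < copies c n)
    (hcap : ∀ l', l' <:+ l → (kept n T j key l').length * Nat.sqrt T ≤ capFactor n * l'.length)
    {p : (ℕ × ℕ) × ℕ} (hp : p ∈ l) (hk : Keep n T j key p.2 p.1.1 p.1.2) :
    StoredAdj n (sampled c n T key l) p.1.1 p.1.2 ∧
      StoredAdj n (sampled c n T key l) p.1.2 p.1.1 := by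
  obtain ⟨hu, hv⟩ := hl p hp
  have hz := mem_sampled_of_keep hl hj hcap hp hk
  exact ⟨⟨_, hz, Or.inl ⟨encodeEdge_div_mod j hu hv, encodeEdge_mod j _ hv⟩⟩,
    ⟨_, hz, Or.inr ⟨encodeEdge_div_mod j hu hv, encodeEdge_mod j _ hv⟩⟩⟩

end FourCycle

open Finset

set_option linter.unusedSectionVars false

namespace FourCycle

/-! ### Fibers of projections -/

section Fibers

variable {α β γ : Type*} [DecidableEq α] [DecidableEq β] [DecidableEq γ]

/-- The number of elements of `F` that have the same image under `π` as `f`. -/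
def fiberCard (F : Finset α) (π : α → β) (f : α) : ℕ := (F.filter fun g => π g = π f).card

theorem fiberCard_mono {F F' : Finset α} (h : F' ⊆ F) (π : α → β) (f : α) :
    fiberCard F' π f ≤ fiberCard F π f := card_le_card (filter_subset_filter _ h)

/-- The fibers over different values are disjoint. They are counted in the large family `F`, so
lower bounds on fibers survive the passage to a subfamily `F'`. -/
theorem card_image_mul_le {F F' : Finset α} (π : α → β) {m : ℕ}
    (hm : ∀ f ∈ F', m ≤ fiberCard F π f) : (F'.image π).card * m ≤ F.card := by
  have h1 : ∑ k ∈ F'.image π, (F.filter fun g => π g = k).card ≤ F.card := by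
    rw [← card_biUnion]
    · exact card_le_card (biUnion_subset.2 fun _ _ => filter_subset _ _)
    · intro x _ y _ hxy
      exact disjoint_filter.2 fun g _ h1 h2 => hxy (h1.symm.trans h2)
  refine le_trans ?_ h1
  rw [← smul_eq_mul]
  refine card_nsmul_le_sum _ _ _ fun k hk => ?_
  obtain ⟨f, hf, rfl⟩ := mem_image.1 hk
  exact hm f hf

theorem card_le_card_image_mul {F : Finset α} (π : α → β) {m : ℕ}
    (hm : ∀ f ∈ F, fiberCard F π f ≤ m) : F.card ≤ (F.image π).card * m := by
  rw [mul_comm]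
  refine card_le_mul_card_image F m fun k hk => ?_
  obtain ⟨f, hf, rfl⟩ := mem_image.1 hk
  exact hm f hf

theorem card_image_prodMk_le (F : Finset α) (π : α → β) (ρ : α → γ) :
    (F.image fun f => (π f, ρ f)).card ≤ (F.image π).card * (F.image ρ).card := by
  rw [← card_product]
  refine card_le_card fun x hx => ?_
  obtain ⟨f, hf, rfl⟩ := mem_image.1 hx
  exact mem_product.2 ⟨mem_image_of_mem _ hf, mem_image_of_mem _ hf⟩

/-- Dyadic pigeonhole: classify the members by the binary logarithms of all their fiber sizes, and
take the largest of the `K ^ card ι` classes. -/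
theorem exists_fiber_bounds {F F₁ : Finset α} (hF : F₁ ⊆ F) {K : ℕ} (hK : F.card < 2 ^ K)
    {ι : Type*} [Fintype ι] [DecidableEq ι] {κ : ι → Type*} [∀ i, DecidableEq (κ i)]
    (π : ∀ i, α → κ i) (hF₁ : F₁.Nonempty) :
    ∃ F' ⊆ F₁, F₁.card ≤ K ^ Fintype.card ι * F'.card ∧ ∃ m : ι → ℕ,
      ∀ i, ∀ f ∈ F', m i ≤ fiberCard F (π i) f ∧ fiberCard F (π i) f ≤ 2 * m i := by
  have hpos : ∀ i, ∀ f ∈ F₁, fiberCard F (π i) f ≠ 0 := fun i f hf =>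
    Nat.pos_iff_ne_zero.1 (card_pos.2 ⟨f, mem_filter.2 ⟨hF hf, rfl⟩⟩)
  have hKpos : 0 < K := by
    rcases Nat.eq_zero_or_pos K with rfl | h
    · have := card_pos.2 (hF₁.mono hF)
      simp at hK
      simp [hK] at this
    · exact h
  -- The default value never occurs on `F₁`, since its members have fibers of size between `1` and
  -- `2 ^ K - 1`.
  let φ : α → ι → Fin K := fun f i =>
    if h : Nat.log 2 (fiberCard F (π i) f) < K then ⟨_, h⟩ else ⟨0, hKpos⟩
  have hφ : ∀ f ∈ F₁, ∀ i, (φ f i : ℕ) = Nat.log 2 (fiberCard F (π i) f) := by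
    intro f hf i
    have : Nat.log 2 (fiberCard F (π i) f) < K :=
      Nat.log_lt_of_lt_pow (hpos i f hf) (lt_of_le_of_lt (card_le_card (filter_subset _ _)) hK)
    simp [φ, this]
  obtain ⟨y, -, hy⟩ := exists_max_image (univ : Finset (ι → Fin K))
    (fun y => (F₁.filter fun f => φ f = y).card) ⟨fun _ => ⟨0, hKpos⟩, mem_univ _⟩
  refine ⟨F₁.filter fun f => φ f = y, filter_subset _ _, ?_, fun i => 2 ^ (y i : ℕ), ?_⟩
  · have h1 := card_eq_sum_card_fiberwise (s := F₁) (t := univ) (f := φ) (fun _ _ => mem_univ _)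
    rw [h1]
    refine (sum_le_card_nsmul _ _ _ fun x _ => hy x (mem_univ _)).trans ?_
    simp
  · intro i f hf
    obtain ⟨hf₁, rfl⟩ := mem_filter.1 hf
    beta_reduce
    rw [hφ f hf₁ i]
    refine ⟨Nat.pow_log_le_self 2 (hpos i f hf₁), ?_⟩
    rw [← pow_succ']
    exact (Nat.lt_pow_succ_log_self (by norm_num) _).le

end Fibers

/-! ### Regular families of quadruples -/

section Quadruples

variable {V : Type*} [DecidableEq V]

abbrev Quad (V : Type*) := V × V × V × V

abbrev projA (f : Quad V) : V := f.1
abbrev projB (f : Quad V) : V := f.2.1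
abbrev projC (f : Quad V) : V := f.2.2.1
abbrev projD (f : Quad V) : V := f.2.2.2
abbrev projAB (f : Quad V) : V × V := (f.1, f.2.1)
abbrev projBC (f : Quad V) : V × V := (f.2.1, f.2.2.1)
abbrev projCD (f : Quad V) : V × V := (f.2.2.1, f.2.2.2)
abbrev projDA (f : Quad V) : V × V := (f.2.2.2, f.1)
abbrev projABD (f : Quad V) : V × V × V := (f.1, f.2.1, f.2.2.2)
abbrev projACD (f : Quad V) : V × V × V := (f.1, f.2.2.1, f.2.2.2)

/-- `F'` is a family of quadruples with bounds for the number of members that agree with a given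
member in the given coordinates. The bounds `α`, `δ`, `μ` and `ν` for agreement in the first one,
the last one, and all except the third or the second one, are compatible with each other. -/
structure IsRegular (F' : Finset (Quad V)) (N lam α δ μ ν : ℕ) : Prop where
  nonempty : F'.Nonempty
  le_A : ∀ f ∈ F', fiberCard F' projA f ≤ 2 * α
  le_D : ∀ f ∈ F', fiberCard F' projD f ≤ 2 * δ
  le_ABD : ∀ f ∈ F', fiberCard F' projABD f ≤ 2 * μ
  le_ACD : ∀ f ∈ F', fiberCard F' projACD f ≤ 2 * ν
  le_AB : ∀ f ∈ F', fiberCard F' projAB f ≤ lam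
  le_CD : ∀ f ∈ F', fiberCard F' projCD f ≤ lam
  le_DA : ∀ f ∈ F', fiberCard F' projDA f ≤ lam
  mul_AD : α * δ * F'.card ≤ N ^ 2 * lam
  mul_A_ABD : α * μ * F'.card ≤ N ^ 2
  mul_D_ACD : δ * ν * F'.card ≤ N ^ 2
  mul_ABD_ACD : μ * ν * F'.card ≤ N * lam

variable {F F₁ F' : Finset (Quad V)} {lam α δ μ ν : ℕ}

/-- There are at most `F.card / α` first and `F.card / δ` last vertices, and each pair of them
carries at most `lam` members. -/
theorem mul_AD_of_fiberCard (hF : F' ⊆ F) (hlam : ∀ f ∈ F', fiberCard F projDA f ≤ lam)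
    (hα : ∀ f ∈ F', α ≤ fiberCard F projA f) (hδ : ∀ f ∈ F', δ ≤ fiberCard F projD f) :
    α * δ * F'.card ≤ F.card ^ 2 * lam := by
  have h1 := card_le_card_image_mul projDA
    (fun f hf => (fiberCard_mono hF projDA f).trans (hlam f hf))
  have h2 := card_image_prodMk_le F' projD projA
  have h3 := card_image_mul_le projA hα
  have h4 := card_image_mul_le projD hδ
  calc α * δ * F'.card
      ≤ α * δ * ((F'.image projD).card * (F'.image projA).card * lam) :=
        Nat.mul_le_mul_left _ (h1.trans (Nat.mul_le_mul_right _ h2))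
    _ = ((F'.image projA).card * α) * ((F'.image projD).card * δ) * lam := by ring
    _ ≤ F.card * F.card * lam := by gcongr
    _ = _ := by ring

/-- Fix the pair (d, a), and let E be its fiber. At most |E|/μ values of b and |E|/ν values of c
occur in `F'`, so `F'` has at most |E|²/(μν) ≤ |E|·lam/(μν) members there. Sum over the disjoint
fibers. -/
theorem mul_ABD_ACD_of_fiberCard (hF : F' ⊆ F) (hlam : ∀ f ∈ F', fiberCard F projDA f ≤ lam)
    (hμ : ∀ f ∈ F', μ ≤ fiberCard F projABD f) (hν : ∀ f ∈ F', ν ≤ fiberCard F projACD f) :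
    μ * ν * F'.card ≤ F.card * lam := by
  have key : ∀ k ∈ F'.image projDA, μ * ν * (F'.filter fun g => projDA g = k).card ≤
      (F.filter fun g => projDA g = k).card * lam := by
    intro k hk
    obtain ⟨f, hf, rfl⟩ := mem_image.1 hk
    set E := F.filter fun g => projDA g = projDA f
    set E' := F'.filter fun g => projDA g = projDA f
    have hE : E' ⊆ E := filter_subset_filter _ hF
    have hcard : E.card ≤ lam := hlam f hf
    have h1 : (E'.image projABD).card * μ ≤ E.card := by
      refine card_image_mul_le _ fun g hg => (hμ g (mem_of_mem_filter g hg)).trans ?_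
      refine card_le_card fun x hx => ?_
      obtain ⟨hx, hxg⟩ := mem_filter.1 hx
      have hgf := (mem_filter.1 hg).2
      simp only [Prod.mk.injEq] at hxg hgf
      simp only [E, mem_filter, Prod.mk.injEq]
      exact ⟨⟨hx, hxg.2.2.trans hgf.1, hxg.1.trans hgf.2⟩, hxg⟩
    have h2 : (E'.image projACD).card * ν ≤ E.card := by
      refine card_image_mul_le _ fun g hg => (hν g (mem_of_mem_filter g hg)).trans ?_
      refine card_le_card fun x hx => ?_
      obtain ⟨hx, hxg⟩ := mem_filter.1 hx
      have hgf := (mem_filter.1 hg).2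
      simp only [Prod.mk.injEq] at hxg hgf
      simp only [E, mem_filter, Prod.mk.injEq]
      exact ⟨⟨hx, hxg.2.2.trans hgf.1, hxg.1.trans hgf.2⟩, hxg⟩
    have h3 : E'.card ≤ (E'.image projABD).card * (E'.image projACD).card := by
      rw [← card_image_of_injective E' (f := fun f => (projABD f, projACD f))]
      · exact card_image_prodMk_le E' projABD projACD
      · rintro ⟨a, b, c, d⟩ ⟨a', b', c', d'⟩ h
        simp only [Prod.mk.injEq] at h
        simp [h]
    calc μ * ν * E'.card ≤ μ * ν * ((E'.image projABD).card * (E'.image projACD).card) := by gcongr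
      _ = ((E'.image projABD).card * μ) * ((E'.image projACD).card * ν) := by ring
      _ ≤ E.card * lam := Nat.mul_le_mul h1 (h2.trans hcard)
  rw [card_eq_sum_card_image projDA F', mul_sum]
  refine (sum_le_sum key).trans ?_
  rw [← sum_mul]
  refine Nat.mul_le_mul_right _ ?_
  rw [← card_biUnion]
  · exact card_le_card (biUnion_subset.2 fun _ _ => filter_subset _ _)
  · intro x _ y _ hxy
    exact disjoint_filter.2 fun g _ h1 h2 => hxy (h1.symm.trans h2)

/-- A quadruple is determined by c and (a, b, d). The bound `α` is needed for the fibers over c,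
which are at least as large as those over a when the cycle is labelled suitably. -/
theorem mul_A_ABD_of_le_C (hα : ∀ f ∈ F', α ≤ fiberCard F projC f)
    (hμ : ∀ f ∈ F', μ ≤ fiberCard F projABD f) : α * μ * F'.card ≤ F.card ^ 2 := by
  have h1 := card_image_mul_le projC hα
  have h2 := card_image_mul_le projABD hμ
  have h3 : F'.card ≤ (F'.image projC).card * (F'.image projABD).card := by
    rw [← card_image_of_injective F' (f := fun f => (projC f, projABD f))]
    · exact card_image_prodMk_le F' projC projABD
    · rintro ⟨a, b, c, d⟩ ⟨a', b', c', d'⟩ h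
      simp only [Prod.mk.injEq] at h ⊢
      tauto
  calc α * μ * F'.card ≤ α * μ * ((F'.image projC).card * (F'.image projABD).card) := by gcongr
    _ = ((F'.image projC).card * α) * ((F'.image projABD).card * μ) := by ring
    _ ≤ F.card * F.card := Nat.mul_le_mul h1 h2
    _ = _ := by ring

theorem mul_D_ACD_of_le_B (hδ : ∀ f ∈ F', δ ≤ fiberCard F projB f)
    (hν : ∀ f ∈ F', ν ≤ fiberCard F projACD f) : δ * ν * F'.card ≤ F.card ^ 2 := by
  have h1 := card_image_mul_le projB hδ
  have h2 := card_image_mul_le projACD hν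
  have h3 : F'.card ≤ (F'.image projB).card * (F'.image projACD).card := by
    rw [← card_image_of_injective F' (f := fun f => (projB f, projACD f))]
    · exact card_image_prodMk_le F' projB projACD
    · rintro ⟨a, b, c, d⟩ ⟨a', b', c', d'⟩ h
      simp only [Prod.mk.injEq] at h ⊢
      tauto
  calc δ * ν * F'.card ≤ δ * ν * ((F'.image projB).card * (F'.image projACD).card) := by gcongr
    _ = ((F'.image projB).card * δ) * ((F'.image projACD).card * ν) := by ring
    _ ≤ F.card * F.card := Nat.mul_le_mul h1 h2
    _ = _ := by ring

/-- The substitute for the comparison of a with c when the middle pairs are few: each b that occurs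
lies in at least `μ` middle pairs, so there are few values of b, hence few pairs (a, b), each with
at most `lam` members. -/
theorem mul_A_ABD_of_few_BC (hF : F' ⊆ F) (hlam : ∀ f ∈ F', fiberCard F projAB f ≤ lam)
    (hα : ∀ f ∈ F', α ≤ fiberCard F projA f) (hμ : ∀ f ∈ F', μ ≤ fiberCard F projABD f) :
    α * μ * F'.card ≤ F.card * ((F.image projBC).card * lam) := by
  have h1 := card_le_card_image_mul projAB
    (fun f hf => (fiberCard_mono hF projAB f).trans (hlam f hf))
  have h2 := card_image_prodMk_le F' projA projB
  have h3 := card_image_mul_le projA hα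
  have h4 : (F'.image projB).card * μ ≤ (F.image projBC).card := by
    have : F'.image projB ⊆ F.image projB := image_subset_image hF
    have h5 : ∀ b ∈ F'.image projB, μ ≤ ((F.image projBC).filter fun e => e.1 = b).card := by
      intro b hb
      obtain ⟨f, hf, rfl⟩ := mem_image.1 hb
      refine (hμ f hf).trans (card_le_card_of_injOn projBC ?_ ?_)
      · intro x hx
        rw [mem_coe, mem_filter] at hx
        obtain ⟨hx, hxf⟩ := hx
        simp only [Prod.mk.injEq] at hxf
        rw [mem_coe, mem_filter]
        exact ⟨mem_image_of_mem _ hx, hxf.2.1⟩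
      · rintro ⟨a, b, c, d⟩ hx ⟨a', b', c', d'⟩ hy h
        rw [mem_coe, mem_filter] at hx hy
        have := hx.2.trans hy.2.symm
        simp only [Prod.mk.injEq] at h this
        simp [h, this]
    calc (F'.image projB).card * μ
        ≤ ∑ b ∈ F'.image projB, ((F.image projBC).filter fun e => e.1 = b).card := by
          rw [← smul_eq_mul]; exact card_nsmul_le_sum _ _ _ h5
      _ ≤ (F.image projBC).card := by
          rw [← card_biUnion]
          · exact card_le_card (biUnion_subset.2 fun _ _ => filter_subset _ _)
          · intro x _ y _ hxy
            exact disjoint_filter.2 fun g _ h1 h2 => hxy (h1.symm.trans h2)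
  calc α * μ * F'.card
      ≤ α * μ * ((F'.image projA).card * (F'.image projB).card * lam) :=
        Nat.mul_le_mul_left _ (h1.trans (Nat.mul_le_mul_right _ h2))
    _ = ((F'.image projA).card * α) * (((F'.image projB).card * μ) * lam) := by ring
    _ ≤ _ := by gcongr

/-- Reversal of the order of the four coordinates. -/
def reverse (f : Quad V) : Quad V := (f.2.2.2, f.2.2.1, f.2.1, f.1)

theorem reverse_reverse (f : Quad V) : reverse (reverse f) = f := rfl

theorem reverse_injective : Function.Injective (reverse : Quad V → Quad V) :=
  Function.LeftInverse.injective reverse_reverse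

theorem fiberCard_image_reverse {β γ : Type*} [DecidableEq β] [DecidableEq γ] (F : Finset (Quad V))
    (π : Quad V → β) (ρ : Quad V → γ)
    (h : ∀ f g, π (reverse f) = π (reverse g) ↔ ρ f = ρ g) (f : Quad V) :
    fiberCard (F.image reverse) π (reverse f) = fiberCard F ρ f := by
  unfold fiberCard
  rw [filter_image, card_image_of_injective _ reverse_injective]
  congr 1
  exact filter_congr fun g _ => h g f

theorem mul_D_ACD_of_few_BC (hF : F' ⊆ F) (hlam : ∀ f ∈ F', fiberCard F projCD f ≤ lam)
    (hδ : ∀ f ∈ F', δ ≤ fiberCard F projD f) (hν : ∀ f ∈ F', ν ≤ fiberCard F projACD f) :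
    δ * ν * F'.card ≤ F.card * ((F.image projBC).card * lam) := by
  have h := mul_A_ABD_of_few_BC (F := F.image reverse) (F' := F'.image reverse) (lam := lam)
    (α := δ) (μ := ν) (image_subset_image hF) ?_ ?_ ?_
  · rw [card_image_of_injective _ reverse_injective, card_image_of_injective _ reverse_injective,
      image_image] at h
    have : F.image (projBC ∘ reverse) = (F.image projBC).image Prod.swap := by
      rw [image_image]; rfl
    rwa [this, card_image_of_injective _ Prod.swap_injective] at h
  · intro f hf
    obtain ⟨g, hg, rfl⟩ := mem_image.1 hf
    rw [fiberCard_image_reverse F projAB projCD]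
    · exact hlam g hg
    · intro f g; simp [reverse, Prod.ext_iff, and_comm]
  · intro f hf
    obtain ⟨g, hg, rfl⟩ := mem_image.1 hf
    rw [fiberCard_image_reverse F projA projD]
    · exact hδ g hg
    · intro f g; simp [reverse]
  · intro f hf
    obtain ⟨g, hg, rfl⟩ := mem_image.1 hf
    rw [fiberCard_image_reverse F projABD projACD]
    · exact hν g hg
    · intro f g; simp [reverse, Prod.ext_iff]; tauto

/-- A large family of quadruples that is light in the three pairs of coordinates except the middle
one has a large regular subfamily if it satisfies one of two conditions. -/
theorem exists_isRegular {N K : ℕ} (hF : F₁ ⊆ F) (hN : F.card ≤ N) (hK : N < 2 ^ K)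
    (hne : F₁.Nonempty) (hAB : ∀ f ∈ F₁, fiberCard F projAB f ≤ lam)
    (hCD : ∀ f ∈ F₁, fiberCard F projCD f ≤ lam) (hDA : ∀ f ∈ F₁, fiberCard F projDA f ≤ lam)
    (h : (∀ f ∈ F₁, fiberCard F projA f ≤ fiberCard F projC f ∧
        fiberCard F projD f ≤ fiberCard F projB f) ∨ (F.image projBC).card * lam ≤ N) :
    ∃ F' ⊆ F₁, F₁.card ≤ K ^ 4 * F'.card ∧ ∃ α δ μ ν, IsRegular F' N lam α δ μ ν := by
  -- The four projections get a common codomain by putting `none` in place of forgotten coordinates.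
  obtain ⟨F', hF', hcard, m, hm⟩ := exists_fiber_bounds hF (hN.trans_lt hK)
    (ι := Fin 4) (κ := fun _ => Option V × Option V × Option V × Option V)
    (![fun f => (some f.1, none, none, none), fun f => (none, none, none, some f.2.2.2),
      fun f => (some f.1, some f.2.1, none, some f.2.2.2),
      fun f => (some f.1, none, some f.2.2.1, some f.2.2.2)]) hne
  rw [Fintype.card_fin] at hcard
  have hFF := hF'.trans hF
  have h0 : ∀ f ∈ F', m 0 ≤ fiberCard F projA f ∧ fiberCard F projA f ≤ 2 * m 0 := by
    simpa [fiberCard, Prod.ext_iff] using hm 0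
  have h1 : ∀ f ∈ F', m 1 ≤ fiberCard F projD f ∧ fiberCard F projD f ≤ 2 * m 1 := by
    simpa [fiberCard, Prod.ext_iff] using hm 1
  have h2 : ∀ f ∈ F', m 2 ≤ fiberCard F projABD f ∧ fiberCard F projABD f ≤ 2 * m 2 := by
    simpa [fiberCard, Prod.ext_iff] using hm 2
  have h3 : ∀ f ∈ F', m 3 ≤ fiberCard F projACD f ∧ fiberCard F projACD f ≤ 2 * m 3 := by
    simpa [fiberCard, Prod.ext_iff] using hm 3
  have hne' : F'.Nonempty := by
    rw [nonempty_iff_ne_empty]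
    rintro rfl
    simp at hcard
    exact hne.ne_empty hcard
  refine ⟨F', hF', hcard, m 0, m 1, m 2, m 3, hne',
    fun f hf => (fiberCard_mono hFF _ _).trans (h0 f hf).2,
    fun f hf => (fiberCard_mono hFF _ _).trans (h1 f hf).2,
    fun f hf => (fiberCard_mono hFF _ _).trans (h2 f hf).2,
    fun f hf => (fiberCard_mono hFF _ _).trans (h3 f hf).2,
    fun f hf => (fiberCard_mono hFF _ _).trans (hAB f (hF' hf)),
    fun f hf => (fiberCard_mono hFF _ _).trans (hCD f (hF' hf)),
    fun f hf => (fiberCard_mono hFF _ _).trans (hDA f (hF' hf)), ?_, ?_, ?_, ?_⟩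
  · refine (mul_AD_of_fiberCard hFF (fun f hf => hDA f (hF' hf)) (fun f hf => (h0 f hf).1)
      (fun f hf => (h1 f hf).1)).trans ?_
    gcongr
  · rcases h with h | h
    · refine (mul_A_ABD_of_le_C (fun f hf => (h0 f hf).1.trans (h f (hF' hf)).1)
        (fun f hf => (h2 f hf).1)).trans ?_
      gcongr
    · refine (mul_A_ABD_of_few_BC hFF (fun f hf => hAB f (hF' hf)) (fun f hf => (h0 f hf).1)
        (fun f hf => (h2 f hf).1)).trans ?_
      rw [sq]
      gcongr
  · rcases h with h | h
    · refine (mul_D_ACD_of_le_B (fun f hf => (h1 f hf).1.trans (h f (hF' hf)).2)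
        (fun f hf => (h3 f hf).1)).trans ?_
      gcongr
    · refine (mul_D_ACD_of_few_BC hFF (fun f hf => hCD f (hF' hf)) (fun f hf => (h1 f hf).1)
        (fun f hf => (h3 f hf).1)).trans ?_
      rw [sq]
      gcongr
  · refine (mul_ABD_ACD_of_fiberCard hFF (fun f hf => hDA f (hF' hf)) (fun f hf => (h2 f hf).1)
      (fun f hf => (h3 f hf).1)).trans ?_
    gcongr

end Quadruples

/-! ### Labelled four-cycles, heavy edges, and the extraction of a regular family -/

section Graph

variable {V : Type*} [Fintype V] [DecidableEq V] (G : SimpleGraph V)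

/-- `f` consists of the vertices of a four-cycle, in their order on it. -/
def IsC4 (f : Quad V) : Prop :=
  G.Adj f.1 f.2.1 ∧ G.Adj f.2.1 f.2.2.1 ∧ G.Adj f.2.2.1 f.2.2.2 ∧ G.Adj f.2.2.2 f.1 ∧
    f.1 ≠ f.2.2.1 ∧ f.2.1 ≠ f.2.2.2

open Classical in
/-- The labelled four-cycles of `G`. -/
noncomputable def c4s : Finset (Quad V) := univ.filter (IsC4 G)

variable {G}

theorem mem_c4s {f : Quad V} : f ∈ c4s G ↔ IsC4 G f := by simp [c4s]

/-- Rotation of the four coordinates. -/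
def rotate (f : Quad V) : Quad V := (f.2.1, f.2.2.1, f.2.2.2, f.1)

/-- Exchange of the first and the third coordinate. -/
def swapAC (f : Quad V) : Quad V := (f.2.2.1, f.2.1, f.1, f.2.2.2)

/-- Exchange of the second and the last coordinate. -/
def swapBD (f : Quad V) : Quad V := (f.1, f.2.2.2, f.2.2.1, f.2.1)

theorem rotate_mem {f : Quad V} : rotate f ∈ c4s G ↔ f ∈ c4s G := by
  simp only [mem_c4s, IsC4, rotate]
  have := fun u v : V => G.adj_comm u v
  have := fun u v : V => (ne_comm : u ≠ v ↔ v ≠ u)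
  grind

theorem swapAC_mem {f : Quad V} : swapAC f ∈ c4s G ↔ f ∈ c4s G := by
  simp only [mem_c4s, IsC4, swapAC]
  have := fun u v : V => G.adj_comm u v
  grind

theorem swapBD_mem {f : Quad V} : swapBD f ∈ c4s G ↔ f ∈ c4s G := by
  simp only [mem_c4s, IsC4, swapBD]
  have := fun u v : V => G.adj_comm u v
  grind

/-- By finiteness an injective `σ` is bijective; it need not be an involution, and rotations are
admitted. -/
theorem card_filter_of_involutive {σ : Quad V → Quad V} (hσ : Function.Injective σ)
    (hmem : ∀ f, σ f ∈ c4s G ↔ f ∈ c4s G) (p q : Quad V → Prop) [DecidablePred p]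
    [DecidablePred q] (h : ∀ f, p f ↔ q (σ f)) :
    ((c4s G).filter p).card = ((c4s G).filter q).card := by
  have hs := Finite.injective_iff_surjective.1 hσ
  refine card_bij' (fun f _ => σ f) (fun f _ => Function.surjInv hs f) ?_ ?_ ?_ ?_
  · intro f hf
    rw [mem_filter] at hf ⊢
    exact ⟨(hmem f).2 hf.1, (h f).1 hf.2⟩
  · intro f hf
    rw [mem_filter] at hf ⊢
    rw [← hmem, h, Function.surjInv_eq hs]
    exact hf
  · intro f _
    exact hσ (Function.surjInv_eq hs _)
  · intro f _
    exact Function.surjInv_eq hs _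

theorem rotate_injective : Function.Injective (rotate : Quad V → Quad V) := by
  rintro ⟨a, b, c, d⟩ ⟨a', b', c', d'⟩ h
  simp only [rotate, Prod.mk.injEq] at h ⊢
  tauto

theorem swapAC_injective : Function.Injective (swapAC : Quad V → Quad V) := by
  rintro ⟨a, b, c, d⟩ ⟨a', b', c', d'⟩ h
  simp only [swapAC, Prod.mk.injEq] at h ⊢
  tauto

theorem swapBD_injective : Function.Injective (swapBD : Quad V → Quad V) := by
  rintro ⟨a, b, c, d⟩ ⟨a', b', c', d'⟩ h
  simp only [swapBD, Prod.mk.injEq] at h ⊢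
  tauto

variable (G) in
/-- The number of labelled four-cycles that start with the vertices `u` and `v`. -/
noncomputable def edgeCount (u v : V) : ℕ := ((c4s G).filter fun f => projAB f = (u, v)).card

theorem fiberCard_projAB (f : Quad V) : fiberCard (c4s G) projAB f = edgeCount G f.1 f.2.1 := rfl

theorem fiberCard_projCD (f : Quad V) :
    fiberCard (c4s G) projCD f = edgeCount G f.2.2.1 f.2.2.2 :=
  card_filter_of_involutive (σ := fun f => rotate (rotate f))
    (rotate_injective.comp rotate_injective)
    (fun _ => by rw [rotate_mem, rotate_mem]) _ _ fun g => by simp [rotate]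

theorem fiberCard_projDA (f : Quad V) :
    fiberCard (c4s G) projDA f = edgeCount G f.2.2.2 f.1 :=
  card_filter_of_involutive (σ := fun f => rotate (rotate (rotate f)))
    (rotate_injective.comp (rotate_injective.comp rotate_injective))
    (fun _ => by rw [rotate_mem, rotate_mem, rotate_mem]) _ _ fun g => by simp [rotate]

theorem edgeCount_comm (u v : V) : edgeCount G u v = edgeCount G v u :=
  card_filter_of_involutive (σ := fun f => swapBD (rotate f))
    (swapBD_injective.comp rotate_injective)
    (fun _ => by rw [swapBD_mem, rotate_mem]) _ _ fun g => by
      simp only [rotate, swapBD, Prod.mk.injEq]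
      tauto

theorem fiberCard_projC (f : Quad V) :
    fiberCard (c4s G) projC f = ((c4s G).filter fun g => projA g = projC f).card :=
  card_filter_of_involutive swapAC_injective (fun _ => swapAC_mem) _ _ fun g => by simp [swapAC]

theorem fiberCard_projB (f : Quad V) :
    fiberCard (c4s G) projB f = ((c4s G).filter fun g => projD g = projB f).card :=
  card_filter_of_involutive swapBD_injective (fun _ => swapBD_mem) _ _ fun g => by simp [swapBD]

variable (G) in
/-- The ordered pairs that start more than `lam` labelled four-cycles. -/
noncomputable def heavyPairs (lam : ℕ) : Finset (V × V) :=
  univ.filter fun e => lam < edgeCount G e.1 e.2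

theorem mem_heavyPairs {lam : ℕ} {e : V × V} :
    e ∈ heavyPairs G lam ↔ lam < edgeCount G e.1 e.2 := by simp [heavyPairs]

theorem swap_mem_heavyPairs {lam : ℕ} {u v : V} :
    (u, v) ∈ heavyPairs G lam ↔ (v, u) ∈ heavyPairs G lam := by
  rw [mem_heavyPairs, mem_heavyPairs, edgeCount_comm]

theorem card_heavyPairs_mul_le (lam : ℕ) : (heavyPairs G lam).card * lam ≤ (c4s G).card := by
  have h : heavyPairs G lam ⊆
      ((c4s G).filter fun f => projAB f ∈ heavyPairs G lam).image projAB := by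
    intro e he
    have : 0 < edgeCount G e.1 e.2 := (Nat.zero_le _).trans_lt (mem_heavyPairs.1 he)
    obtain ⟨f, hf⟩ := card_pos.1 this
    obtain ⟨hf, hfe⟩ := mem_filter.1 hf
    refine mem_image.2 ⟨f, mem_filter.2 ⟨hf, ?_⟩, hfe⟩
    rwa [hfe]
  refine (Nat.mul_le_mul_right _ (card_le_card h)).trans (card_image_mul_le projAB ?_)
  intro f hf
  exact (mem_heavyPairs.1 (mem_filter.1 hf).2).le

/-- Two opposite sides determine the labelled cycle. -/
theorem card_opposite_heavy_le (lam : ℕ) :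
    ((c4s G).filter fun f => projAB f ∈ heavyPairs G lam ∧ projCD f ∈ heavyPairs G lam).card ≤
      (heavyPairs G lam).card ^ 2 := by
  rw [sq, ← card_product]
  refine card_le_card_of_injOn (fun f => (projAB f, projCD f)) ?_ ?_
  · intro f hf
    rw [mem_coe, mem_filter] at hf
    exact mem_product.2 hf.2
  · rintro ⟨a, b, c, d⟩ _ ⟨a', b', c', d'⟩ _ h
    simp only [Prod.mk.injEq] at h ⊢
    tauto

/-- The four-cycles with two adjacent heavy edges are bounded by the Cauchy–Schwarz inequality for
the sum over pairs of opposite vertices. -/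
theorem card_adjacent_heavy_sq_le (lam : ℕ) :
    ((c4s G).filter fun f => projAB f ∈ heavyPairs G lam ∧ projBC f ∈ heavyPairs G lam).card ^ 2 ≤
      (heavyPairs G lam).card ^ 2 * (c4s G).card := by
  classical
  set H := heavyPairs G lam
  set W := (c4s G).filter fun f => projAB f ∈ H ∧ projBC f ∈ H with hW
  let N : V × V → Finset V := fun p => univ.filter fun b => G.Adj p.1 b ∧ G.Adj b p.2
  let M : V × V → Finset V := fun p =>
    univ.filter fun b => ((p.1, b) ∈ H ∧ (b, p.2) ∈ H) ∧ b ∈ N p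
  let P : Finset (V × V) := univ.filter fun p => p.1 ≠ p.2
  let ac : Quad V → V × V := fun f => (f.1, f.2.2.1)
  have hP : ∀ f ∈ c4s G, ac f ∈ P := fun f hf => by
    simpa [P, ac] using (mem_c4s.1 hf).2.2.2.2.1
  -- For a fixed diagonal (a, c), the choices of (b, d) are the ordered pairs of distinct common
  -- neighbours.
  have hc4 : (c4s G).card = ∑ p ∈ P, (N p).card * ((N p).card - 1) := by
    rw [card_eq_sum_card_fiberwise (f := ac) (t := P) hP]
    refine sum_congr rfl fun p hp => ?_
    have hp : p.1 ≠ p.2 := by simpa [P] using hp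
    rw [Nat.mul_sub_one, ← offDiag_card]
    refine card_bij' (fun f _ => (f.2.1, f.2.2.2)) (fun x _ => (p.1, x.1, p.2, x.2)) ?_ ?_ ?_ ?_
    · intro f hf
      obtain ⟨hf₁, rfl⟩ := mem_filter.1 hf
      have := mem_c4s.1 hf₁
      simp only [mem_offDiag, N, mem_filter, mem_univ, true_and, ac]
      exact ⟨⟨this.1, this.2.1⟩, ⟨this.2.2.2.1.symm, this.2.2.1.symm⟩, this.2.2.2.2.2⟩
    · intro x hx
      simp only [mem_offDiag, N, mem_filter, mem_univ, true_and] at hx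
      refine mem_filter.2 ⟨mem_c4s.2 ⟨hx.1.1, hx.1.2, hx.2.1.2.symm, hx.2.1.1.symm, hp, hx.2.2⟩,
        rfl⟩
    · intro f hf
      obtain ⟨hf, rfl⟩ := mem_filter.1 hf
      rfl
    · intro x hx
      rfl
  have hWcard : W.card ≤ ∑ p ∈ P, (M p).card * ((N p).card - 1) := by
    rw [card_eq_sum_card_fiberwise (f := ac) (t := P) fun f hf => hP f (mem_filter.1 hf).1]
    refine sum_le_sum fun p hp => ?_
    have h1 : ∀ b ∈ M p, ((N p).erase b).card = (N p).card - 1 := fun b hb =>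
      card_erase_of_mem (mem_filter.1 hb).2.2
    rw [← smul_eq_mul, ← sum_const, ← sum_congr rfl h1, ← card_sigma]
    refine card_le_card_of_injOn (fun f => ⟨f.2.1, f.2.2.2⟩) ?_ ?_
    · intro f hf
      rw [mem_coe, mem_filter, mem_filter] at hf
      obtain ⟨⟨hf₁, hH⟩, rfl⟩ := hf
      have := mem_c4s.1 hf₁
      simp only [coe_sigma, Set.mem_sigma_iff, mem_coe, mem_erase, N, M, mem_filter, mem_univ,
        true_and, ac]
      exact ⟨⟨hH, this.1, this.2.1⟩, this.2.2.2.2.2.symm, this.2.2.2.1.symm, this.2.2.1.symm⟩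
    · rintro ⟨a, b, c, d⟩ hf ⟨a', b', c', d'⟩ hf' h
      rw [mem_coe, mem_filter] at hf hf'
      have h2 := hf.2.trans hf'.2.symm
      simp only [ac, Prod.mk.injEq, Sigma.mk.injEq, heq_eq_eq] at h h2 ⊢
      tauto
  -- Two middle vertices b, b' of heavy paths from a to c give the heavy pairs (a, b) and (b', c),
  -- which determine a, b, b' and c.
  have hM : ∑ p ∈ P, (M p).card ^ 2 ≤ H.card ^ 2 := by
    rw [sq, ← card_product]
    have : ∑ p ∈ P, (M p).card ^ 2 = (P.sigma fun p => M p ×ˢ M p).card := by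
      rw [card_sigma]
      exact sum_congr rfl fun p _ => by rw [card_product, sq]
    rw [this]
    refine card_le_card_of_injOn (fun x => ((x.1.1, x.2.1), (x.2.2, x.1.2))) ?_ ?_
    · intro x hx
      simp only [coe_sigma, Set.mem_sigma_iff, mem_coe, mem_product, M, mem_filter, mem_univ,
        true_and] at hx ⊢
      exact ⟨hx.2.1.1.1, hx.2.2.1.2⟩
    · rintro ⟨⟨a, c⟩, b, b'⟩ _ ⟨⟨a', c'⟩, d, d'⟩ _ h
      simp only [Prod.mk.injEq] at h
      obtain ⟨⟨rfl, rfl⟩, rfl, rfl⟩ := h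
      rfl
  have hN : ∑ p ∈ P, ((N p).card - 1) ^ 2 ≤ (c4s G).card := by
    rw [hc4]
    refine sum_le_sum fun p _ => ?_
    rw [sq]
    exact Nat.mul_le_mul_right _ (Nat.sub_le _ _)
  calc W.card ^ 2 ≤ (∑ p ∈ P, (M p).card * ((N p).card - 1)) ^ 2 := Nat.pow_le_pow_left hWcard 2
    _ ≤ (∑ p ∈ P, (M p).card ^ 2) * ∑ p ∈ P, ((N p).card - 1) ^ 2 := by
        have := sum_mul_sq_le_sq_mul_sq P (fun p => ((M p).card : ℝ))
          (fun p => (((N p).card - 1 : ℕ) : ℝ))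
        exact_mod_cast this
    _ ≤ _ := Nat.mul_le_mul hM hN

/-- The four-cycles that are light in all pairs of consecutive coordinates. -/
noncomputable def lightC4s (G : SimpleGraph V) (lam : ℕ) : Finset (Quad V) :=
  (c4s G).filter fun f => projAB f ∉ heavyPairs G lam ∧ projBC f ∉ heavyPairs G lam ∧
    projCD f ∉ heavyPairs G lam ∧ projDA f ∉ heavyPairs G lam

/-- The four-cycles whose only heavy pair of consecutive coordinates is the middle one. -/
noncomputable def heavyBCs (G : SimpleGraph V) (lam : ℕ) : Finset (Quad V) :=
  (c4s G).filter fun f => projAB f ∉ heavyPairs G lam ∧ projBC f ∈ heavyPairs G lam ∧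
    projCD f ∉ heavyPairs G lam ∧ projDA f ∉ heavyPairs G lam

/-- A cycle has no heavy side, exactly one, or two that are opposite or adjacent. The coefficients
count the rotations that bring the heavy sides to the standard position. -/
theorem card_c4s_le_light_add (lam : ℕ) :
    (c4s G).card ≤ (lightC4s G lam).card + 4 * (heavyBCs G lam).card +
      2 * ((c4s G).filter fun f =>
        projAB f ∈ heavyPairs G lam ∧ projCD f ∈ heavyPairs G lam).card +
      4 * ((c4s G).filter fun f =>
        projAB f ∈ heavyPairs G lam ∧ projBC f ∈ heavyPairs G lam).card := by
  classical
  set H := heavyPairs G lam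
  let rot : ∀ p : Quad V → Prop, [DecidablePred p] →
      ((c4s G).filter fun f => p (rotate f)).card = ((c4s G).filter p).card := fun p _ =>
    card_filter_of_involutive rotate_injective (fun _ => rotate_mem) _ _ fun f => Iff.rfl
  let p1 : Quad V → Prop := fun f => projAB f ∉ H ∧ projBC f ∈ H ∧ projCD f ∉ H ∧ projDA f ∉ H
  let p2 : Quad V → Prop := fun f => projAB f ∈ H ∧ projCD f ∈ H
  let p3 : Quad V → Prop := fun f => projAB f ∈ H ∧ projBC f ∈ H
  have h1 : c4s G ⊆ lightC4s G lam ∪ ((c4s G).filter p1 ∪ (c4s G).filter (fun f => p1 (rotate f)) ∪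
      (c4s G).filter (fun f => p1 (rotate (rotate f))) ∪
      (c4s G).filter (fun f => p1 (rotate (rotate (rotate f))))) ∪
      ((c4s G).filter p2 ∪ (c4s G).filter (fun f => p2 (rotate f))) ∪
      ((c4s G).filter p3 ∪ (c4s G).filter (fun f => p3 (rotate f)) ∪
      (c4s G).filter (fun f => p3 (rotate (rotate f))) ∪
      (c4s G).filter (fun f => p3 (rotate (rotate (rotate f))))) := by
    intro f hf
    have hL : f ∈ lightC4s G lam ↔ projAB f ∉ H ∧ projBC f ∉ H ∧ projCD f ∉ H ∧ projDA f ∉ H := by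
      simp [lightC4s, hf, H]
    simp only [mem_union, mem_filter, hL, hf, true_and]
    simp only [p1, p2, p3, rotate]
    by_cases h1 : (f.1, f.2.1) ∈ H <;> by_cases h2 : (f.2.1, f.2.2.1) ∈ H <;>
      by_cases h3 : (f.2.2.1, f.2.2.2) ∈ H <;> by_cases h4 : (f.2.2.2, f.1) ∈ H <;>
      simp [h1, h2, h3, h4]
  have e1 := rot p1
  have e2 := rot fun f => p1 (rotate f)
  have e3 := rot fun f => p1 (rotate (rotate f))
  have e4 := rot p2
  have e5 := rot p3
  have e6 := rot fun f => p3 (rotate f)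
  have e7 := rot fun f => p3 (rotate (rotate f))
  have h2 := card_le_card h1
  have u1 := fun A B : Finset (Quad V) => card_union_le A B
  have e0 : (heavyBCs G lam).card = ((c4s G).filter p1).card := rfl
  rw [e0]
  change _ ≤ _ + _ + 2 * ((c4s G).filter p2).card + 4 * ((c4s G).filter p3).card
  refine h2.trans ((u1 _ _).trans ?_)
  refine (add_le_add (u1 _ _) (u1 _ _)).trans ?_
  refine (add_le_add (add_le_add (u1 _ _) (u1 _ _)) (add_le_add (u1 _ _) le_rfl)).trans ?_
  have v1 := u1 ((c4s G).filter p1) ((c4s G).filter (fun f => p1 (rotate f)))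
  have v2 := u1 ((c4s G).filter p1 ∪ (c4s G).filter (fun f => p1 (rotate f)))
    ((c4s G).filter (fun f => p1 (rotate (rotate f))))
  have v3 := u1 ((c4s G).filter p1 ∪ (c4s G).filter (fun f => p1 (rotate f)) ∪
    (c4s G).filter (fun f => p1 (rotate (rotate f))))
    ((c4s G).filter (fun f => p1 (rotate (rotate (rotate f)))))
  have v4 := u1 ((c4s G).filter p3) ((c4s G).filter (fun f => p3 (rotate f)))
  have v5 := u1 ((c4s G).filter p3 ∪ (c4s G).filter (fun f => p3 (rotate f)))
    ((c4s G).filter (fun f => p3 (rotate (rotate f))))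
  omega

/-- As `lam` is at least 10√N, there are at most √N/10 heavy pairs. So at most N/100 cycles have the
two given opposite sides heavy, at most N/10 the two given adjacent ones, and at least 0.58·N remain
for the light cycles and four times the cycles with heavy middle. -/
theorem card_light_or_heavyBC {lam : ℕ} (hlam : 100 * (c4s G).card ≤ lam ^ 2) :
    (c4s G).card ≤ 4 * (lightC4s G lam).card ∨ (c4s G).card ≤ 16 * (heavyBCs G lam).card := by
  set N := (c4s G).card with hN
  rcases Nat.eq_zero_or_pos N with h0 | h0
  · left; omega
  have h1 := card_heavyPairs_mul_le (G := G) lam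
  have h2 := card_opposite_heavy_le (G := G) lam
  have h3 := card_adjacent_heavy_sq_le (G := G) lam
  have h4 := card_c4s_le_light_add (G := G) lam
  rw [← hN] at h1 h3 h4
  set h := (heavyPairs G lam).card
  set O := ((c4s G).filter fun f =>
    projAB f ∈ heavyPairs G lam ∧ projCD f ∈ heavyPairs G lam).card
  set W := ((c4s G).filter fun f =>
    projAB f ∈ heavyPairs G lam ∧ projBC f ∈ heavyPairs G lam).card
  have h5 : 100 * h ^ 2 ≤ N := by
    have : 100 * h ^ 2 * N ≤ N * N := by
      calc 100 * h ^ 2 * N = h ^ 2 * (100 * N) := by ring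
        _ ≤ h ^ 2 * lam ^ 2 := by gcongr
        _ = (h * lam) ^ 2 := by ring
        _ ≤ N ^ 2 := by gcongr
        _ = N * N := sq N
    exact Nat.le_of_mul_le_mul_right this h0
  have h6 : 10 * W ≤ N := by
    have : (10 * W) ^ 2 ≤ N ^ 2 := by
      calc (10 * W) ^ 2 = 100 * W ^ 2 := by ring
        _ ≤ 100 * (h ^ 2 * N) := by gcongr
        _ = 100 * h ^ 2 * N := by ring
        _ ≤ N * N := by gcongr
        _ = N ^ 2 := (sq N).symm
    exact (Nat.pow_le_pow_iff_left two_ne_zero).1 this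
  omega

/-- Exchanging a with c, or b with d, preserves lightness, and one of the four resulting labellings
has the required order. -/
theorem card_le_four_mul_ordered {lam : ℕ} (t : V → ℕ) (s : V → ℕ) :
    (lightC4s G lam).card ≤ 4 * ((lightC4s G lam).filter fun f =>
      t f.1 ≤ t f.2.2.1 ∧ s f.2.2.2 ≤ s f.2.1).card := by
  classical
  set L := lightC4s G lam
  set F := L.filter fun f => t f.1 ≤ t f.2.2.1 ∧ s f.2.2.2 ≤ s f.2.1 with hF
  have hAC : ∀ f ∈ L, swapAC f ∈ L := by
    intro f hf
    obtain ⟨hf, h1, h2, h3, h4⟩ := mem_filter.1 hf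
    refine mem_filter.2 ⟨swapAC_mem.2 hf, ?_⟩
    simp only [swapAC]
    rw [swap_mem_heavyPairs] at h1 h2 h3 h4
    exact ⟨h2, h1, h4, h3⟩
  have hBD : ∀ f ∈ L, swapBD f ∈ L := by
    intro f hf
    obtain ⟨hf, h1, h2, h3, h4⟩ := mem_filter.1 hf
    refine mem_filter.2 ⟨swapBD_mem.2 hf, ?_⟩
    simp only [swapBD]
    rw [swap_mem_heavyPairs] at h1 h2 h3 h4
    exact ⟨h4, h3, h2, h1⟩
  have h : L ⊆ F ∪ F.image swapAC ∪ (F.image swapBD ∪ (F.image swapAC).image swapBD) := by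
    intro f hf
    simp only [mem_union, mem_image]
    rcases le_total (t f.1) (t f.2.2.1) with h1 | h1 <;>
      rcases le_total (s f.2.2.2) (s f.2.1) with h2 | h2
    · exact Or.inl (Or.inl (mem_filter.2 ⟨hf, h1, h2⟩))
    · exact Or.inr (Or.inl ⟨swapBD f, mem_filter.2 ⟨hBD f hf, h1, h2⟩, rfl⟩)
    · exact Or.inl (Or.inr ⟨swapAC f, mem_filter.2 ⟨hAC f hf, h1, h2⟩, rfl⟩)
    · exact Or.inr (Or.inr ⟨swapBD f, ⟨swapAC (swapBD f),
        mem_filter.2 ⟨hAC _ (hBD f hf), h1, h2⟩, rfl⟩, rfl⟩)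
  have h1 : (F.image swapAC).card ≤ F.card := card_image_le
  have h2 : (F.image swapBD).card ≤ F.card := card_image_le
  have h3 : ((F.image swapAC).image swapBD).card ≤ (F.image swapAC).card := card_image_le
  have h4 := card_le_card h
  have h5 := card_union_le (F ∪ F.image swapAC) (F.image swapBD ∪ (F.image swapAC).image swapBD)
  have h6 := card_union_le F (F.image swapAC)
  have h7 := card_union_le (F.image swapBD) ((F.image swapAC).image swapBD)
  omega

/-- Every graph with a four-cycle has a large regular family of labelled four-cycles. -/
theorem exists_isRegular_c4s {lam K : ℕ} (hlam : 100 * (c4s G).card ≤ lam ^ 2)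
    (hK : (c4s G).card < 2 ^ K) (hne : (c4s G).Nonempty) :
    ∃ F' ⊆ c4s G, (c4s G).card ≤ 16 * K ^ 4 * F'.card ∧
      ∃ α δ μ ν, IsRegular F' (c4s G).card lam α δ μ ν := by
  have light : ∀ {u v : V}, (u, v) ∉ heavyPairs G lam → edgeCount G u v ≤ lam := by
    intro u v h
    rw [mem_heavyPairs] at h
    exact not_lt.1 h
  have hpos := card_pos.2 hne
  rcases card_light_or_heavyBC hlam with h | h
  · let t : V → ℕ := fun v => ((c4s G).filter fun g => projA g = v).card
    let s : V → ℕ := fun v => ((c4s G).filter fun g => projD g = v).card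
    set F₁ := (lightC4s G lam).filter fun f => t f.1 ≤ t f.2.2.1 ∧ s f.2.2.2 ≤ s f.2.1 with hF₁
    have h4 : (lightC4s G lam).card ≤ 4 * F₁.card := card_le_four_mul_ordered t s
    have hsub : F₁ ⊆ c4s G := (filter_subset _ _).trans (filter_subset _ _)
    have hl : ∀ f ∈ F₁, f ∈ lightC4s G lam := fun f hf => (mem_filter.1 hf).1
    have hne₁ : F₁.Nonempty := card_pos.1 (by omega)
    have hAB : ∀ f ∈ F₁, fiberCard (c4s G) projAB f ≤ lam := fun f hf => by
      rw [fiberCard_projAB]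
      exact light (mem_filter.1 (hl f hf)).2.1
    have hCD : ∀ f ∈ F₁, fiberCard (c4s G) projCD f ≤ lam := fun f hf => by
      rw [fiberCard_projCD]
      exact light (mem_filter.1 (hl f hf)).2.2.2.1
    have hDA : ∀ f ∈ F₁, fiberCard (c4s G) projDA f ≤ lam := fun f hf => by
      rw [fiberCard_projDA]
      exact light (mem_filter.1 (hl f hf)).2.2.2.2
    -- Fibers are counted among all four-cycles here, because the comparison of opposite vertices
    -- rests on the symmetries of that family.
    obtain ⟨F', hF', hc, hreg⟩ := exists_isRegular hsub le_rfl hK hne₁ hAB hCD hDA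
      (Or.inl fun f hf => by
        rw [fiberCard_projC, fiberCard_projB]
        exact (mem_filter.1 hf).2)
    exact ⟨F', hF'.trans hsub, by linarith, hreg⟩
  · have hsub : heavyBCs G lam ⊆ c4s G := filter_subset _ _
    have hne₁ : (heavyBCs G lam).Nonempty := card_pos.1 (by omega)
    -- Here fibers are counted within the cycles with heavy middle, because the family must have few
    -- middle pairs.
    have hAB : ∀ f ∈ heavyBCs G lam, fiberCard (heavyBCs G lam) projAB f ≤ lam := fun f hf => by
      refine (fiberCard_mono hsub _ _).trans ?_
      rw [fiberCard_projAB]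
      exact light (mem_filter.1 hf).2.1
    have hCD : ∀ f ∈ heavyBCs G lam, fiberCard (heavyBCs G lam) projCD f ≤ lam := fun f hf => by
      refine (fiberCard_mono hsub _ _).trans ?_
      rw [fiberCard_projCD]
      exact light (mem_filter.1 hf).2.2.2.1
    have hDA : ∀ f ∈ heavyBCs G lam, fiberCard (heavyBCs G lam) projDA f ≤ lam := fun f hf => by
      refine (fiberCard_mono hsub _ _).trans ?_
      rw [fiberCard_projDA]
      exact light (mem_filter.1 hf).2.2.2.2
    have hBC : ((heavyBCs G lam).image projBC).card * lam ≤ (c4s G).card := by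
      refine (Nat.mul_le_mul_right _ (card_le_card ?_)).trans (card_heavyPairs_mul_le lam)
      intro e he
      obtain ⟨f, hf, rfl⟩ := mem_image.1 he
      exact (mem_filter.1 hf).2.2.1
    obtain ⟨F', hF', hc, hreg⟩ := exists_isRegular (Subset.refl (heavyBCs G lam))
      (card_le_card hsub) hK hne₁ hAB hCD hDA (Or.inr hBC)
    exact ⟨F', hF'.trans hsub, by linarith, hreg⟩

end Graph

/-! ### Sampling rates for a regular family -/

/-- The sampling rates `x` and `y` are large enough for the second moment method to work for the
family `F`. -/
structure RateBounds {V : Type*} [DecidableEq V] (F : Finset (Quad V)) (x y : ℝ) : Prop where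
  le_A : ∀ f ∈ F, (fiberCard F projA f : ℝ) ≤ x * F.card
  le_D : ∀ f ∈ F, (fiberCard F projD f : ℝ) ≤ y * F.card
  le_AB : ∀ f ∈ F, (fiberCard F projAB f : ℝ) ≤ x * y * F.card
  le_CD : ∀ f ∈ F, (fiberCard F projCD f : ℝ) ≤ x * y * F.card
  le_DA : ∀ f ∈ F, (fiberCard F projDA f : ℝ) ≤ x * y * F.card
  le_ABD : ∀ f ∈ F, (fiberCard F projABD f : ℝ) ≤ x * y ^ 2 * F.card
  le_ACD : ∀ f ∈ F, (fiberCard F projACD f : ℝ) ≤ x ^ 2 * y * F.card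
  one_le : 1 ≤ x ^ 2 * y ^ 2 * F.card

theorem rateBounds_singleton {V : Type*} [DecidableEq V] (f : Quad V) :
    RateBounds {f} 1 1 := by
  constructor <;> simp [fiberCard, filter_singleton]

/-- Let t be the size of the family, a and d bounds for the fibers over the first and last vertex, p
and q those for `projABD` and `projACD`. If xy ≥ s, the nontrivial requirements are x ≥ a/t, x ≥
q/(st), y ≥ d/t and y ≥ p/(st). They are compatible with xy of order s if each lower bound for x
times each one for y is at most s, that is, ad ≤ st², ap ≤ s²t², dq ≤ s²t² and pq ≤ s³t². These are
`b2` to `b5`, from the product bounds in `IsRegular`. -/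
theorem IsRegular.exists_rates {V : Type*} [DecidableEq V] {F : Finset (Quad V)}
    {N lam α δ μ ν : ℕ} (h : IsRegular F N lam α δ μ ν) {L s : ℝ} (hL : 1 ≤ L)
    (hN : (N : ℝ) ≤ L * F.card) (hlam : (lam : ℝ) ≤ 20 * Real.sqrt N)
    (hs : 160 * L ^ 3 ≤ s * Real.sqrt N) (hs0 : 0 < s) (hs1 : s ≤ 1) :
    ∃ i : ℕ, (2 : ℝ) ^ i * s ≤ 1 ∧ ∀ x y : ℝ, 0 ≤ y → 1 ≤ 2 ^ i * x →
      (y = 1 ∨ 2 * s * 2 ^ i ≤ y) → RateBounds F x y := by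
  obtain ⟨t, ht⟩ : ∃ t : ℝ, t = F.card := ⟨_, rfl⟩
  rw [← ht] at hN
  set r := Real.sqrt N with hr
  have hr0 : 0 ≤ r := Real.sqrt_nonneg _
  have hrN : (N : ℝ) = r ^ 2 := (Real.sq_sqrt (Nat.cast_nonneg N)).symm
  have ht1 : 1 ≤ t := by rw [ht]; exact_mod_cast card_pos.2 h.nonempty
  have ht0 : 0 < t := by linarith
  have hL0 : 0 < L := by linarith
  have hL3 : 1 ≤ L ^ 3 := one_le_pow₀ hL
  rw [hrN] at hN
  have b1 : lam ≤ s * t := by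
    have : 160 * L ^ 3 * r ≤ s * t * L := by
      calc 160 * L ^ 3 * r ≤ s * r * r := by gcongr
        _ = s * r ^ 2 := by ring
        _ ≤ s * (L * t) := by gcongr
        _ = s * t * L := by ring
    have h2 : 20 * r * L ≤ 160 * L ^ 3 * r := by
      have : L ≤ L ^ 3 := le_self_pow₀ hL (by norm_num)
      nlinarith
    exact hlam.trans (le_of_mul_le_mul_right (h2.trans this) hL0)
  have t3 : r ^ 6 ≤ L ^ 3 * t ^ 3 := by
    calc r ^ 6 = (r ^ 2) ^ 3 := by ring
      _ ≤ (L * t) ^ 3 := by gcongr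
      _ = _ := by ring
  have e1 : 160 * r ^ 5 ≤ s * t ^ 3 := by
    refine le_of_mul_le_mul_right ?_ (by positivity : 0 < L ^ 3)
    calc 160 * r ^ 5 * L ^ 3 = 160 * L ^ 3 * r ^ 5 := by ring
      _ ≤ s * r * r ^ 5 := by gcongr
      _ = s * r ^ 6 := by ring
      _ ≤ s * (L ^ 3 * t ^ 3) := by gcongr
      _ = _ := by ring
  have e2 : 160 * r ^ 4 ≤ s ^ 2 * t ^ 3 := by
    refine le_of_mul_le_mul_right ?_ (by positivity : 0 < L ^ 3)
    calc 160 * r ^ 4 * L ^ 3 ≤ 160 * r ^ 4 * L ^ 3 * (160 * L ^ 3) :=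
          le_mul_of_one_le_right (by positivity) (by linarith)
      _ = (160 * L ^ 3) ^ 2 * r ^ 4 := by ring
      _ ≤ (s * r) ^ 2 * r ^ 4 := by gcongr
      _ = s ^ 2 * r ^ 6 := by ring
      _ ≤ s ^ 2 * (L ^ 3 * t ^ 3) := by gcongr
      _ = _ := by ring
  have e3 : 160 * r ^ 3 ≤ s ^ 3 * t ^ 3 := by
    refine le_of_mul_le_mul_right ?_ (by positivity : 0 < L ^ 3)
    calc 160 * r ^ 3 * L ^ 3 ≤ 160 * r ^ 3 * L ^ 3 * (160 * L ^ 3) ^ 2 :=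
          le_mul_of_one_le_right (by positivity) (one_le_pow₀ (by linarith))
      _ = (160 * L ^ 3) ^ 3 * r ^ 3 := by ring
      _ ≤ (s * r) ^ 3 * r ^ 3 := by gcongr
      _ = s ^ 3 * r ^ 6 := by ring
      _ ≤ s ^ 3 * (L ^ 3 * t ^ 3) := by gcongr
      _ = _ := by ring
  have b6 : 1 ≤ s ^ 2 * t := by
    refine le_of_mul_le_mul_right ?_ hL0
    calc 1 * L ≤ L ^ 3 := by rw [one_mul]; exact le_self_pow₀ hL (by norm_num)
      _ ≤ 160 * L ^ 3 := by linarith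
      _ ≤ (160 * L ^ 3) ^ 2 := le_self_pow₀ (by linarith) (by norm_num)
      _ ≤ (s * r) ^ 2 := by gcongr
      _ = s ^ 2 * r ^ 2 := by ring
      _ ≤ s ^ 2 * (L * t) := by gcongr
      _ = _ := by ring
  have m1 : (α * δ * t : ℝ) ≤ r ^ 4 * lam := by
    have h2 : (α * δ * t : ℝ) ≤ (N : ℝ) ^ 2 * lam := by rw [ht]; exact_mod_cast h.mul_AD
    rw [hrN] at h2; linarith
  have m2 : (α * μ * t : ℝ) ≤ r ^ 4 := by
    have h2 : (α * μ * t : ℝ) ≤ (N : ℝ) ^ 2 := by rw [ht]; exact_mod_cast h.mul_A_ABD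
    rw [hrN] at h2; linarith
  have m3 : (δ * ν * t : ℝ) ≤ r ^ 4 := by
    have h2 : (δ * ν * t : ℝ) ≤ (N : ℝ) ^ 2 := by rw [ht]; exact_mod_cast h.mul_D_ACD
    rw [hrN] at h2; linarith
  have m4 : (μ * ν * t : ℝ) ≤ r ^ 2 * lam := by
    have h2 : (μ * ν * t : ℝ) ≤ (N : ℝ) * lam := by rw [ht]; exact_mod_cast h.mul_ABD_ACD
    rw [hrN] at h2; linarith
  have b2 : (2 * α) * (2 * δ) ≤ s * t ^ 2 := by
    refine le_of_mul_le_mul_right ?_ ht0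
    have : r ^ 4 * lam ≤ r ^ 4 * (20 * r) := by gcongr
    calc (2 * α) * (2 * δ) * t = 4 * (α * δ * t) := by ring
      _ ≤ 4 * (r ^ 4 * (20 * r)) := by linarith
      _ = 80 * r ^ 5 := by ring
      _ ≤ 160 * r ^ 5 := by gcongr; norm_num
      _ ≤ s * t ^ 2 * t := by linarith
  have b3 : (2 * α) * (2 * μ) ≤ s ^ 2 * t ^ 2 := by
    refine le_of_mul_le_mul_right ?_ ht0
    have : 0 ≤ r ^ 4 := by positivity
    calc (2 * α) * (2 * μ) * t = 4 * (α * μ * t) := by ring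
      _ ≤ 160 * r ^ 4 := by linarith
      _ ≤ s ^ 2 * t ^ 2 * t := by linarith
  have b4 : (2 * δ) * (2 * ν) ≤ s ^ 2 * t ^ 2 := by
    refine le_of_mul_le_mul_right ?_ ht0
    have : 0 ≤ r ^ 4 := by positivity
    calc (2 * δ) * (2 * ν) * t = 4 * (δ * ν * t) := by ring
      _ ≤ 160 * r ^ 4 := by linarith
      _ ≤ s ^ 2 * t ^ 2 * t := by linarith
  have b5 : (2 * μ) * (2 * ν) ≤ s ^ 3 * t ^ 2 := by
    refine le_of_mul_le_mul_right ?_ ht0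
    have : r ^ 2 * lam ≤ r ^ 2 * (20 * r) := by gcongr
    calc (2 * μ) * (2 * ν) * t = 4 * (μ * ν * t) := by ring
      _ ≤ 4 * (r ^ 2 * (20 * r)) := by linarith
      _ = 80 * r ^ 3 := by ring
      _ ≤ 160 * r ^ 3 := by gcongr; norm_num
      _ ≤ s ^ 3 * t ^ 2 * t := by linarith
  clear m1 m2 m3 m4 e1 e2 e3 t3
  -- Truncation by the trivial bounds `t` and `lam` makes all required rates at most 1.
  obtain ⟨a, ea⟩ : ∃ a : ℝ, a = min (2 * α : ℝ) t := ⟨_, rfl⟩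
  obtain ⟨d, ed⟩ : ∃ d : ℝ, d = min (2 * δ : ℝ) t := ⟨_, rfl⟩
  obtain ⟨p, ep⟩ : ∃ p : ℝ, p = min (2 * μ : ℝ) lam := ⟨_, rfl⟩
  obtain ⟨q, eq⟩ : ∃ q : ℝ, q = min (2 * ν : ℝ) lam := ⟨_, rfl⟩
  have ha0 : 0 ≤ a := ea ▸ le_min (by positivity) ht0.le
  have hd0 : 0 ≤ d := ed ▸ le_min (by positivity) ht0.le
  have hp0 : 0 ≤ p := ep ▸ le_min (by positivity) (by positivity)
  have hq0 : 0 ≤ q := eq ▸ le_min (by positivity) (by positivity)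
  have ha : a ≤ 2 * α := ea ▸ min_le_left _ _
  have hd : d ≤ 2 * δ := ed ▸ min_le_left _ _
  have hp : p ≤ 2 * μ := ep ▸ min_le_left _ _
  have hq : q ≤ 2 * ν := eq ▸ min_le_left _ _
  have hat : a ≤ t := ea ▸ min_le_right _ _
  have hdt : d ≤ t := ed ▸ min_le_right _ _
  have hpl : p ≤ s * t := (ep ▸ min_le_right _ _ : p ≤ lam).trans b1
  have hql : q ≤ s * t := (eq ▸ min_le_right _ _ : q ≤ lam).trans b1
  have hst : 0 < s * t := by positivity
  -- The smallest admissible x. The term `s` is included so that the matching rate `s / x₀` for y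
  -- does not exceed 1.
  obtain ⟨x₀, hx₀⟩ : ∃ x₀, x₀ = max (max (a / t) (q / (s * t))) s := ⟨_, rfl⟩
  have hx₀s : s ≤ x₀ := hx₀ ▸ le_max_right _ _
  have hx₀0 : 0 < x₀ := hs0.trans_le hx₀s
  have hx₀a : a ≤ x₀ * t := by
    rw [← div_le_iff₀ ht0, hx₀]
    exact (le_max_left _ _).trans (le_max_left _ _)
  have hx₀q : q ≤ x₀ * (s * t) := by
    rw [← div_le_iff₀ hst, hx₀]
    exact (le_max_right _ _).trans (le_max_left _ _)
  have hx₀1 : x₀ ≤ 1 := by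
    rw [hx₀]
    exact max_le (max_le ((div_le_one ht0).2 hat) ((div_le_one hst).2 hql)) hs1
  have cases_x₀ : x₀ = a / t ∨ x₀ = q / (s * t) ∨ x₀ = s := by
    rcases max_choice (max (a / t) (q / (s * t))) s with h | h
    · rcases max_choice (a / t) (q / (s * t)) with h' | h'
      · left; rw [hx₀, h, h']
      · right; left; rw [hx₀, h, h']
    · right; right; rw [hx₀, h]
  have hdx : d * x₀ ≤ s * t := by
    rcases cases_x₀ with h | h | h
    · rw [h, ← mul_div_assoc, div_le_iff₀ ht0]
      calc d * a ≤ (2 * δ) * (2 * α) := by gcongr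
        _ ≤ s * t * t := by linarith
    · rw [h, ← mul_div_assoc, div_le_iff₀ hst]
      calc d * q ≤ (2 * δ) * (2 * ν) := by gcongr
        _ ≤ s * t * (s * t) := by linarith
    · rw [h, mul_comm]; gcongr
  have hpx : p * x₀ ≤ s ^ 2 * t := by
    rcases cases_x₀ with h | h | h
    · rw [h, ← mul_div_assoc, div_le_iff₀ ht0]
      calc p * a ≤ (2 * μ) * (2 * α) := by gcongr
        _ ≤ s ^ 2 * t * t := by linarith
    · rw [h, ← mul_div_assoc, div_le_iff₀ hst]
      calc p * q ≤ (2 * μ) * (2 * ν) := by gcongr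
        _ ≤ s ^ 2 * t * (s * t) := by linarith
    · rw [h]
      calc p * s ≤ s * t * s := by gcongr
        _ = _ := by ring
  -- Rounding `1 / x₀` down to a power of two gives x ≥ `x₀` at once. The loss for y is less than 2,
  -- which the factor 2 in the condition on y repays.
  obtain ⟨i, hi1, hi2⟩ := exists_nat_pow_near ((one_le_div hx₀0).2 hx₀1) (one_lt_two (α := ℝ))
  rw [le_div_iff₀ hx₀0] at hi1
  rw [div_lt_iff₀ hx₀0, pow_succ] at hi2
  have h2i : (0 : ℝ) < 2 ^ i := by positivity
  refine ⟨i, le_trans (by gcongr) hi1, fun x y hy0 hx hy => ?_⟩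
  have hxx₀ : x₀ ≤ x := le_of_mul_le_mul_left (hi1.trans hx) h2i
  have hx0 : 0 < x := hx₀0.trans_le hxx₀
  have hxy : s ≤ x * y := by
    rcases hy with rfl | hy
    · linarith
    · calc s ≤ (2 ^ i * x) * s := le_mul_of_one_le_left hs0.le hx
        _ ≤ (2 ^ i * x) * (2 * s) := by gcongr; linarith
        _ = x * (2 * s * 2 ^ i) := by ring
        _ ≤ x * y := by gcongr
  have hy' : y = 1 ∨ s ≤ y * x₀ := by
    rcases hy with rfl | hy
    · exact Or.inl rfl
    · right
      calc s ≤ (2 ^ i * 2 * x₀) * s := le_mul_of_one_le_left hs0.le hi2.le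
        _ = (2 * s * 2 ^ i) * x₀ := by ring
        _ ≤ y * x₀ := by gcongr
  have hdy : d ≤ y * t := by
    rcases hy' with rfl | hy'
    · linarith
    · refine le_of_mul_le_mul_right ?_ hx₀0
      calc d * x₀ ≤ s * t := hdx
        _ ≤ y * x₀ * t := by gcongr
        _ = _ := by ring
  have hpy : p ≤ s * (y * t) := by
    rcases hy' with rfl | hy'
    · linarith
    · refine le_of_mul_le_mul_right ?_ hx₀0
      calc p * x₀ ≤ s ^ 2 * t := hpx
        _ = s * (s * t) := by ring
        _ ≤ s * (y * x₀ * t) := by gcongr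
        _ = _ := by ring
  have hlam' : (lam : ℝ) ≤ x * y * t := b1.trans (by gcongr)
  have fib_le : ∀ (π : Quad V → V) (f : Quad V), (fiberCard F π f : ℝ) ≤ t := fun π f => by
    rw [ht]; exact_mod_cast card_le_card (filter_subset _ _)
  have hABD_AB : ∀ f, fiberCard F projABD f ≤ fiberCard F projAB f := fun f => by
    refine card_le_card fun g hg => ?_
    simp only [mem_filter, Prod.mk.injEq] at hg ⊢
    tauto
  have hACD_DA : ∀ f, fiberCard F projACD f ≤ fiberCard F projDA f := fun f => by
    refine card_le_card fun g hg => ?_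
    simp only [mem_filter, Prod.mk.injEq] at hg ⊢
    tauto
  refine ⟨fun f hf => ?_, fun f hf => ?_, fun f hf => ?_, fun f hf => ?_, fun f hf => ?_,
    fun f hf => ?_, fun f hf => ?_, ?_⟩ <;> rw [← ht]
  · have h1 : (fiberCard F projA f : ℝ) ≤ a := by
      rw [ea]
      exact le_min (by exact_mod_cast h.le_A f hf) (fib_le projA f)
    exact h1.trans (hx₀a.trans (by gcongr))
  · have h1 : (fiberCard F projD f : ℝ) ≤ d := by
      rw [ed]
      exact le_min (by exact_mod_cast h.le_D f hf) (fib_le projD f)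
    exact h1.trans hdy
  · exact (Nat.cast_le.2 (h.le_AB f hf)).trans hlam'
  · exact (Nat.cast_le.2 (h.le_CD f hf)).trans hlam'
  · exact (Nat.cast_le.2 (h.le_DA f hf)).trans hlam'
  · have h1 : (fiberCard F projABD f : ℝ) ≤ p := by
      rw [ep]
      exact le_min (by exact_mod_cast h.le_ABD f hf)
        (by exact_mod_cast (hABD_AB f).trans (h.le_AB f hf))
    calc _ ≤ p := h1
      _ ≤ s * (y * t) := hpy
      _ ≤ x * y * (y * t) := by gcongr
      _ = _ := by ring
  · have h1 : (fiberCard F projACD f : ℝ) ≤ q := by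
      rw [eq]
      exact le_min (by exact_mod_cast h.le_ACD f hf)
        (by exact_mod_cast (hACD_DA f).trans (h.le_DA f hf))
    calc _ ≤ q := h1
      _ ≤ x₀ * (s * t) := hx₀q
      _ ≤ x * (x * y * t) := by gcongr
      _ = _ := by ring
  · calc 1 ≤ s ^ 2 * t := b6
      _ ≤ (x * y) ^ 2 * t := by gcongr
      _ = _ := by ring

/-! ### Probabilities in finite uniform spaces -/

section Uniform

variable {Ω Ω' : Type*}

/-- The probability of `p` for a uniformly random element of `Ω`. -/
noncomputable def pr (p : Ω → Prop) : ℝ := (Nat.card {ω // p ω} : ℝ) / Nat.card Ω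

open Classical in
theorem pr_eq_sum [Fintype Ω] (p : Ω → Prop) :
    pr p = (∑ ω, if p ω then (1 : ℝ) else 0) / Nat.card Ω := by
  rw [pr, Nat.card_eq_fintype_card, Fintype.card_subtype]
  simp

theorem pr_nonneg (p : Ω → Prop) : 0 ≤ pr p := by unfold pr; positivity

theorem pr_mono [Fintype Ω] {p r : Ω → Prop} (h : ∀ ω, p ω → r ω) : pr p ≤ pr r := by
  unfold pr
  gcongr
  exact Nat.card_le_card_of_injective (fun ω => ⟨ω.1, h _ ω.2⟩)
    fun ω ω' h => Subtype.ext (Subtype.mk.inj h)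

theorem pr_congr {p r : Ω → Prop} (h : ∀ ω, p ω ↔ r ω) : pr p = pr r := by
  rw [show p = r from funext fun ω => propext (h ω)]

theorem pr_equiv (e : Ω ≃ Ω') (p : Ω' → Prop) : pr (fun ω => p (e ω)) = pr p := by
  unfold pr
  rw [Nat.card_congr e, Nat.card_congr (e.subtypeEquiv (p := fun ω => p (e ω)) (q := p)
    fun _ => Iff.rfl)]

theorem pr_prod (p : Ω → Prop) (r : Ω' → Prop) :
    pr (fun ω : Ω × Ω' => p ω.1 ∧ r ω.2) = pr p * pr r := by
  unfold pr
  rw [Nat.card_congr (Equiv.subtypeProdEquivProd (p := p) (q := r)), Nat.card_prod, Nat.card_prod]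
  push_cast
  rw [mul_div_mul_comm]

theorem pr_pi {κ : Type*} [Fintype κ] [DecidableEq κ] {X : κ → Type*} [∀ i, Fintype (X i)]
    (p : ∀ i, X i → Prop) : pr (fun c : ∀ i, X i => ∀ i, p i (c i)) = ∏ i, pr (p i) := by
  unfold pr
  rw [Nat.card_congr (Equiv.subtypePiEquivPi (p := p)), Nat.card_pi, Nat.card_pi]
  push_cast
  rw [prod_div_distrib]

theorem pr_true [Finite Ω] [Nonempty Ω] : pr (fun _ : Ω => True) = 1 := by
  unfold pr
  rw [Nat.card_congr (Equiv.subtypeUnivEquiv fun _ => trivial)]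
  exact div_self (by exact_mod_cast Nat.card_pos.ne')

theorem pr_le_one [Fintype Ω] [Nonempty Ω] (p : Ω → Prop) : pr p ≤ 1 :=
  pr_true (Ω := Ω) ▸ pr_mono fun _ _ => trivial

theorem pr_fst [Finite Ω'] [Nonempty Ω'] (p : Ω → Prop) : pr (fun ω : Ω × Ω' => p ω.1) = pr p := by
  have := pr_prod p (fun _ : Ω' => True)
  rw [pr_true, mul_one] at this
  rw [← this]
  exact pr_congr fun ω => by simp

theorem pr_snd [Finite Ω] [Nonempty Ω] (p : Ω' → Prop) : pr (fun ω : Ω × Ω' => p ω.2) = pr p := by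
  have := pr_prod (fun _ : Ω => True) p
  rw [pr_true, one_mul] at this
  rw [← this]
  exact pr_congr fun ω => by simp

theorem pr_not [Fintype Ω] [Nonempty Ω] (p : Ω → Prop) : pr (fun ω => ¬ p ω) = 1 - pr p := by
  classical
  rw [eq_sub_iff_add_eq, ← pr_true (Ω := Ω), pr_eq_sum, pr_eq_sum, pr_eq_sum, ← add_div,
    ← sum_add_distrib]
  congr 1
  refine sum_congr rfl fun ω _ => ?_
  by_cases h : p ω <;> simp [h]

theorem pr_or_le [Fintype Ω] (p r : Ω → Prop) : pr (fun ω => p ω ∨ r ω) ≤ pr p + pr r := by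
  classical
  rw [pr_eq_sum, pr_eq_sum, pr_eq_sum, ← add_div, ← sum_add_distrib]
  gcongr with ω
  by_cases h : p ω <;> by_cases h' : r ω <;> simp [h, h']

theorem pr_exists_le [Fintype Ω] {β : Type*} (s : Finset β) (p : β → Ω → Prop) :
    pr (fun ω => ∃ b ∈ s, p b ω) ≤ ∑ b ∈ s, pr (p b) := by
  classical
  induction s using Finset.induction_on with
  | empty => simp [pr]
  | insert b s hb ih =>
    rw [sum_insert hb]
    refine le_trans (le_of_eq ?_) ((pr_or_le (p b) fun ω => ∃ b ∈ s, p b ω).trans (by gcongr))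
    exact pr_congr fun ω => by simp

/-- Markov's inequality for the number of events that occur. -/
theorem mul_pr_lt_card_le [Fintype Ω] {β : Type*} (s : Finset β) (p : β → Ω → Prop)
    [∀ b ω, Decidable (p b ω)] (B : ℝ) :
    B * pr (fun ω => B ≤ ((s.filter fun b => p b ω).card : ℝ)) ≤ ∑ b ∈ s, pr (p b) := by
  classical
  rw [pr_eq_sum, ← mul_div_assoc]
  simp only [pr_eq_sum]
  rw [← sum_div, sum_comm, mul_sum]
  gcongr with ω
  have hc : (∑ b ∈ s, @ite ℝ (p b ω) (Classical.propDecidable _) 1 0) =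
      (s.filter fun b => p b ω).card := by
    rw [card_filter]
    push_cast
    exact sum_congr rfl fun b _ => by by_cases h : p b ω <;> simp [h]
  rw [hc]
  split_ifs with h
  · rwa [mul_one]
  · rw [mul_zero]; positivity

/-- The second moment method. -/
theorem one_div_le_pr_exists [Fintype Ω] [Nonempty Ω] {β : Type*} (s : Finset β)
    (p : β → Ω → Prop) {P κ : ℝ}
    (hs : s.Nonempty) (hP : 0 < P) (h1 : ∀ b ∈ s, pr (p b) = P)
    (h2 : ∑ b ∈ s, ∑ b' ∈ s, pr (fun ω => p b ω ∧ p b' ω) ≤ κ * (s.card * P) ^ 2) :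
    1 / κ ≤ pr (fun ω => ∃ b ∈ s, p b ω) := by
  classical
  let Z : Ω → ℝ := fun ω => ∑ b ∈ s, if p b ω then 1 else 0
  obtain ⟨N, hN⟩ : ∃ N : ℝ, N = Nat.card Ω := ⟨_, rfl⟩
  have hN0 : 0 < N := by rw [hN]; exact_mod_cast Nat.card_pos
  have hs0 : (0 : ℝ) < s.card := by exact_mod_cast card_pos.2 hs
  have hZ : ∑ ω, Z ω = N * (s.card * P) := by
    rw [sum_comm]
    have : ∀ b ∈ s, (∑ ω, if p b ω then (1 : ℝ) else 0) = N * P := fun b hb => by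
      rw [← h1 b hb, pr_eq_sum, ← hN, mul_div_cancel₀ _ hN0.ne']
    rw [sum_congr rfl this, sum_const, nsmul_eq_mul]; ring
  have hZ2 : ∑ ω, Z ω ^ 2 ≤ N * (κ * (s.card * P) ^ 2) := by
    refine le_trans (le_of_eq ?_) (mul_le_mul_of_nonneg_left h2 hN0.le)
    simp only [pr_eq_sum]
    rw [mul_sum, ← hN]
    simp only [← sum_div, mul_div_cancel₀ _ hN0.ne']
    simp only [Z, sq, sum_mul_sum]
    rw [sum_comm]
    refine sum_congr rfl fun b _ => ?_
    rw [sum_comm]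
    refine sum_congr rfl fun b' _ => sum_congr rfl fun ω _ => ?_
    by_cases h : p b ω <;> by_cases h' : p b' ω <;> simp [h, h']
  have hpr : ∑ ω, (if ∃ b ∈ s, p b ω then (1 : ℝ) else 0) ^ 2 =
      N * pr (fun ω => ∃ b ∈ s, p b ω) := by
    rw [pr_eq_sum, ← hN, mul_div_cancel₀ _ hN0.ne']
    exact sum_congr rfl fun ω _ => by split_ifs <;> simp
  -- Cauchy–Schwarz for the indicator of Z > 0 and Z itself, whose product is Z.
  have hCS := sum_mul_sq_le_sq_mul_sq univ (fun ω => if ∃ b ∈ s, p b ω then (1 : ℝ) else 0) Z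
  have hmul : ∀ ω, (if ∃ b ∈ s, p b ω then (1 : ℝ) else 0) * Z ω = Z ω := by
    intro ω
    split_ifs with h
    · rw [one_mul]
    · rw [zero_mul, eq_comm]
      refine sum_eq_zero fun b hb => if_neg fun hb' => h ⟨b, hb, hb'⟩
  simp only [hmul] at hCS
  rw [hZ, hpr] at hCS
  have hκ : (N * (s.card * P)) ^ 2 ≤
      N * pr (fun ω => ∃ b ∈ s, p b ω) * (N * (κ * (s.card * P) ^ 2)) :=
    hCS.trans (mul_le_mul_of_nonneg_left hZ2 (mul_nonneg hN0.le (pr_nonneg _)))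
  have hQ : 0 < (N * (s.card * P)) ^ 2 := by positivity
  have h3 : 1 ≤ pr (fun ω => ∃ b ∈ s, p b ω) * κ := by
    refine le_of_mul_le_mul_right ?_ hQ
    linarith
  have hκ0 : 0 < κ := by
    by_contra h
    have := mul_nonpos_of_nonneg_of_nonpos (pr_nonneg (fun ω => ∃ b ∈ s, p b ω)) (not_lt.1 h)
    linarith
  rwa [div_le_iff₀ hκ0]

end Uniform

/-! ### Hash functions and coins -/

section Hash

variable {q : ℕ}

theorem pr_fin_lt {x : ℕ} (hx : x ≤ q) : pr (fun a : Fin q => (a : ℕ) < x) = x / q := by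
  unfold pr
  have h : Nat.card {a : Fin q // (a : ℕ) < x} = x := by
    rw [Nat.card_eq_fintype_card, Fintype.card_subtype]
    rw [Fin.card_filter_val_lt, min_eq_right hx]
  rw [h, Nat.card_fin]

variable [Fact q.Prime]

theorem hash_eq_iff {a a' b b' : Fin q} {u : ℕ} :
    ((a : ℕ) * u + b) % q = ((a' : ℕ) * u + b') % q ↔
      ((a : ℕ) : ZMod q) * u + (b : ℕ) = ((a' : ℕ) : ZMod q) * u + (b' : ℕ) := by
  change _ ≡ _ [MOD q] ↔ _
  rw [← ZMod.natCast_eq_natCast_iff]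
  push_cast
  rfl

theorem Fin.cast_zmod_inj {a b : Fin q} : ((a : ℕ) : ZMod q) = ((b : ℕ) : ZMod q) ↔ a = b := by
  rw [ZMod.natCast_eq_natCast_iff, Nat.ModEq, Nat.mod_eq_of_lt a.2, Nat.mod_eq_of_lt b.2,
    Fin.ext_iff]

/-- For a fixed slope, the hash value is a bijective function of the constant coefficient. -/
theorem pr_hash_lt (u : ℕ) {x : ℕ} (hx : x ≤ q) :
    pr (fun k : Fin q × Fin q => ((k.1 : ℕ) * u + k.2) % q < x) = x / q := by
  have hq : 0 < q := (Fact.out : q.Prime).pos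
  have : Nonempty (Fin q) := ⟨⟨0, hq⟩⟩
  let φ : Fin q × Fin q → Fin q × Fin q := fun k =>
    (k.1, ⟨((k.1 : ℕ) * u + k.2) % q, Nat.mod_lt _ hq⟩)
  have hφ : Function.Injective φ := by
    rintro ⟨a, b⟩ ⟨a', b'⟩ h
    simp only [φ, Prod.mk.injEq, Fin.mk.injEq] at h
    obtain ⟨rfl, h⟩ := h
    rw [hash_eq_iff, add_right_inj, Fin.cast_zmod_inj] at h
    rw [h]
  rw [← pr_fin_lt hx, ← pr_snd (Ω := Fin q) (fun a : Fin q => (a : ℕ) < x),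
    ← pr_equiv (Equiv.ofBijective φ (Finite.injective_iff_bijective.1 hφ))
      (fun k => (k.2 : ℕ) < x)]
  rfl

/-- Pairwise independence: `u - v` is invertible modulo `q`, so the two hash values determine both
coefficients and are jointly uniform. -/
theorem pr_hash_lt_and {u v : ℕ} (hu : u < q) (hv : v < q) (huv : u ≠ v) {x : ℕ} (hx : x ≤ q) :
    pr (fun k : Fin q × Fin q => ((k.1 : ℕ) * u + k.2) % q < x ∧ ((k.1 : ℕ) * v + k.2) % q < x) =
      (x / q : ℝ) ^ 2 := by
  have hq : 0 < q := (Fact.out : q.Prime).pos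
  let φ : Fin q × Fin q → Fin q × Fin q := fun k =>
    (⟨((k.1 : ℕ) * u + k.2) % q, Nat.mod_lt _ hq⟩, ⟨((k.1 : ℕ) * v + k.2) % q, Nat.mod_lt _ hq⟩)
  have hφ : Function.Injective φ := by
    rintro ⟨a, b⟩ ⟨a', b'⟩ h
    simp only [φ, Prod.mk.injEq, Fin.mk.injEq] at h
    obtain ⟨h1, h2⟩ := h
    rw [hash_eq_iff] at h1 h2
    have huv' : (u : ZMod q) - v ≠ 0 := by
      rw [sub_ne_zero]
      exact fun h => huv (congrArg Fin.val ((Fin.cast_zmod_inj (a := ⟨u, hu⟩) (b := ⟨v, hv⟩)).1 h))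
    have h3 : ((a : ℕ) : ZMod q) = (a' : ℕ) := by
      refine mul_right_cancel₀ huv' ?_
      linear_combination h1 - h2
    rw [h3, add_right_inj, Fin.cast_zmod_inj] at h1
    rw [Fin.cast_zmod_inj] at h3
    rw [h1, h3]
  rw [sq, ← pr_fin_lt hx, ← pr_prod,
    ← pr_equiv (Equiv.ofBijective φ (Finite.injective_iff_bijective.1 hφ))
      (fun k => (k.1 : ℕ) < x ∧ (k.2 : ℕ) < x)]
  rfl

theorem pr_coins {κ : Type*} [Fintype κ] [DecidableEq κ] (thr : κ → ℕ) (hthr : ∀ i, thr i ≤ q)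
    (J : Finset κ) :
    pr (fun c : κ → Fin q => ∀ i ∈ J, (c i : ℕ) < thr i) = ∏ i ∈ J, (thr i / q : ℝ) := by
  have : Nonempty (Fin q) := ⟨⟨0, (Fact.out : q.Prime).pos⟩⟩
  rw [pr_pi (fun i (a : Fin q) => i ∈ J → (a : ℕ) < thr i), ← prod_subset (subset_univ J)]
  · refine prod_congr rfl fun i hi => ?_
    rw [← pr_fin_lt (hthr i)]
    exact pr_congr fun a => by simp [hi]
  · intro i _ hi
    rw [← pr_true (Ω := Fin q)]
    exact pr_congr fun a => by simp [hi]

end Hash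

/-! ### The second moment of the number of sampled paths -/

section Copy

variable {q : ℕ} [Fact q.Prime] {κ : Type*} [Fintype κ] [DecidableEq κ] {n : ℕ}

instance : Nonempty (Fin q) := ⟨⟨0, (Fact.out : q.Prime).pos⟩⟩

/-- Four coefficients are the coefficients of two hash functions. -/
def splitCoefficients (q : ℕ) : (Fin 4 → Fin q) ≃ (Fin q × Fin q) × (Fin q × Fin q) where
  toFun h := ((h 0, h 1), (h 2, h 3))
  invFun k := ![k.1.1, k.1.2, k.2.1, k.2.2]
  left_inv h := by ext i; fin_cases i <;> rfl
  right_inv _ := rfl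

def HashX (x : ℕ) (h : Fin 4 → Fin q) (u : ℕ) : Prop := ((h 0 : ℕ) * u + h 1) % q < x

def HashY (y : ℕ) (h : Fin 4 → Fin q) (v : ℕ) : Prop := ((h 2 : ℕ) * v + h 3) % q < y

theorem pr_hashX_and_hashY (P R : Fin q × Fin q → Prop) :
    pr (fun h : Fin 4 → Fin q => P (h 0, h 1) ∧ R (h 2, h 3)) = pr P * pr R := by
  rw [← pr_prod]
  exact pr_equiv (splitCoefficients q) (fun k => P k.1 ∧ R k.2)

/-- The probability that two events of probability `z` both occur, when they are equal if `b` holds,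
and independent otherwise. -/
noncomputable def pairProb (b : Prop) [Decidable b] (z : ℝ) : ℝ := if b then z else z ^ 2

theorem pr_hash_pair {u v : ℕ} (hu : u < q) (hv : v < q) {x : ℕ} (hx : x ≤ q) :
    pr (fun k : Fin q × Fin q => ((k.1 : ℕ) * u + k.2) % q < x ∧ ((k.1 : ℕ) * v + k.2) % q < x) =
      pairProb (u = v) (x / q) := by
  unfold pairProb
  split_ifs with h
  · subst h
    simp only [and_self]
    exact pr_hash_lt u hx
  · exact pr_hash_lt_and hu hv h hx

/-- The event that the first and the last edge of the path `b, a, d, c` are sampled with the help of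
coins, and the middle one because of its end vertices. -/
def PathSampled (x y : ℕ) (e₁ e₂ : Quad (Fin n) → κ) (f : Quad (Fin n))
    (ω : (Fin 4 → Fin q) × (κ → Fin q)) : Prop :=
  HashX x ω.1 f.1 ∧ HashY y ω.1 f.2.2.2 ∧ (ω.2 (e₁ f) : ℕ) < y ∧ (ω.2 (e₂ f) : ℕ) < x

variable {x y : ℕ} {e₁ e₂ : Quad (Fin n) → κ} {thr : κ → ℕ}

theorem pr_pathSampled (hx : x ≤ q) (hy : y ≤ q) (hthr : ∀ i, thr i ≤ q) (f : Quad (Fin n))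
    (h1 : thr (e₁ f) = y) (h2 : thr (e₂ f) = x) (h12 : e₁ f ≠ e₂ f) :
    pr (PathSampled (q := q) x y e₁ e₂ f) = (x / q : ℝ) ^ 2 * (y / q : ℝ) ^ 2 := by
  have h : pr (PathSampled (q := q) x y e₁ e₂ f) =
      pr (fun ω : (Fin 4 → Fin q) × (κ → Fin q) =>
        (HashX x ω.1 f.1 ∧ HashY y ω.1 f.2.2.2) ∧
          ∀ i ∈ ({e₁ f, e₂ f} : Finset κ), (ω.2 i : ℕ) < thr i) :=
    pr_congr fun ω => by simp [PathSampled, h1, h2, and_assoc]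
  rw [h, pr_prod (fun h => HashX x h f.1 ∧ HashY y h f.2.2.2)
    (fun c : κ → Fin q => ∀ i ∈ ({e₁ f, e₂ f} : Finset κ), (c i : ℕ) < thr i),
    pr_coins thr hthr, prod_pair h12, h1, h2]
  have h3 := pr_hashX_and_hashY (q := q) (fun k => ((k.1 : ℕ) * f.1 + k.2) % q < x)
    (fun k => ((k.1 : ℕ) * f.2.2.2 + k.2) % q < y)
  rw [pr_hash_lt _ hx, pr_hash_lt _ hy] at h3
  change pr (fun h : Fin 4 → Fin q => HashX x h f.1 ∧ HashY y h f.2.2.2) = _ at h3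
  rw [h3]
  ring

/-- The hash of a, the hash of d, the coin of ab and the coin of dc are mutually independent. Within
each kind, the two cycles make the same choice or independent ones, so pairwise independent hashing
suffices. By `h12`, no coin serves both as a coin of rate y and as one of rate x. -/
theorem pr_pathSampled_and (hn : n ≤ q) (hx : x ≤ q) (hy : y ≤ q) (hthr : ∀ i, thr i ≤ q)
    (f g : Quad (Fin n))
    (h1 : thr (e₁ f) = y) (h2 : thr (e₂ f) = x) (h1' : thr (e₁ g) = y) (h2' : thr (e₂ g) = x)
    (h12 : ∀ f' ∈ ({f, g} : Finset (Quad (Fin n))), ∀ g' ∈ ({f, g} : Finset (Quad (Fin n))),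
      e₁ f' ≠ e₂ g') :
    pr (fun ω => PathSampled (q := q) x y e₁ e₂ f ω ∧ PathSampled (q := q) x y e₁ e₂ g ω) =
      pairProb (projA f = projA g) (x / q) * pairProb (projD f = projD g) (y / q) *
        (pairProb (e₁ f = e₁ g) (y / q) * pairProb (e₂ f = e₂ g) (x / q)) := by
  have h : pr (fun ω => PathSampled (q := q) x y e₁ e₂ f ω ∧
      PathSampled (q := q) x y e₁ e₂ g ω) =
      pr (fun ω : (Fin 4 → Fin q) × (κ → Fin q) =>
        ((HashX x ω.1 f.1 ∧ HashX x ω.1 g.1) ∧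
          (HashY y ω.1 f.2.2.2 ∧ HashY y ω.1 g.2.2.2)) ∧
          ∀ i ∈ ({e₁ f, e₁ g} ∪ {e₂ f, e₂ g} : Finset κ), (ω.2 i : ℕ) < thr i) := by
    refine pr_congr fun ω => ?_
    simp only [PathSampled, mem_union, mem_insert, mem_singleton, or_imp,
      forall_and, forall_eq, h1, h2, h1', h2']
    tauto
  have hdisj : Disjoint ({e₁ f, e₁ g} : Finset κ) {e₂ f, e₂ g} := by
    have a1 := h12 f (by simp) f (by simp)
    have a2 := h12 f (by simp) g (by simp)
    have a3 := h12 g (by simp) f (by simp)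
    have a4 := h12 g (by simp) g (by simp)
    simp only [disjoint_insert_left, disjoint_singleton_left, mem_insert, mem_singleton]
    tauto
  have hpair : ∀ (i j : κ) (z : ℕ), thr i = z → thr j = z →
      ∏ i ∈ ({i, j} : Finset κ), (thr i / q : ℝ) = pairProb (i = j) (z / q) := by
    intro i j z hi hj
    unfold pairProb
    split_ifs with h
    · subst h; simp [hi]
    · rw [prod_pair h, hi, hj, sq]
  rw [h, pr_prod (fun h => (HashX x h f.1 ∧ HashX x h g.1) ∧
      (HashY y h f.2.2.2 ∧ HashY y h g.2.2.2))
    (fun c : κ → Fin q =>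
      ∀ i ∈ ({e₁ f, e₁ g} ∪ {e₂ f, e₂ g} : Finset κ), (c i : ℕ) < thr i),
    pr_coins thr hthr, prod_union hdisj, hpair _ _ y h1 h1', hpair _ _ x h2 h2']
  congr 1
  have h3 := pr_hashX_and_hashY (q := q)
    (fun k => ((k.1 : ℕ) * f.1 + k.2) % q < x ∧ ((k.1 : ℕ) * g.1 + k.2) % q < x)
    (fun k => ((k.1 : ℕ) * f.2.2.2 + k.2) % q < y ∧ ((k.1 : ℕ) * g.2.2.2 + k.2) % q < y)
  rw [pr_hash_pair (f.1.2.trans_le hn) (g.1.2.trans_le hn) hx,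
    pr_hash_pair (f.2.2.2.2.trans_le hn) (g.2.2.2.2.trans_le hn) hy] at h3
  refine Eq.trans h3 ?_
  simp only [Fin.val_inj]

/-- Since `b` implies `a`, only three cases arise: no agreement, `a` alone, or both. Relative to
full independence they cost the factors 1, 1/X and 1/(XY), which are added. -/
theorem pairProb_mul_le {a b : Prop} [Decidable a] [Decidable b] (hab : b → a) {X Y : ℝ}
    (hX : 0 < X) (hY : 0 < Y) :
    pairProb a X * pairProb b Y ≤
      (X * Y) ^ 2 * (1 + (if a then 1 / X else 0) + if b then 1 / (X * Y) else 0) := by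
  unfold pairProb
  by_cases hb : b
  · simp only [hb, hab hb, if_true]
    have : (X * Y) ^ 2 * (1 + 1 / X + 1 / (X * Y)) = (X * Y) ^ 2 * (1 + 1 / X) + X * Y := by
      field_simp
    rw [this]
    have : 0 ≤ (X * Y) ^ 2 * (1 + 1 / X) := by positivity
    linarith
  · by_cases ha : a
    · simp only [hb, ha, if_true, if_false]
      have : (X * Y) ^ 2 * (1 + 1 / X + 0) = (X * Y) ^ 2 + X * Y ^ 2 := by
        field_simp
        ring
      rw [this]
      have : 0 ≤ (X * Y) ^ 2 := by positivity
      linarith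
    · simp only [hb, ha, if_false]
      exact le_of_eq (by ring)

theorem sum_agree {V : Type*} [DecidableEq V] (F : Finset (Quad V)) {β : Type*} [DecidableEq β]
    (π : Quad V → β) (f : Quad V) (z : ℝ) :
    ∑ g ∈ F, (if π f = π g then z else 0) = fiberCard F π f * z := by
  rw [← sum_filter, sum_const, nsmul_eq_mul, fiberCard]
  simp only [eq_comm]

/-- The product of the sums for (a, ab) and (d, cd) has nine terms. Agreement in a and d is
agreement in da; a with cd, and ab with d, give agreement in three vertices; ab with cd gives
equality. After summation over `g`, each term is at most `F.card` by one field of `RateBounds`, or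
trivially. -/
theorem RateBounds.sum_pairProb_le {V : Type*} [DecidableEq V] {F : Finset (Quad V)} {X Y : ℝ}
    (h : RateBounds F X Y) (hX : 0 < X) (hY : 0 < Y) {f : Quad V} (hf : f ∈ F) :
    ∑ g ∈ F, pairProb (projA f = projA g) X * pairProb (projD f = projD g) Y *
      (pairProb (projAB f = projAB g) Y * pairProb (projCD f = projCD g) X) ≤
      9 * F.card * (X ^ 2 * Y ^ 2) ^ 2 := by
  have hp : ∀ {b : Prop} [Decidable b] {z : ℝ}, 0 < z → 0 ≤ pairProb b z := by
    intro b _ z hz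
    unfold pairProb
    split_ifs <;> positivity
  have h1 : ∀ g ∈ F, pairProb (projA f = projA g) X * pairProb (projD f = projD g) Y *
      (pairProb (projAB f = projAB g) Y * pairProb (projCD f = projCD g) X) ≤
      (X ^ 2 * Y ^ 2) ^ 2 * (1 + (if projD f = projD g then 1 / Y else 0) +
        (if projCD f = projCD g then 1 / (X * Y) else 0) +
        (if projA f = projA g then 1 / X else 0) +
        (if projDA f = projDA g then 1 / (X * Y) else 0) +
        (if projACD f = projACD g then 1 / (X ^ 2 * Y) else 0) +
        (if projAB f = projAB g then 1 / (X * Y) else 0) +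
        (if projABD f = projABD g then 1 / (X * Y ^ 2) else 0) +
        (if f = g then 1 / (X ^ 2 * Y ^ 2) else 0)) := by
    intro g _
    have e1 := pairProb_mul_le (a := projA f = projA g) (b := projAB f = projAB g)
      (fun h => (Prod.mk.inj h).1) hX hY
    have e2 := pairProb_mul_le (a := projD f = projD g) (b := projCD f = projCD g)
      (fun h => (Prod.mk.inj h).2) hY hX
    calc _ = pairProb (projA f = projA g) X * pairProb (projAB f = projAB g) Y *
          (pairProb (projD f = projD g) Y * pairProb (projCD f = projCD g) X) := by ring
      _ ≤ _ := mul_le_mul e1 e2 (mul_nonneg (hp hY) (hp hX)) (by positivity)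
      _ = _ := by
        obtain ⟨a, b, c, d⟩ := f
        obtain ⟨a', b', c', d'⟩ := g
        simp only [Prod.mk.injEq]
        by_cases ha : a = a' <;> by_cases hb : b = b' <;> by_cases hc : c = c' <;>
          by_cases hd : d = d' <;> simp [ha, hb, hc, hd] <;> field_simp <;> ring
  refine (sum_le_sum h1).trans ?_
  rw [← mul_sum, mul_comm (9 * (F.card : ℝ))]
  refine mul_le_mul_of_nonneg_left ?_ (by positivity)
  simp only [sum_add_distrib, sum_agree]
  have hid : ∑ g ∈ F, (if f = g then 1 / (X ^ 2 * Y ^ 2) else 0) = 1 / (X ^ 2 * Y ^ 2) := by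
    rw [sum_ite_eq, if_pos hf]
  have key : ∀ {m z : ℝ}, 0 < z → m ≤ z * F.card → m * (1 / z) ≤ F.card := by
    intro m z hz hm
    rw [mul_one_div, div_le_iff₀ hz]
    linarith
  have k1 := key hY (h.le_D f hf)
  have k2 := key (mul_pos hX hY) (h.le_CD f hf)
  have k3 := key hX (h.le_A f hf)
  have k4 := key (mul_pos hX hY) (h.le_DA f hf)
  have k5 := key (by positivity) (h.le_ACD f hf)
  have k6 := key (mul_pos hX hY) (h.le_AB f hf)
  have k7 := key (by positivity) (h.le_ABD f hf)
  have k8 := key (by positivity) h.one_le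
  rw [hid, sum_const, nsmul_eq_mul, mul_one]
  linarith

theorem le_pr_exists_pathSampled (hn : n ≤ q) (hx : x ≤ q) (hy : y ≤ q) (hx0 : 0 < x)
    (hy0 : 0 < y) (hthr : ∀ i, thr i ≤ q) {F : Finset (Quad (Fin n))} (hF : F.Nonempty)
    (h1 : ∀ f ∈ F, thr (e₁ f) = y) (h2 : ∀ f ∈ F, thr (e₂ f) = x)
    (h12 : ∀ f ∈ F, ∀ g ∈ F, e₁ f ≠ e₂ g)
    (hi₁ : ∀ f ∈ F, ∀ g ∈ F, e₁ f = e₁ g ↔ projAB f = projAB g)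
    (hi₂ : ∀ f ∈ F, ∀ g ∈ F, e₂ f = e₂ g ↔ projCD f = projCD g)
    (hrate : RateBounds F (x / q) (y / q)) :
    1 / 9 ≤ pr (fun ω => ∃ f ∈ F, PathSampled (q := q) x y e₁ e₂ f ω) := by
  have hq : (0 : ℝ) < q := by exact_mod_cast (Fact.out : q.Prime).pos
  have hX : (0 : ℝ) < x / q := by positivity
  have hY : (0 : ℝ) < y / q := by positivity
  refine one_div_le_pr_exists F _ hF (P := (x / q : ℝ) ^ 2 * (y / q : ℝ) ^ 2) (by positivity)
    (fun f hf => pr_pathSampled hx hy hthr f (h1 f hf) (h2 f hf) (h12 f hf f hf)) ?_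
  have : ∀ f ∈ F, ∑ g ∈ F, pr (fun ω => PathSampled (q := q) x y e₁ e₂ f ω ∧
      PathSampled (q := q) x y e₁ e₂ g ω) ≤
      9 * F.card * ((x / q : ℝ) ^ 2 * (y / q : ℝ) ^ 2) ^ 2 := by
    intro f hf
    refine le_trans (le_of_eq (sum_congr rfl fun g hg => ?_)) (hrate.sum_pairProb_le hX hY hf)
    rw [pr_pathSampled_and hn hx hy hthr f g (h1 f hf) (h2 f hf) (h1 g hg) (h2 g hg)]
    · simp only [hi₁ f hf g hg, hi₂ f hf g hg]
    · intro f' hf' g' hg'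
      simp only [mem_insert, mem_singleton] at hf' hg'
      rcases hf' with rfl | rfl <;> rcases hg' with rfl | rfl
      exacts [h12 _ hf _ hf, h12 _ hf _ hg, h12 _ hg _ hf, h12 _ hg _ hg]
  refine (sum_le_sum this).trans (le_of_eq ?_)
  rw [sum_const, nsmul_eq_mul]
  ring

/-- The coefficients or coins of one copy, as numbers. -/
def toNatFun (h : Fin 4 → Fin q) (k : ℕ) : ℕ := h (Fin.ofNat 4 k)

theorem pr_keepEdge_le {I : Type*} [Fintype I] [DecidableEq I] (hx : x ≤ q) (hy : y ≤ q)
    (t : I) (u v : ℕ) :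
    pr (fun ω : (Fin 4 → Fin q) × (I × Fin 4 → Fin q) =>
      KeepEdge q x y (toNatFun ω.1) (toNatFun fun k => ω.2 (t, k)) u v) ≤
      6 * ((x / q : ℝ) * (y / q : ℝ)) := by
  have hX : ∀ w, pr (fun h : Fin 4 → Fin q => HashX x h w) = x / q := fun w => by
    rw [← pr_hash_lt w hx, ← pr_fst (Ω' := Fin q × Fin q)
      (fun k : Fin q × Fin q => ((k.1 : ℕ) * w + k.2) % q < x)]
    exact pr_equiv (splitCoefficients q) (fun k => ((k.1.1 : ℕ) * w + k.1.2) % q < x)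
  have hY : ∀ w, pr (fun h : Fin 4 → Fin q => HashY y h w) = y / q := fun w => by
    rw [← pr_hash_lt w hy, ← pr_snd (Ω := Fin q × Fin q)
      (fun k : Fin q × Fin q => ((k.1 : ℕ) * w + k.2) % q < y)]
    exact pr_equiv (splitCoefficients q) (fun k => ((k.2.1 : ℕ) * w + k.2.2) % q < y)
  have hcoin : ∀ (k : Fin 4) {z : ℕ}, z ≤ q →
      pr (fun c : I × Fin 4 → Fin q => (c (t, k) : ℕ) < z) = z / q := fun k z hz => by
    have := pr_coins (q := q) (fun _ : I × Fin 4 => z) (fun _ => hz) {(t, k)}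
    simpa using this
  have hXY : ∀ w w', pr (fun ω : (Fin 4 → Fin q) × (I × Fin 4 → Fin q) =>
      HashX x ω.1 w ∧ HashY y ω.1 w') = (x / q : ℝ) * (y / q : ℝ) := fun w w' => by
    rw [pr_fst (fun h : Fin 4 → Fin q => HashX x h w ∧ HashY y h w'), ← pr_hash_lt w hx,
      ← pr_hash_lt w' hy]
    exact pr_hashX_and_hashY (fun k => ((k.1 : ℕ) * w + k.2) % q < x)
      (fun k => ((k.1 : ℕ) * w' + k.2) % q < y)
  have hXc : ∀ w k, pr (fun ω : (Fin 4 → Fin q) × (I × Fin 4 → Fin q) =>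
      HashX x ω.1 w ∧ (ω.2 (t, k) : ℕ) < y) = (x / q : ℝ) * (y / q : ℝ) := fun w k => by
    rw [pr_prod (fun h => HashX x h w) (fun c : I × Fin 4 → Fin q => (c (t, k) : ℕ) < y),
      hX, hcoin k hy]
  have hYc : ∀ w k, pr (fun ω : (Fin 4 → Fin q) × (I × Fin 4 → Fin q) =>
      HashY y ω.1 w ∧ (ω.2 (t, k) : ℕ) < x) = (x / q : ℝ) * (y / q : ℝ) := fun w k => by
    rw [pr_prod (fun h => HashY y h w) (fun c : I × Fin 4 → Fin q => (c (t, k) : ℕ) < x),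
      hY, hcoin k hx, mul_comm]
  have h6 : ∀ p₁ p₂ p₃ p₄ p₅ p₆ : (Fin 4 → Fin q) × (I × Fin 4 → Fin q) → Prop,
      pr (fun ω => p₁ ω ∨ p₂ ω ∨ p₃ ω ∨ p₄ ω ∨ p₅ ω ∨ p₆ ω) ≤
        pr p₁ + (pr p₂ + (pr p₃ + (pr p₄ + (pr p₅ + pr p₆)))) := by
    intro p₁ p₂ p₃ p₄ p₅ p₆
    refine (pr_or_le _ _).trans (add_le_add le_rfl ?_)
    refine (pr_or_le _ _).trans (add_le_add le_rfl ?_)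
    refine (pr_or_le _ _).trans (add_le_add le_rfl ?_)
    refine (pr_or_le _ _).trans (add_le_add le_rfl ?_)
    exact pr_or_le _ _
  refine (h6 (fun ω => HashX x ω.1 u ∧ HashY y ω.1 v) (fun ω => HashX x ω.1 v ∧ HashY y ω.1 u)
    (fun ω => HashX x ω.1 u ∧ (ω.2 (t, 0) : ℕ) < y) (fun ω => HashX x ω.1 v ∧ (ω.2 (t, 1) : ℕ) < y)
    (fun ω => HashY y ω.1 u ∧ (ω.2 (t, 2) : ℕ) < x)
    (fun ω => HashY y ω.1 v ∧ (ω.2 (t, 3) : ℕ) < x)).trans ?_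
  rw [hXY, hXY, hXc, hXc, hYc, hYc]
  linarith

end Copy

/-! ### Properties of the parameters -/

theorem lt_two_pow_bitLen (n : ℕ) : n < 2 ^ bitLen n := by
  by_contra! h
  have h1 : bitLen n ≤ n := (Nat.lt_two_pow_self.trans_le h).le
  have h2 : bitLen n ≤ Nat.findGreatest (fun k => 2 ^ k ≤ n) n := Nat.le_findGreatest h1 h
  unfold bitLen at h2
  omega

theorem two_pow_bitLen_le {n : ℕ} (hn : 1 ≤ n) : 2 ^ bitLen n ≤ 2 * n := by
  have := Nat.findGreatest_spec (P := fun k => 2 ^ k ≤ n) (Nat.zero_le n) (by simpa using hn)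
  rw [bitLen, pow_succ']
  omega

theorem one_le_bitLen (n : ℕ) : 1 ≤ bitLen n := Nat.le_add_left _ _

/-- Bertrand's postulate. The field exceeds both `2 ^ i` and `√T` in the relevant ranges, so
rounding the thresholds up at most doubles them. -/
theorem prime_fieldSize {n : ℕ} (hn : 1 ≤ n) :
    (fieldSize n).Prime ∧ 16 * n ^ 2 < fieldSize n ∧ fieldSize n ≤ 32 * n ^ 2 := by
  obtain ⟨p, hp, h1, h2⟩ := Nat.exists_prime_lt_and_le_two_mul (16 * n ^ 2) (by positivity)
  have h3 : p ≤ fieldSize n := Nat.le_findGreatest h2 hp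
  refine ⟨Nat.findGreatest_spec (P := Nat.Prime) h2 hp, h1.trans_le h3, ?_⟩
  exact (Nat.findGreatest_le _).trans (le_of_eq (by ring))

theorem one_le_regLoss (n : ℕ) : 1 ≤ regLoss n := by
  have := one_le_bitLen n
  unfold regLoss
  have : 0 < (4 * bitLen n) ^ 4 := by positivity
  omega

theorem one_le_boost (n : ℕ) : 1 ≤ boost n := by
  have := one_le_regLoss n
  unfold boost
  have : 0 < regLoss n ^ 3 := by positivity
  omega

theorem two_pow_le_of_lt_levels {n i : ℕ} (hn : 1 ≤ n) (hi : i < levels n) :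
    2 ^ i ≤ 4 * n ^ 2 := by
  have h1 := two_pow_bitLen_le hn
  calc 2 ^ i ≤ 2 ^ (2 * bitLen n) := Nat.pow_le_pow_right (by norm_num) hi.le
    _ = (2 ^ bitLen n) ^ 2 := by rw [mul_comm, pow_mul]
    _ ≤ (2 * n) ^ 2 := by gcongr
    _ = 4 * n ^ 2 := by ring

theorem xThr_le (n i : ℕ) : xThr n i ≤ fieldSize n := min_le_left _ _

theorem yThr_le (n T i : ℕ) : yThr n T i ≤ fieldSize n := min_le_left _ _

theorem xThr_pos {n i : ℕ} (hn : 1 ≤ n) : 0 < xThr n i :=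
  lt_min (prime_fieldSize hn).1.pos (Nat.succ_pos _)

theorem yThr_pos {n T i : ℕ} (hn : 1 ≤ n) : 0 < yThr n T i :=
  lt_min (prime_fieldSize hn).1.pos (Nat.succ_pos _)

/-- The sampling rate of the first set of vertices. -/
noncomputable def xRate (n i : ℕ) : ℝ := (xThr n i : ℝ) / fieldSize n

/-- The sampling rate of the second set of vertices. -/
noncomputable def yRate (n T i : ℕ) : ℝ := (yThr n T i : ℝ) / fieldSize n

theorem one_le_two_pow_mul_xRate {n : ℕ} (hn : 1 ≤ n) (i : ℕ) : 1 ≤ 2 ^ i * xRate n i := by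
  have hq : (0 : ℝ) < fieldSize n := by exact_mod_cast (prime_fieldSize hn).1.pos
  have h2 : (0 : ℝ) < 2 ^ i := by positivity
  rw [xRate, ← mul_div_assoc, le_div_iff₀ hq, one_mul, xThr]
  rcases le_total (fieldSize n) (fieldSize n / 2 ^ i + 1) with h | h
  · rw [min_eq_left h]
    exact le_mul_of_one_le_left hq.le (one_le_pow₀ (by norm_num))
  · rw [min_eq_right h]
    have : fieldSize n < 2 ^ i * (fieldSize n / 2 ^ i + 1) :=
      Nat.lt_mul_div_succ _ (by positivity)
    exact_mod_cast this.le

theorem two_pow_mul_xRate_le {n i : ℕ} (hn : 1 ≤ n) (hi : i < levels n) :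
    2 ^ i * xRate n i ≤ 2 := by
  have hq : (0 : ℝ) < fieldSize n := by exact_mod_cast (prime_fieldSize hn).1.pos
  rw [xRate, ← mul_div_assoc, div_le_iff₀ hq]
  have h1 : 2 ^ i * (fieldSize n / 2 ^ i + 1) ≤ 2 * fieldSize n := by
    have h2 := two_pow_le_of_lt_levels hn hi
    have h3 := (prime_fieldSize hn).2.1
    have h4 := Nat.mul_div_le (fieldSize n) (2 ^ i)
    rw [mul_add]
    omega
  have h2 : 2 ^ i * xThr n i ≤ 2 * fieldSize n :=
    (Nat.mul_le_mul_left _ (min_le_right _ _)).trans h1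
  exact_mod_cast h2

theorem yRate_eq_one_or {n T : ℕ} (hn : 1 ≤ n) (hT : 1 ≤ T) (i : ℕ) :
    yRate n T i = 1 ∨ 2 * ((boost n : ℝ) / Nat.sqrt T) * 2 ^ i ≤ yRate n T i := by
  have hq : (0 : ℝ) < fieldSize n := by exact_mod_cast (prime_fieldSize hn).1.pos
  have hs : 0 < Nat.sqrt T := Nat.sqrt_pos.2 hT
  have hs' : (0 : ℝ) < Nat.sqrt T := by exact_mod_cast hs
  rw [yRate, yThr]
  rcases le_total (fieldSize n) (2 * boost n * fieldSize n * 2 ^ i / Nat.sqrt T + 1) with h | h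
  · left
    rw [min_eq_left h, div_self hq.ne']
  · right
    rw [min_eq_right h, le_div_iff₀ hq]
    have h1 : 2 * boost n * fieldSize n * 2 ^ i <
        Nat.sqrt T * (2 * boost n * fieldSize n * 2 ^ i / Nat.sqrt T + 1) :=
      Nat.lt_mul_div_succ _ hs
    have h2 : (2 * boost n * fieldSize n * 2 ^ i : ℝ) ≤
        Nat.sqrt T * ((2 * boost n * fieldSize n * 2 ^ i / Nat.sqrt T + 1 : ℕ) : ℝ) := by
      exact_mod_cast h1.le
    calc 2 * ((boost n : ℝ) / Nat.sqrt T) * 2 ^ i * fieldSize n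
        = (2 * boost n * fieldSize n * 2 ^ i : ℝ) / Nat.sqrt T := by ring
      _ ≤ _ := by rw [div_le_iff₀ hs']; linarith

/-- The intended value is `2 * boost n`, and the roundings of the two thresholds contribute a factor
2 each. For y this uses that `√T` is at most the field size, by `T ≤ n ^ 4`. -/
theorem xRate_mul_yRate_le {n T i : ℕ} (hn : 1 ≤ n) (hT : 1 ≤ T) (hTn : T ≤ n ^ 4)
    (hi : i < levels n) : xRate n i * yRate n T i * Nat.sqrt T ≤ 8 * boost n := by
  have hq : (0 : ℝ) < fieldSize n := by exact_mod_cast (prime_fieldSize hn).1.pos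
  have hs : 0 < Nat.sqrt T := Nat.sqrt_pos.2 hT
  have hsn : Nat.sqrt T ≤ n ^ 2 := by
    have h := Nat.sqrt_le_sqrt hTn
    rwa [show n ^ 4 = (n ^ 2) ^ 2 by ring, Nat.sqrt_eq'] at h
  have h2 : (0 : ℝ) < 2 ^ i := by positivity
  have hy : yRate n T i * Nat.sqrt T ≤ 4 * boost n * 2 ^ i := by
    have h1 : yThr n T i * Nat.sqrt T ≤ 4 * boost n * 2 ^ i * fieldSize n := by
      refine (Nat.mul_le_mul_right _ (min_le_right _ _)).trans ?_
      rw [add_mul, one_mul]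
      have h3 := Nat.div_mul_le_self (2 * boost n * fieldSize n * 2 ^ i) (Nat.sqrt T)
      have h4 : Nat.sqrt T ≤ 2 * boost n * 2 ^ i * fieldSize n := by
        calc Nat.sqrt T ≤ fieldSize n := by have := (prime_fieldSize hn).2.1; omega
          _ ≤ 2 * boost n * 2 ^ i * fieldSize n := Nat.le_mul_of_pos_left _ (by
            have := one_le_boost n; positivity)
      linarith
    rw [yRate, div_mul_eq_mul_div, div_le_iff₀ hq]
    exact_mod_cast h1
  have hx := two_pow_mul_xRate_le hn hi
  have hx0 : 0 ≤ xRate n i := by unfold xRate; positivity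
  calc xRate n i * yRate n T i * Nat.sqrt T = xRate n i * (yRate n T i * Nat.sqrt T) := by ring
    _ ≤ xRate n i * (4 * boost n * 2 ^ i) := by gcongr
    _ = 4 * boost n * (2 ^ i * xRate n i) := by ring
    _ ≤ 4 * boost n * 2 := by gcongr
    _ = _ := by ring

/-! ### The existence of a good level -/

theorem card_c4s_le {n : ℕ} (G : SimpleGraph (Fin n)) : (c4s G).card ≤ n ^ 4 := by
  refine (card_le_univ _).trans (le_of_eq ?_)
  simp only [Quad, Fintype.card_prod, Fintype.card_fin]
  ring

theorem exists_good_level {n T : ℕ} (hn : 1 ≤ n) (hT : 1 ≤ T) (G : SimpleGraph (Fin n))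
    (hG : T ≤ (c4s G).card) :
    ∃ i < levels n, ∃ F ⊆ c4s G, F.Nonempty ∧ RateBounds F (xRate n i) (yRate n T i) := by
  have hne : (c4s G).Nonempty := card_pos.1 (by omega)
  have hq : (0 : ℝ) < fieldSize n := by exact_mod_cast (prime_fieldSize hn).1.pos
  have hs : 0 < Nat.sqrt T := Nat.sqrt_pos.2 hT
  have hs' : (0 : ℝ) < Nat.sqrt T := by exact_mod_cast hs
  have hlev : 0 < levels n := by have := one_le_bitLen n; unfold levels; omega
  have hb : (1 : ℝ) ≤ boost n := by exact_mod_cast one_le_boost n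
  -- For small `T`, both thresholds at level 0 are the full field size: everything is kept, and a
  -- single cycle will do.
  rcases le_total (Nat.sqrt T) (boost n) with h | h
  · obtain ⟨f, hf⟩ := hne
    refine ⟨0, hlev, {f}, singleton_subset_iff.2 hf, singleton_nonempty _, ?_⟩
    have hx : xRate n 0 = 1 := by
      rw [xRate, xThr, pow_zero, Nat.div_one, min_eq_left (Nat.le_succ _), div_self hq.ne']
    have hy : yRate n T 0 = 1 := by
      rw [yRate, yThr, min_eq_left, div_self hq.ne']
      refine le_trans ?_ (Nat.le_succ _)
      rw [Nat.le_div_iff_mul_le hs]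
      nlinarith
    rw [hx, hy]
    exact rateBounds_singleton f
  -- With N the number of labelled cycles, this `lam` lies between 10√N, as the heavy-edge count
  -- requires, and 20√N, as the choice of rates requires.
  · obtain ⟨F, hF, hcard, α, δ, μ, ν, hreg⟩ := exists_isRegular_c4s (G := G)
      (lam := 10 * (Nat.sqrt (c4s G).card + 1)) (K := 4 * bitLen n) (by
        have := Nat.lt_succ_sqrt (c4s G).card
        simp only [Nat.succ_eq_add_one] at this
        nlinarith) (by
        calc (c4s G).card ≤ n ^ 4 := card_c4s_le G
          _ < (2 ^ bitLen n) ^ 4 := Nat.pow_lt_pow_left (lt_two_pow_bitLen n) (by norm_num)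
          _ = 2 ^ (4 * bitLen n) := by rw [← pow_mul, mul_comm]) hne
    have hN1 : (1 : ℝ) ≤ (c4s G).card := by exact_mod_cast card_pos.2 hne
    have hsqrt1 : 1 ≤ Real.sqrt (c4s G).card := Real.one_le_sqrt.2 hN1
    have hsT : (Nat.sqrt T : ℝ) ≤ Real.sqrt (c4s G).card :=
      Real.nat_sqrt_le_real_sqrt.trans (Real.sqrt_le_sqrt (by exact_mod_cast hG))
    obtain ⟨i, hi, hrate⟩ := hreg.exists_rates (L := regLoss n) (s := (boost n : ℝ) / Nat.sqrt T)
      (by exact_mod_cast one_le_regLoss n)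
      (by exact_mod_cast hcard)
      (by
        have : (Nat.sqrt (c4s G).card : ℝ) ≤ Real.sqrt (c4s G).card := Real.nat_sqrt_le_real_sqrt
        push_cast
        linarith)
      (by
        have : (160 * (regLoss n : ℝ) ^ 3) = boost n := by unfold boost; push_cast; ring
        rw [this, div_mul_eq_mul_div, le_div_iff₀ hs']
        gcongr)
      (by positivity)
      (by rw [div_le_one hs']; exact_mod_cast h)
    refine ⟨i, ?_, F, hF, hreg.nonempty, hrate _ _ (by unfold yRate; positivity)
      (one_le_two_pow_mul_xRate hn i) (yRate_eq_one_or hn hT i)⟩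
    -- The level is among those tried because `2 ^ i ≤ √T ≤ n ^ 2 < 2 ^ levels n`.
    have h1 : (2 : ℝ) ^ i ≤ Nat.sqrt T := by
      rw [← mul_div_assoc, div_le_one hs'] at hi
      exact (le_mul_of_one_le_right (by positivity) hb).trans hi
    have h2 : 2 ^ i ≤ Nat.sqrt T := by exact_mod_cast h1
    have h3 : Nat.sqrt T ≤ n ^ 2 := by
      have h := Nat.sqrt_le_sqrt (hG.trans (card_c4s_le G))
      rwa [show n ^ 4 = (n ^ 2) ^ 2 by ring, Nat.sqrt_eq'] at h
    have h4 : n ^ 2 < 2 ^ levels n := by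
      unfold levels
      rw [mul_comm, pow_mul]
      exact Nat.pow_lt_pow_left (lt_two_pow_bitLen n) (by norm_num)
    exact (Nat.pow_lt_pow_iff_right (by norm_num)).1 ((h2.trans h3).trans_lt h4)

/-! ### The success probability of one copy -/

/-- If every event of a sequence has probability at most `π`, then the number of events that occur
among the first `k` is likely to be at most `B * k`, for all `k` simultaneously. -/
theorem pr_exists_prefix_le {Ω : Type*} [Fintype Ω] {m L : ℕ} (p : Fin m → Ω → Prop)
    [∀ t ω, Decidable (p t ω)] {π B : ℝ} (hπ0 : 0 ≤ π) (hπ : ∀ t, pr (p t) ≤ π) (hB : 0 < B)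
    (hm : m ≤ 2 ^ L) :
    pr (fun ω => ∃ k ≤ m, B * k < ((univ.filter fun t => t.1 < k ∧ p t ω).card : ℝ)) ≤
      (L + 1) * (2 * π / B) := by
  have h1 : pr (fun ω => ∃ k ≤ m, B * k < ((univ.filter fun t => t.1 < k ∧ p t ω).card : ℝ)) ≤
      pr (fun ω => ∃ j ∈ range (L + 1), B * 2 ^ j / 2 ≤
        ((((univ : Finset (Fin m)).filter fun t => t.1 < 2 ^ j).filter
          fun t => p t ω).card : ℝ)) := by
    refine pr_mono fun ω => ?_
    rintro ⟨k, hk, h⟩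
    have hk0 : k ≠ 0 := by rintro rfl; simp at h
    -- Round the length up to a power of two: the prefix grows at most twofold, and Markov's
    -- inequality is needed only at `L + 1` times.
    refine ⟨Nat.clog 2 k, mem_range_succ_iff.2 (Nat.clog_le_of_le_pow (hk.trans hm)), ?_⟩
    have hle : k ≤ 2 ^ Nat.clog 2 k := Nat.le_pow_clog (by norm_num) k
    have hlt : 2 ^ Nat.clog 2 k ≤ 2 * k := by
      rcases Nat.lt_or_ge 1 k with h1 | h1
      · have := Nat.pow_pred_clog_lt_self (b := 2) (by norm_num) h1
        have hpos := Nat.clog_pos (b := 2) (by norm_num) h1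
        obtain ⟨s, hs⟩ := Nat.exists_eq_succ_of_ne_zero hpos.ne'
        rw [hs] at this ⊢
        simp only [Nat.pred_eq_sub_one, Nat.succ_sub_one] at this
        rw [pow_succ]
        omega
      · have : k = 1 := by omega
        simp [this]
    have hlt' : (2 : ℝ) ^ Nat.clog 2 k ≤ 2 * k := by exact_mod_cast hlt
    have hsub : ((univ.filter fun t => t.1 < k ∧ p t ω).card : ℝ) ≤
        ((((univ : Finset (Fin m)).filter fun t => t.1 < 2 ^ Nat.clog 2 k).filter
          fun t => p t ω).card : ℝ) := by
      rw [filter_filter]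
      refine Nat.cast_le.2 (card_le_card fun t ht => ?_)
      simp only [mem_filter] at ht ⊢
      exact ⟨ht.1, ht.2.1.trans_le hle, ht.2.2⟩
    refine le_trans ?_ (h.le.trans hsub)
    nlinarith
  refine h1.trans ((pr_exists_le _ _).trans ?_)
  refine (sum_le_card_nsmul _ _ (2 * π / B) fun j _ => ?_).trans (le_of_eq (by simp))
  have h2 := mul_pr_lt_card_le ((univ : Finset (Fin m)).filter fun t => t.1 < 2 ^ j) p
    (B * 2 ^ j / 2)
  have h3 : (((univ : Finset (Fin m)).filter fun t => t.1 < 2 ^ j).card : ℝ) ≤ 2 ^ j := by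
    rw [Fin.card_filter_val_lt]
    exact_mod_cast min_le_right _ _
  have h4 := h2.trans ((sum_le_card_nsmul _ _ π fun t _ => hπ t).trans
    (le_of_eq (nsmul_eq_mul _ _)))
  have h5 := h4.trans (mul_le_mul_of_nonneg_right h3 hπ0)
  rw [le_div_iff₀ hB]
  refine le_of_mul_le_mul_left ?_ (show (0 : ℝ) < 2 ^ j by positivity)
  linarith

section CopyEvent

variable {n : ℕ}

/-- All edges of a path `b, a, d, c` that is closed by an edge to a four-cycle are kept, and the
number of kept edges never exceeds the capacity of the copy. -/
def CopySucceeds (G : SimpleGraph (Fin n)) (T i : ℕ) (es : List (Fin n × Fin n)) (h : ℕ → ℕ)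
    (coin : Fin es.length → ℕ → ℕ) : Prop :=
  (∃ f, IsC4 G f ∧ ∀ e ∈ [(f.1, f.2.1), (f.1, f.2.2.2), (f.2.2.2, f.2.2.1)],
    ∃ t : Fin es.length, (es[t] = e ∨ es[t] = e.swap) ∧
      KeepEdge (fieldSize n) (xThr n i) (yThr n T i) h (coin t) es[t].1 es[t].2) ∧
  ∀ k ≤ es.length, (univ.filter fun t : Fin es.length => t.1 < k ∧
    KeepEdge (fieldSize n) (xThr n i) (yThr n T i) h (coin t) es[t].1 es[t].2).card * Nat.sqrt T ≤
      capFactor n * k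

theorem length_le_of_isEdgeStream {G : SimpleGraph (Fin n)} {es : List (Fin n × Fin n)}
    (hes : IsEdgeStream G es) : es.length ≤ n ^ 2 := by
  have h1 := (hes.1.of_map _).length_le_card
  simpa [sq] using h1

theorem exists_index_of_isEdgeStream {G : SimpleGraph (Fin n)} {es : List (Fin n × Fin n)}
    (hes : IsEdgeStream G es) {u v : Fin n} (h : G.Adj u v) :
    ∃ t : Fin es.length, es[t] = (u, v) ∨ es[t] = (v, u) := by
  obtain ⟨e, he, heq⟩ := List.mem_map.1 ((hes.2 u v).2 h)
  obtain ⟨t, ht, rfl⟩ := List.mem_iff_getElem.1 he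
  refine ⟨⟨t, ht⟩, ?_⟩
  rw [Sym2.eq_iff] at heq
  rcases heq with h | h
  · exact Or.inl (Prod.ext h.1 h.2)
  · exact Or.inr (Prod.ext h.1 h.2)

variable {q : ℕ} [Fact q.Prime]

theorem le_pr_exists_keepEdge {x y : ℕ} {G : SimpleGraph (Fin n)} {es : List (Fin n × Fin n)}
    (hes : IsEdgeStream G es) (hn : n ≤ q) (hx : x ≤ q) (hy : y ≤ q) (hx0 : 0 < x) (hy0 : 0 < y)
    {I : Type*} [Fintype I] [DecidableEq I] (ρ : Fin es.length → I) (hρ : ρ.Injective)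
    {F : Finset (Quad (Fin n))} (hFG : F ⊆ c4s G) (hF : F.Nonempty)
    (hrate : RateBounds F (x / q) (y / q)) :
    1 / 9 ≤ pr (fun ω : (Fin 4 → Fin q) × (I × Fin 4 → Fin q) =>
      ∃ f, IsC4 G f ∧ ∀ e ∈ [(f.1, f.2.1), (f.1, f.2.2.2), (f.2.2.2, f.2.2.1)],
        ∃ t : Fin es.length, (es[t] = e ∨ es[t] = e.swap) ∧
          KeepEdge q x y (toNatFun ω.1) (toNatFun fun k => ω.2 (ρ t, k)) es[t].1 es[t].2) := by
  obtain ⟨f₀, hf₀⟩ := hF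
  -- A default position for pairs that are not edges.
  obtain ⟨t₀, -⟩ := exists_index_of_isEdgeStream hes (mem_c4s.1 (hFG hf₀)).1
  have hidx : ∀ e : Fin n × Fin n, ∃ t : Fin es.length,
      G.Adj e.1 e.2 → es[t] = e ∨ es[t] = e.swap := fun e => by
    by_cases h : G.Adj e.1 e.2
    · obtain ⟨t, ht⟩ := exists_index_of_isEdgeStream hes h
      exact ⟨t, fun _ => ht⟩
    · exact ⟨t₀, fun h' => absurd h' h⟩
  choose idx hidx using hidx
  -- The stream may present an edge in either orientation, and `KeepEdge` has a separate coin for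
  -- each endpoint. The slot is chosen by the orientation, so that different ordered pairs, even the
  -- two orientations of one edge, use different coins.
  let slot : Fin n × Fin n → Fin 4 → Fin 4 → I × Fin 4 := fun e s s' =>
    (ρ (idx e), if es[idx e] = e then s else s')
  have slot_inj : ∀ {e e' : Fin n × Fin n} {s s' : Fin 4}, G.Adj e.1 e.2 → G.Adj e'.1 e'.2 →
      s ≠ s' → slot e s s' = slot e' s s' → e = e' := by
    intro e e' s s' he he' hs h
    obtain ⟨h1, h2⟩ := Prod.mk.inj h
    have h1 := hρ h1
    have k1 := hidx e he
    have k2 := hidx e' he'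
    simp only [← h1] at k2 h2
    split_ifs at h2 with c1 c2 c2
    · exact c1.symm.trans c2
    · exact absurd h2 hs
    · exact absurd h2.symm hs
    · have := (k1.resolve_left c1).symm.trans (k2.resolve_left c2)
      exact Prod.swap_injective this
  have main := le_pr_exists_pathSampled (q := q) (κ := I × Fin 4) (x := x) (y := y)
    (e₁ := fun f => slot (f.1, f.2.1) 0 1) (e₂ := fun f => slot (f.2.2.2, f.2.2.1) 2 3)
    (thr := fun i => if i.2 < 2 then y else x) hn hx hy hx0 hy0
    (fun i => by split_ifs <;> assumption) ⟨f₀, hf₀⟩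
    (fun f _ => by simp only [slot]; split_ifs <;> simp_all)
    (fun f _ => by simp only [slot]; split_ifs <;> simp_all)
    (fun f _ g _ h => by
      have := (Prod.mk.inj h).2
      split_ifs at this <;> exact absurd this (by decide))
    (fun f hf g hg => by
      have hf := mem_c4s.1 (hFG hf)
      have hg := mem_c4s.1 (hFG hg)
      exact ⟨slot_inj hf.1 hg.1 (by decide), fun h => by rw [show (f.1, f.2.1) = _ from h]⟩)
    (fun f hf g hg => by
      have hf := mem_c4s.1 (hFG hf)
      have hg := mem_c4s.1 (hFG hg)
      refine ⟨fun h => ?_, fun h => ?_⟩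
      · have := slot_inj (e := (f.2.2.2, f.2.2.1)) (e' := (g.2.2.2, g.2.2.1))
          hf.2.2.1.symm hg.2.2.1.symm (by decide) h
        simp only [Prod.mk.injEq] at this ⊢
        exact this.symm
      · simp only [Prod.mk.injEq] at h
        rw [h.1, h.2])
    hrate
  refine main.trans (pr_mono ?_)
  rintro ω ⟨f, hf, hfx, hfy, hc1, hc2⟩
  have hf := mem_c4s.1 (hFG hf)
  refine ⟨f, hf, ?_⟩
  simp only [List.mem_cons, List.not_mem_nil, or_false, forall_eq_or_imp, forall_eq]
  refine ⟨⟨idx (f.1, f.2.1), hidx _ hf.1, ?_⟩, ⟨idx (f.1, f.2.2.2), hidx _ hf.2.2.2.1.symm, ?_⟩,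
    ⟨idx (f.2.2.2, f.2.2.1), hidx _ hf.2.2.1.symm, ?_⟩⟩
  · by_cases h : es[idx (f.1, f.2.1)] = (f.1, f.2.1)
    · simp only [slot, if_pos h] at hc1
      rw [h]
      exact Or.inr (Or.inr (Or.inl ⟨hfx, hc1⟩))
    · simp only [slot, if_neg h] at hc1
      rw [(hidx _ hf.1).resolve_left h]
      exact Or.inr (Or.inr (Or.inr (Or.inl ⟨hfx, hc1⟩)))
  · rcases hidx (f.1, f.2.2.2) hf.2.2.2.1.symm with h | h
    · rw [h]
      exact Or.inl ⟨hfx, hfy⟩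
    · rw [h]
      exact Or.inr (Or.inl ⟨hfx, hfy⟩)
  · by_cases h : es[idx (f.2.2.2, f.2.2.1)] = (f.2.2.2, f.2.2.1)
    · simp only [slot, if_pos h] at hc2
      rw [h]
      exact Or.inr (Or.inr (Or.inr (Or.inr (Or.inl ⟨hfy, hc2⟩))))
    · simp only [slot, if_neg h] at hc2
      rw [(hidx _ hf.2.2.1.symm).resolve_left h]
      exact Or.inr (Or.inr (Or.inr (Or.inr (Or.inr ⟨hfy, hc2⟩))))

end CopyEvent

/-- An item is kept with probability at most 6xy ≤ 48·`boost n`/√T. The constant 6144 = 64·2·48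
makes each of the `2 * bitLen n + 1` dyadic times contribute at most 1/(64(`bitLen n` + 1)). -/
theorem pr_exceeds_capacity_le {n T i : ℕ} (hn : 1 ≤ n) (hT : 1 ≤ T) (hTn : T ≤ n ^ 4)
    (hi : i < levels n) [Fact (fieldSize n).Prime] {es : List (Fin n × Fin n)}
    (hlen : es.length ≤ n ^ 2)
    {I : Type*} [Fintype I] [DecidableEq I] (ρ : Fin es.length → I) :
    pr (fun ω : (Fin 4 → Fin (fieldSize n)) × (I × Fin 4 → Fin (fieldSize n)) =>
      ¬ ∀ k ≤ es.length, (univ.filter fun t : Fin es.length => t.1 < k ∧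
        KeepEdge (fieldSize n) (xThr n i) (yThr n T i) (toNatFun ω.1)
          (toNatFun fun k => ω.2 (ρ t, k)) es[t].1 es[t].2).card * Nat.sqrt T ≤
            capFactor n * k) ≤ 1 / 32 := by
  have hs : (0 : ℝ) < Nat.sqrt T := by exact_mod_cast Nat.sqrt_pos.2 hT
  have hcap : (0 : ℝ) < capFactor n := by
    have := one_le_boost n
    unfold capFactor; positivity
  have h := pr_exists_prefix_le (L := 2 * bitLen n) (m := es.length)
    (fun t (ω : (Fin 4 → Fin (fieldSize n)) × (I × Fin 4 → Fin (fieldSize n))) =>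
      KeepEdge (fieldSize n) (xThr n i) (yThr n T i) (toNatFun ω.1)
        (toNatFun fun k => ω.2 (ρ t, k)) es[t].1 es[t].2)
    (by positivity) (fun t => pr_keepEdge_le (xThr_le n i) (yThr_le n T i) (ρ t) es[t].1 es[t].2)
    (B := (capFactor n : ℝ) / Nat.sqrt T) (by positivity) (by
      calc es.length ≤ n ^ 2 := hlen
        _ ≤ (2 ^ bitLen n) ^ 2 := Nat.pow_le_pow_left (lt_two_pow_bitLen n).le 2
        _ = _ := by rw [← pow_mul, mul_comm])
  refine le_trans (pr_mono fun ω hω => ?_) (h.trans ?_)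
  · push Not at hω
    obtain ⟨k, hk, hω⟩ := hω
    refine ⟨k, hk, ?_⟩
    rw [div_mul_eq_mul_div, div_lt_iff₀ hs]
    exact_mod_cast hω
  · have h1 := xRate_mul_yRate_le hn hT hTn hi
    unfold xRate yRate at h1
    generalize (xThr n i / fieldSize n * (yThr n T i / fieldSize n) : ℝ) = z at h1
    have hb : (0 : ℝ) < boost n := by exact_mod_cast one_le_boost n
    have h2 : 2 * (6 * z) / ((capFactor n : ℝ) / Nat.sqrt T) ≤ 1 / (64 * (bitLen n + 1)) := by
      rw [div_div_eq_mul_div, div_le_div_iff₀ hcap (by positivity)]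
      have : (capFactor n : ℝ) = 6144 * (bitLen n + 1) * boost n := by
        unfold capFactor; push_cast; rfl
      rw [this]
      have : 0 ≤ ((bitLen n : ℝ) + 1) := by positivity
      nlinarith
    calc ((2 * bitLen n : ℕ) + 1 : ℝ) * (2 * (6 * z) / ((capFactor n : ℝ) / Nat.sqrt T))
        ≤ ((2 * bitLen n : ℕ) + 1 : ℝ) * (1 / (64 * (bitLen n + 1))) := by gcongr
      _ ≤ 1 / 32 := by
        push_cast
        rw [mul_one_div, div_le_div_iff₀ (by positivity) (by norm_num)]
        linarith

/-- The loss through the capacity is affordable: 1/9 - 1/32 ≥ 1/32. -/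
theorem le_pr_copySucceeds {n T : ℕ} (hn : 1 ≤ n) (hT : 1 ≤ T) [Fact (fieldSize n).Prime]
    {G : SimpleGraph (Fin n)} (hG : T ≤ (c4s G).card) {es : List (Fin n × Fin n)}
    (hes : IsEdgeStream G es)
    {I : Type*} [Fintype I] [DecidableEq I] (ρ : Fin es.length → I) (hρ : ρ.Injective) :
    ∃ i < levels n, 1 / 32 ≤
      pr (fun ω : (Fin 4 → Fin (fieldSize n)) × (I × Fin 4 → Fin (fieldSize n)) =>
        CopySucceeds G T i es (toNatFun ω.1) fun t => toNatFun fun k => ω.2 (ρ t, k)) := by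
  obtain ⟨i, hi, F, hFG, hF, hrate⟩ := exists_good_level hn hT G hG
  refine ⟨i, hi, ?_⟩
  have h1 := pr_exceeds_capacity_le hn hT (hG.trans (card_c4s_le G)) hi
    (length_le_of_isEdgeStream hes) ρ
  have h2 := le_pr_exists_keepEdge hes (q := fieldSize n)
    (by have := (prime_fieldSize hn).2.1; nlinarith) (xThr_le n i) (yThr_le n T i)
    (xThr_pos hn) (yThr_pos hn) ρ hρ hFG hF hrate
  have h3 := pr_or_le (fun ω : (Fin 4 → Fin (fieldSize n)) × (I × Fin 4 → Fin (fieldSize n)) =>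
        CopySucceeds G T i es (toNatFun ω.1) fun t => toNatFun fun k => ω.2 (ρ t, k))
    (fun ω => ¬ ∀ k ≤ es.length, (univ.filter fun t : Fin es.length => t.1 < k ∧
        KeepEdge (fieldSize n) (xThr n i) (yThr n T i) (toNatFun ω.1)
          (toNatFun fun k => ω.2 (ρ t, k)) es[t].1 es[t].2).card * Nat.sqrt T ≤
            capFactor n * k)
  have h4 := h2.trans (pr_mono fun ω h => show CopySucceeds G T i es (toNatFun ω.1)
      (fun t => toNatFun fun k => ω.2 (ρ t, k)) ∨ ¬ ∀ k ≤ es.length,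
        (univ.filter fun t : Fin es.length => t.1 < k ∧
        KeepEdge (fieldSize n) (xThr n i) (yThr n T i) (toNatFun ω.1)
          (toNatFun fun k => ω.2 (ρ t, k)) es[t].1 es[t].2).card * Nat.sqrt T ≤
            capFactor n * k from
      or_iff_not_imp_right.2 fun h' => ⟨h, not_not.1 h'⟩)
  linarith

/-! ### The copies of the sampling procedure -/

theorem keepEdge_congr {q x y u v : ℕ} {h h' coin coin' : ℕ → ℕ} (hh : ∀ k < 4, h k = h' k)
    (hc : ∀ k < 4, coin k = coin' k) :
    KeepEdge q x y h coin u v ↔ KeepEdge q x y h' coin' u v := by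
  unfold KeepEdge
  rw [hh 0 (by norm_num), hh 1 (by norm_num), hh 2 (by norm_num), hh 3 (by norm_num),
    hc 0 (by norm_num), hc 1 (by norm_num), hc 2 (by norm_num), hc 3 (by norm_num)]

theorem copySucceeds_congr {n T i : ℕ} {G : SimpleGraph (Fin n)} {es : List (Fin n × Fin n)}
    {h h' : ℕ → ℕ} {coin coin' : Fin es.length → ℕ → ℕ} (hh : ∀ k < 4, h k = h' k)
    (hc : ∀ t, ∀ k < 4, coin t k = coin' t k) :
    CopySucceeds G T i es h coin ↔ CopySucceeds G T i es h' coin' := by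
  have key : ∀ (t : Fin es.length) (u v : ℕ),
      KeepEdge (fieldSize n) (xThr n i) (yThr n T i) h (coin t) u v ↔
        KeepEdge (fieldSize n) (xThr n i) (yThr n T i) h' (coin' t) u v :=
    fun t u v => keepEdge_congr hh (hc t)
  unfold CopySucceeds
  simp only [key]

theorem countP_take {α : Type*} (p : α → Prop) [DecidablePred p] (l : List α) (k : ℕ) :
    (l.take k).countP (fun a => p a) =
      (univ.filter fun t : Fin l.length => t.1 < k ∧ p l[t]).card := by
  induction l generalizing k with
  | nil => simp
  | cons a l ih =>
    cases k with
    | zero => simp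
    | succ k =>
      rw [List.take_succ_cons, List.countP_cons, ih k]
      have := Fin.card_filter_univ_succ
        (fun t : Fin (l.length + 1) => t.1 < k + 1 ∧ p ((a :: l)[t]))
      simp only [List.length_cons]
      rw [this]
      by_cases h : p a <;> simp [h, add_comm]

theorem zip_getElem_streamItems {n : ℕ} (es : List (Fin n × Fin n)) (rs : List ℕ)
    (hlen : es.length ≤ rs.length) (t : ℕ) (ht : t < es.length) :
    ∃ h : t < ((streamItems es).zip rs).length, ((streamItems es).zip rs)[t] =
      ((((es[t].1 : Fin n) : ℕ), ((es[t].2 : Fin n) : ℕ)), rs[t]) := by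
  refine ⟨by simp [streamItems]; omega, ?_⟩
  simp [streamItems]

theorem inRange_zip {n : ℕ} (es : List (Fin n × Fin n)) (rs : List ℕ) :
    InRange n ((streamItems es).zip rs).reverse := by
  rintro ⟨e, r⟩ hp
  have he := (List.of_mem_zip (List.mem_reverse.1 hp)).1
  obtain ⟨e', -, rfl⟩ := List.mem_map.1 he
  exact ⟨e'.1.2, e'.2.2⟩

/-- Translates between suffixes of the reversed list of items and initial segments of the stream. -/
theorem length_kept_of_suffix {n T j key : ℕ} (es : List (Fin n × Fin n)) (rs : List ℕ)
    (hlen : es.length ≤ rs.length) {l' : List ((ℕ × ℕ) × ℕ)}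
    (hl' : l' <:+ ((streamItems es).zip rs).reverse) :
    l'.length ≤ es.length ∧ (kept n T j key l').length =
      (univ.filter fun t : Fin es.length => t.1 < l'.length ∧
        Keep n T j key rs[t] es[t].1 es[t].2).card := by
  have hZ : ((streamItems es).zip rs).length = es.length := by simp [streamItems]; omega
  have h1 : l'.reverse <+: (streamItems es).zip rs := by
    rw [← List.reverse_reverse ((streamItems es).zip rs)]
    exact List.reverse_prefix.2 hl'
  have h2 := List.prefix_iff_eq_take.1 h1
  rw [List.length_reverse] at h2
  refine ⟨by simpa [hZ] using h1.length_le, ?_⟩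
  rw [kept, ← List.countP_eq_length_filter, ← List.countP_reverse, h2,
    countP_take (fun p : (ℕ × ℕ) × ℕ => Keep n T j key p.2 p.1.1 p.1.2)]
  refine card_bij' (fun t _ => Fin.cast hZ t) (fun t _ => Fin.cast hZ.symm t) ?_ ?_ ?_ ?_
  · intro t ht
    obtain ⟨_, h3⟩ := zip_getElem_streamItems es rs hlen t (hZ ▸ t.2)
    simp only [mem_filter, mem_univ, true_and, Fin.getElem_fin] at ht ⊢
    rw [h3] at ht
    exact ht
  · intro t ht
    obtain ⟨_, h3⟩ := zip_getElem_streamItems es rs hlen t t.2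
    simp only [mem_filter, mem_univ, true_and, Fin.getElem_fin] at ht ⊢
    simp only [Fin.val_cast, h3]
    exact ht
  · intro t _; rfl
  · intro t _; rfl

theorem exists_closes_of_copySucceeds {c n T key j : ℕ} {G : SimpleGraph (Fin n)}
    {es : List (Fin n × Fin n)} (hes : IsEdgeStream G es) {rs : List ℕ}
    (hlen : es.length ≤ rs.length) (hj : j < copies c n)
    (h : CopySucceeds G T (j % levels n) es (fun k => digit (fieldSize n) key (k + 4 * j))
      fun t k => digit (fieldSize n) rs[t] (k + 4 * j)) :
    ∃ e ∈ streamItems es,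
      Closes n (sampled c n T key ((streamItems es).zip rs).reverse) e.1 e.2 := by
  obtain ⟨⟨f, hf, hpath⟩, hcap⟩ := h
  have hstored : ∀ e ∈ [(f.1, f.2.1), (f.1, f.2.2.2), (f.2.2.2, f.2.2.1)],
      StoredAdj n (sampled c n T key ((streamItems es).zip rs).reverse)
        (e.1 : Fin n) (e.2 : Fin n) ∧
      StoredAdj n (sampled c n T key ((streamItems es).zip rs).reverse)
        (e.2 : Fin n) (e.1 : Fin n) := by
    intro e he
    obtain ⟨t, ht, hk⟩ := hpath e he
    obtain ⟨h1, h2⟩ := zip_getElem_streamItems es rs hlen t t.2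
    have hmem : ((((es[t].1 : Fin n) : ℕ), ((es[t].2 : Fin n) : ℕ)), rs[t]) ∈
        ((streamItems es).zip rs).reverse := by
      rw [List.mem_reverse, Fin.getElem_fin, Fin.getElem_fin, ← h2]
      exact List.getElem_mem _
    have := storedAdj_of_keep (T := T) (key := key) (inRange_zip es rs) hj (fun l' hl' => by
      obtain ⟨h3, h4⟩ := length_kept_of_suffix (T := T) (j := j) (key := key) es rs hlen hl'
      rw [h4]
      exact hcap _ h3) hmem hk
    rcases ht with ht | ht
    · rwa [ht] at this
    · rw [ht] at this
      exact ⟨this.2, this.1⟩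
  simp only [List.mem_cons, List.not_mem_nil, or_false, forall_eq_or_imp, forall_eq] at hstored
  obtain ⟨hab, had, hdc⟩ := hstored
  obtain ⟨-, hbc, -, -, hac, hbd⟩ := hf
  -- The edge bc closes the stored path; its orientation in the stream decides in which direction
  -- the path is read.
  obtain ⟨t, ht⟩ := exists_index_of_isEdgeStream hes hbc
  refine ⟨_, List.mem_map.2 ⟨es[t], List.getElem_mem _, rfl⟩, ?_⟩
  rcases ht with ht | ht
  · rw [ht]
    exact ⟨f.1, f.1.2, f.2.2.2, f.2.2.2.2, by rwa [Ne, Fin.val_inj], by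
      rw [Ne, Fin.val_inj]; exact hbd.symm, hab.2, had.1, hdc.1⟩
  · rw [ht]
    exact ⟨f.2.2.2, f.2.2.2.2, f.1, f.1.2, by rw [Ne, Fin.val_inj]; exact hbd.symm, by
      rwa [Ne, Fin.val_inj], hdc.2, had.2, hab.1⟩

/-- A number with `K * 4` digits consists of the digits of `K` copies. -/
def digitEquiv (q K : ℕ) : Fin (q ^ (K * 4)) ≃ (Fin K → Fin 4 → Fin q) :=
  (finFunctionFinEquiv.symm.trans (finProdFinEquiv.arrowCongr (Equiv.refl _)).symm).trans
    (Equiv.curry _ _ _)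

theorem digitEquiv_apply (q K : ℕ) (r : Fin (q ^ (K * 4))) (j : Fin K) (k : Fin 4) :
    (digitEquiv q K r j k : ℕ) = digit q r (k + 4 * j) := rfl

/-- The random numbers of a run, sorted by the copies that use their digits. -/
def randomEquiv (q K N : ℕ) : (Fin (N + 1) → Fin (q ^ (K * 4))) ≃
    (Fin K → (Fin 4 → Fin q) × (Fin N × Fin 4 → Fin q)) where
  toFun w j := (digitEquiv q K (w 0) j, fun p => digitEquiv q K (w p.1.succ) j p.2)
  invFun g := Fin.cons ((digitEquiv q K).symm fun j => (g j).1)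
    fun t => (digitEquiv q K).symm fun j k => (g j).2 (t, k)
  left_inv w := by
    refine funext fun t => ?_
    refine Fin.cases ?_ (fun t => ?_) t
    · dsimp only
      rw [Fin.cons_zero]
      exact (digitEquiv q K).symm_apply_apply _
    · dsimp only
      rw [Fin.cons_succ]
      exact (digitEquiv q K).symm_apply_apply _
  right_inv g := by
    refine funext fun j => ?_
    simp only [Fin.cons_zero, Fin.cons_succ, Equiv.apply_symm_apply]

/-- The `R` copies `i + L * r` of level `i` are independent; the factors of all other copies are at
most 1. -/
theorem pr_forall_fail_le {Ω : Type*} [Fintype Ω] [Nonempty Ω] {L R i : ℕ} (hi : i < L)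
    (S : Ω → Prop) {z : ℝ} (hz : z ≤ pr S) :
    pr (fun g : Fin (L * R) → Ω => ∀ j, j.1 % L = i → ¬ S (g j)) ≤ (1 - z) ^ R := by
  have hle : ∀ j : Fin (L * R), pr (fun ω : Ω => j.1 % L = i → ¬ S ω) ≤ 1 := fun j => pr_le_one _
  let φ : Fin R ↪ Fin (L * R) := ⟨fun r => ⟨i + L * r, by
    have h1 : (r : ℕ) + 1 ≤ R := r.2
    have := Nat.mul_le_mul_left L h1
    rw [mul_add, mul_one] at this
    omega⟩, fun r r' h => by
      have hL : 0 < L := by omega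
      simpa [Fin.ext_iff, hL.ne'] using h⟩
  rw [pr_pi (fun (j : Fin (L * R)) ω => j.1 % L = i → ¬ S ω)]
  calc ∏ j : Fin (L * R), pr (fun ω : Ω => j.1 % L = i → ¬ S ω)
      ≤ ∏ j ∈ univ.map φ, pr (fun ω : Ω => j.1 % L = i → ¬ S ω) :=
        prod_le_prod_of_subset_of_le_one (subset_univ _) (fun _ _ => pr_nonneg _)
          (fun j _ _ => hle j)
    _ = ∏ r : Fin R, (1 - pr S) := by
        rw [prod_map]
        refine prod_congr rfl fun r _ => ?_
        rw [← pr_not]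
        refine pr_congr fun ω => ?_
        have h : (φ r : ℕ) % L = i := by
          change (i + L * r) % L = i
          rw [Nat.add_mul_mod_self_left, Nat.mod_eq_of_lt hi]
        simp [h]
    _ ≤ (1 - z) ^ R := by
        rw [prod_const, card_univ, Fintype.card_fin]
        gcongr
        linarith [pr_le_one S]

/-! ### Space -/

theorem memBits_cons (a : ℕ) (M : List ℕ) : memBits (a :: M) = Nat.size a + 1 + memBits M := by
  simp [memBits]

theorem memBits_le {M : List ℕ} {W : ℕ} (h : ∀ z ∈ M, Nat.size z ≤ W) :
    memBits M ≤ M.length * (W + 1) := by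
  have := List.sum_le_card_nsmul (M.map fun w => Nat.size w + 1) (W + 1) (by
    intro z hz
    obtain ⟨w, hw, rfl⟩ := List.mem_map.1 hz
    exact Nat.succ_le_succ (h w hw))
  simpa [memBits] using this

theorem encodeEdge_lt {n j u v K : ℕ} (hj : j < K) (hu : u < n) (hv : v < n) :
    encodeEdge n j u v < K * (n * n) := by
  have h1 : u * n + v < n * n := by nlinarith
  have h2 : (j + 1) * (n * n) ≤ K * (n * n) := Nat.mul_le_mul_right _ hj
  unfold encodeEdge
  linarith

/-- A bound for the number of bits of the memory when `m` edges have arrived. -/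
def spaceBound (c n T m : ℕ) : ℕ :=
  -- The three summands are for the counter, for the key, and for the codes (their number times the
  -- bits for each).
  (2 * bitLen n + 1) + ((5 + 2 * bitLen n) * (copies c n * 4) + 1) +
    copies c n * (capFactor n * m) / Nat.sqrt T * (copies c n + 2 * bitLen n + 1)

theorem sq_lt_two_pow (n : ℕ) : n ^ 2 < 2 ^ (2 * bitLen n) := by
  rw [mul_comm, pow_mul]
  exact Nat.pow_lt_pow_left (lt_two_pow_bitLen n) (by norm_num)

theorem fieldSize_lt_two_pow {n : ℕ} (hn : 1 ≤ n) : fieldSize n < 2 ^ (5 + 2 * bitLen n) := by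
  have h1 := (prime_fieldSize hn).2.2
  have h2 := sq_lt_two_pow n
  rw [pow_add]
  omega

theorem memBits_memory_le {c n T key m : ℕ} (hn : 1 ≤ n) (hT : 1 ≤ T) (hm : m ≤ n ^ 2)
    (hkey : key < fieldSize n ^ (copies c n * 4)) {l : List ((ℕ × ℕ) × ℕ)} (hl : InRange n l)
    (hlen : l.length ≤ m) : memBits (memory c n T key l) ≤ spaceBound c n T m := by
  have hs : 0 < Nat.sqrt T := Nat.sqrt_pos.2 hT
  rw [memory, memBits_cons, memBits_cons, spaceBound, add_assoc (2 * bitLen n + 1)]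
  refine add_le_add (Nat.succ_le_succ (Nat.size_le.2 ?_))
    (add_le_add (Nat.succ_le_succ (Nat.size_le.2 ?_)) ?_)
  · exact (hlen.trans hm).trans_lt (sq_lt_two_pow n)
  · rw [pow_mul]
    exact hkey.trans_le (Nat.pow_le_pow_left (fieldSize_lt_two_pow hn).le _)
  · refine (memBits_le (W := copies c n + 2 * bitLen n) fun z hz => ?_).trans
      (Nat.mul_le_mul_right _ ?_)
    · obtain ⟨p, hp, j, hj, rfl⟩ := mem_sampled hz
      obtain ⟨hu, hv⟩ := hl p hp
      rw [Nat.size_le, pow_add]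
      refine (encodeEdge_lt hj hu hv).trans_le (Nat.mul_le_mul Nat.lt_two_pow_self.le ?_)
      rw [← sq]
      exact (sq_lt_two_pow n).le
    · rw [Nat.le_div_iff_mul_le hs]
      refine (length_sampled_mul_sqrt_le hl).trans ?_
      gcongr

theorem bitLen_le_log {n : ℕ} (hn : 2 ≤ n) : (bitLen n : ℝ) ≤ 3 * Real.log n := by
  have h1 : ((2 : ℝ) ^ bitLen n) ≤ 2 * n := by exact_mod_cast two_pow_bitLen_le (by omega)
  have hn0 : (2 : ℝ) ≤ n := by exact_mod_cast hn
  have h2 := Real.log_le_log (by positivity) h1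
  rw [Real.log_pow, Real.log_mul (by norm_num) (by positivity)] at h2
  have h3 := Real.log_le_log (by norm_num) hn0
  have h4 := Real.log_two_gt_d9
  have h5 : (0 : ℝ) ≤ bitLen n := by positivity
  nlinarith

theorem sqrt_le_two_mul_natSqrt {T : ℕ} (hT : 1 ≤ T) : Real.sqrt T ≤ 2 * Nat.sqrt T := by
  have h1 : (1 : ℝ) ≤ Nat.sqrt T := by exact_mod_cast Nat.sqrt_pos.2 hT
  have h2 := Real.real_sqrt_le_nat_sqrt_succ (a := T)
  linarith

/-- In terms of `bitLen n`, the copies contribute degree 2, the capacity 13 and the length of a code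
2, which makes the exponent 17. -/
theorem spaceBound_le (c : ℕ) : ∃ C : ℝ, ∀ n T m : ℕ, 2 ≤ n → 1 ≤ T →
    (spaceBound c n T m : ℝ) ≤ C * Real.log n ^ 17 * (m / Real.sqrt T + 1) := by
  let A : ℝ := 12288 * 160 * 16 ^ 3 * 4 ^ 12
  let D : ℝ := (4 + 1792 * c) + 2 * ((64 * c + 3) * (64 * c * A))
  refine ⟨D * 3 ^ 17, fun n T m hn hT => ?_⟩
  have hT' : (0 : ℝ) < Real.sqrt T := Real.sqrt_pos.2 (by exact_mod_cast hT)
  have hs' : (0 : ℝ) < Nat.sqrt T := by exact_mod_cast Nat.sqrt_pos.2 hT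
  obtain ⟨g, hg⟩ : ∃ g : ℝ, g = bitLen n := ⟨_, rfl⟩
  have hg1 : 1 ≤ g := by rw [hg]; exact_mod_cast one_le_bitLen n
  have hK : (copies c n : ℝ) = 64 * c * g ^ 2 := by
    rw [hg]; unfold copies levels; push_cast; ring
  have hcap : (capFactor n : ℝ) ≤ A * g ^ 13 := by
    have : (capFactor n : ℝ) = (6144 * 160 * 16 ^ 3 * 4 ^ 12) * (g + 1) * g ^ 12 := by
      rw [hg]; unfold capFactor boost regLoss; push_cast; ring
    rw [this]
    calc (6144 * 160 * 16 ^ 3 * 4 ^ 12 : ℝ) * (g + 1) * g ^ 12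
        ≤ (6144 * 160 * 16 ^ 3 * 4 ^ 12) * (2 * g) * g ^ 12 := by gcongr; linarith
      _ = A * g ^ 13 := by simp only [A]; ring
  have hdiv : ((copies c n * (capFactor n * m) / Nat.sqrt T : ℕ) : ℝ) ≤
      64 * c * A * g ^ 15 * (2 * (m / Real.sqrt T)) := by
    refine Nat.cast_div_le.trans ?_
    rw [div_le_iff₀ hs']
    push_cast
    rw [hK]
    have h1 : (m : ℝ) ≤ 2 * (m / Real.sqrt T) * Nat.sqrt T := by
      have := sqrt_le_two_mul_natSqrt hT
      calc (m : ℝ) = m / Real.sqrt T * Real.sqrt T := by field_simp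
        _ ≤ m / Real.sqrt T * (2 * Nat.sqrt T) := by gcongr
        _ = _ := by ring
    calc 64 * c * g ^ 2 * (capFactor n * m)
        ≤ 64 * c * g ^ 2 * ((A * g ^ 13) * (2 * (m / Real.sqrt T) * Nat.sqrt T)) := by gcongr
      _ = _ := by ring
  have hz : (0 : ℝ) ≤ m / Real.sqrt T := by positivity
  have hA : 0 < A := by simp only [A]; norm_num
  have hmain : (spaceBound c n T m : ℝ) ≤ D * g ^ 17 * (m / Real.sqrt T + 1) := by
    have hfirst : (2 * g + 1) + ((5 + 2 * g) * (64 * c * g ^ 2 * 4) + 1) ≤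
        (4 + 1792 * c) * g ^ 17 := by
      have h3 : g ^ 3 ≤ g ^ 17 := pow_le_pow_right₀ hg1 (by norm_num)
      have h1 : g ≤ g ^ 17 := le_self_pow₀ hg1 (by norm_num)
      have h2 : 5 + 2 * g ≤ 7 * g := by linarith
      have hc : (0 : ℝ) ≤ c := by positivity
      calc (2 * g + 1) + ((5 + 2 * g) * (64 * c * g ^ 2 * 4) + 1)
          ≤ (2 * g + 1) + ((7 * g) * (64 * c * g ^ 2 * 4) + 1) := by gcongr
        _ ≤ 4 * g + 1792 * c * g ^ 3 := by nlinarith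
        _ ≤ 4 * g ^ 17 + 1792 * c * g ^ 17 := by gcongr
        _ = _ := by ring
    have hlast : 64 * c * g ^ 2 + 2 * g + 1 ≤ (64 * c + 3) * g ^ 2 := by nlinarith
    unfold spaceBound
    push_cast
    rw [hK, ← hg]
    calc (2 * g + 1) + ((5 + 2 * g) * (64 * c * g ^ 2 * 4) + 1) +
          ((copies c n * (capFactor n * m) / Nat.sqrt T : ℕ) : ℝ) * (64 * c * g ^ 2 + 2 * g + 1)
        ≤ (4 + 1792 * c) * g ^ 17 +
          64 * c * A * g ^ 15 * (2 * (m / Real.sqrt T)) * ((64 * c + 3) * g ^ 2) := by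
          gcongr
      _ = (4 + 1792 * c) * g ^ 17 * 1 +
          2 * ((64 * c + 3) * (64 * c * A)) * g ^ 17 * (m / Real.sqrt T) := by ring
      _ ≤ (4 + 1792 * c) * g ^ 17 * (m / Real.sqrt T + 1) +
          2 * ((64 * c + 3) * (64 * c * A)) * g ^ 17 * (m / Real.sqrt T + 1) := by
          gcongr <;> linarith
      _ = _ := by simp only [D]; ring
  refine hmain.trans ?_
  have hlog : g ≤ 3 * Real.log n := hg ▸ bitLen_le_log hn
  calc D * g ^ 17 * (m / Real.sqrt T + 1)
      ≤ D * (3 * Real.log n) ^ 17 * (m / Real.sqrt T + 1) := by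
        have : 0 ≤ D := by simp only [D]; positivity
        gcongr
    _ = _ := by ring

/-! ### Four-cycles as subgraphs -/

section Count

variable {n : ℕ} {G : SimpleGraph (Fin n)}

theorem isC4_of_copy (φ : (SimpleGraph.cycleGraph 4).Copy G) :
    IsC4 G (φ 0, φ 1, φ 2, φ 3) := by
  have hadj : ∀ i j : Fin 4, (SimpleGraph.cycleGraph 4).Adj i j → G.Adj (φ i) (φ j) :=
    fun i j h => φ.toHom.map_adj h
  have hcyc : ∀ i : Fin 4, (SimpleGraph.cycleGraph 4).Adj i (i + 1) := fun i =>
    SimpleGraph.cycleGraph_adj.2 (Or.inr (add_sub_cancel_left i 1))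
  exact ⟨hadj 0 1 (hcyc 0), hadj 1 2 (hcyc 1), hadj 2 3 (hcyc 2), hadj 3 0 (hcyc 3),
    fun h => absurd (φ.injective h) (by decide), fun h => absurd (φ.injective h) (by decide)⟩

theorem isContained_of_isC4 {f : Quad (Fin n)} (hf : IsC4 G f) :
    (SimpleGraph.cycleGraph 4).IsContained G := by
  obtain ⟨a, b, c, d⟩ := f
  obtain ⟨hab, hbc, hcd, hda, hac, hbd⟩ := hf
  dsimp only at hab hbc hcd hda hac hbd
  have e1 := hab.ne
  have e2 := hbc.ne
  have e3 := hcd.ne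
  have e4 := hda.ne
  refine ⟨⟨⟨![a, b, c, d], ?_⟩, ?_⟩⟩
  · intro i j h
    rw [SimpleGraph.cycleGraph_adj] at h
    fin_cases i <;> fin_cases j <;> first
      | exact absurd h (by decide)
      | exact hab
      | exact hbc
      | exact hcd
      | exact hda
      | exact hab.symm
      | exact hbc.symm
      | exact hcd.symm
      | exact hda.symm
  · intro i j h
    change ![a, b, c, d] i = ![a, b, c, d] j at h
    fin_cases i <;> fin_cases j <;> first
      | rfl
      | exact absurd h e1
      | exact absurd h e2
      | exact absurd h e3
      | exact absurd h e4
      | exact absurd h hac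
      | exact absurd h hbd
      | exact absurd h.symm e1
      | exact absurd h.symm e2
      | exact absurd h.symm e3
      | exact absurd h.symm e4
      | exact absurd h.symm hac
      | exact absurd h.symm hbd

/-- Counting cycles with labels can only increase their number, so the lower bound `T` passes to
labelled cycles. -/
theorem numFourCycles_le_card_c4s (G : SimpleGraph (Fin n)) :
    numFourCycles G ≤ (c4s G).card := by
  classical
  refine SimpleGraph.copyCount_le_labelledCopyCount.trans ?_
  let quad : (SimpleGraph.cycleGraph 4).Copy G → c4s G :=
    fun φ => ⟨(φ 0, φ 1, φ 2, φ 3), mem_c4s.2 (isC4_of_copy φ)⟩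
  have h : G.labelledCopyCount (SimpleGraph.cycleGraph 4) =
      Nat.card ((SimpleGraph.cycleGraph 4).Copy G) := (@Nat.card_eq_fintype_card _ (_)).symm
  rw [h, ← Nat.card_eq_finsetCard]
  refine Nat.card_le_card_of_injective quad fun φ ψ h => ?_
  have h := congrArg Subtype.val h
  simp only [quad, Prod.mk.injEq] at h
  refine DFunLike.ext _ _ fun i => ?_
  fin_cases i
  exacts [h.1, h.2.1, h.2.2.1, h.2.2.2]

theorem not_isC4_of_numFourCycles_eq_zero (h : numFourCycles G = 0) (f : Quad (Fin n)) :
    ¬ IsC4 G f := fun hf =>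
  SimpleGraph.copyCount_eq_zero.1 h (isContained_of_isC4 hf)

theorem ncard_edgeSet {es : List (Fin n × Fin n)} (hes : IsEdgeStream G es) :
    G.edgeSet.ncard = es.length := by
  have h : G.edgeSet = ((es.map fun e => s(e.1, e.2)).toFinset : Set (Sym2 (Fin n))) := by
    ext e
    induction e with | h u v => ?_
    rw [SimpleGraph.mem_edgeSet, ← hes.2 u v]
    simp
  rw [h, Set.ncard_coe_finset, List.toFinset_card_of_nodup hes.1, List.length_map]

theorem adj_of_storedAdj {c T key u v : ℕ} {es : List (Fin n × Fin n)} (hes : IsEdgeStream G es)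
    {rs : List ℕ}
    (h : StoredAdj n (sampled c n T key ((streamItems es).zip rs).reverse) u v) :
    ∃ (hu : u < n) (hv : v < n), G.Adj ⟨u, hu⟩ ⟨v, hv⟩ := by
  obtain ⟨⟨e, r⟩, hp, h⟩ := storedAdj_sampled (inRange_zip es rs) h
  obtain ⟨e', he', rfl⟩ := List.mem_map.1 (List.of_mem_zip (List.mem_reverse.1 hp)).1
  have hadj : G.Adj e'.1 e'.2 := (hes.2 _ _).1 (List.mem_map.2 ⟨e', he', rfl⟩)
  rcases h with ⟨rfl, rfl⟩ | ⟨rfl, rfl⟩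
  · exact ⟨e'.1.2, e'.2.2, hadj⟩
  · exact ⟨e'.2.2, e'.1.2, hadj.symm⟩

/-- The reason for the one-sided error: stored edges are edges of `G`. Neighbouring vertices differ
by adjacency, and opposite ones by the two inequalities in `Closes`. -/
theorem exists_isC4_of_closes {c T key : ℕ} {es : List (Fin n × Fin n)} (hes : IsEdgeStream G es)
    {rs : List ℕ} {e : ℕ × ℕ} (he : e ∈ streamItems es)
    (h : Closes n (sampled c n T key ((streamItems es).zip rs).reverse) e.1 e.2) :
    ∃ f, IsC4 G f := by
  obtain ⟨e', he', rfl⟩ := List.mem_map.1 he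
  have hadj : G.Adj e'.1 e'.2 := (hes.2 _ _).1 (List.mem_map.2 ⟨e', he', rfl⟩)
  obtain ⟨a, ha, d, hd, hav, hdu, h1, h2, h3⟩ := h
  obtain ⟨_, _, k1⟩ := adj_of_storedAdj hes h1
  obtain ⟨_, _, k2⟩ := adj_of_storedAdj hes h2
  obtain ⟨_, _, k3⟩ := adj_of_storedAdj hes h3
  exact ⟨(e'.1, ⟨a, ha⟩, ⟨d, hd⟩, e'.2), k1, k2, k3, hadj.symm,
    fun h => hdu (congrArg Fin.val h).symm, fun h => hav (congrArg Fin.val h)⟩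

end Count

/-! ### The run of the algorithm -/

section Run

variable {c n T : ℕ}

theorem coin_add_one (hn : 1 ≤ n) :
    (algorithm c).coin (n, T) + 1 = fieldSize n ^ (copies c n * 4) :=
  Nat.sub_add_cancel (Nat.pow_pos (prime_fieldSize hn).1.pos)

/-- The items of both passes. -/
abbrev twoPasses (es : List (ℕ × ℕ)) : List (ℕ × ℕ × ℕ) :=
  es.map (Prod.mk 0) ++ es.map (Prod.mk 1)

theorem detRun_ofFn (hn : 1 ≤ n) (hT : 1 ≤ T) {es : List (Fin n × Fin n)}
    (hlen : es.length ≤ n ^ 2)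
    (w : Fin ((twoPasses (streamItems es)).length + 1) → Fin ((algorithm c).coin (n, T) + 1)) :
    ((algorithm c).answer (n, T) ((algorithm c).detRun (n, T) (twoPasses (streamItems es))
        (List.ofFn fun t => (w t : ℕ))).1 = true ↔
      ∃ e ∈ streamItems es, Closes n (sampled c n T (w 0)
        ((streamItems es).zip (List.ofFn fun t => (w (Fin.succ t) : ℕ))).reverse) e.1 e.2) ∧
    ((algorithm c).detRun (n, T) (twoPasses (streamItems es))
        (List.ofFn fun t => (w t : ℕ))).2 ≤ spaceBound c n T es.length := by
  have h := detRun_algorithm c n T (spaceBound c n T es.length) (streamItems es) (w 0)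
    (List.ofFn fun t => (w (Fin.succ t) : ℕ)) (by simp) (fun l' hl' => by
      refine memBits_memory_le hn hT hlen ?_ (fun p hp => inRange_zip es _ p (hl'.subset hp)) ?_
      · rw [← coin_add_one (T := T) hn]
        exact (w 0).2
      · refine hl'.length_le.trans ?_
        rw [List.length_reverse, List.length_zip]
        exact (min_le_left _ _).trans (by simp [streamItems]))
  rw [List.ofFn_succ]
  refine ⟨(iff_of_eq (congrArg (fun M => (algorithm c).answer (n, T) M = true) h.1)).trans ?_,
    h.2⟩
  split_ifs with hc
  · exact iff_of_true (by simp [algorithm]) hc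
  · exact iff_of_false (by simp [algorithm, memory]) hc

theorem probAnswer_eq_pr (x : ℕ × ℕ) (es : List (ℕ × ℕ)) (b : Bool) :
    (algorithm c).probAnswer 2 x es b =
      pr (fun w : Fin ((twoPasses es).length + 1) → Fin ((algorithm c).coin x + 1) =>
        (algorithm c).answer x ((algorithm c).detRun x (twoPasses es)
          (List.ofFn fun t => (w t : ℕ))).1 = b) := by
  rw [StreamingAlgorithm.probAnswer_two, pr, Nat.card_eq_fintype_card, Nat.card_eq_fintype_card,
    Fintype.card_subtype]

theorem space_le (hn : 1 ≤ n) (hT : 1 ≤ T) {es : List (Fin n × Fin n)} (hlen : es.length ≤ n ^ 2)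
    {o : Bool × ℕ} (ho : o ∈ ((algorithm c).run 2 (n, T) (streamItems es)).support) :
    o.2 ≤ spaceBound c n T es.length := by
  rw [StreamingAlgorithm.run_two, PMF.mem_support_map_iff] at ho
  obtain ⟨w, -, rfl⟩ := ho
  exact (detRun_ofFn hn hT hlen w).2

theorem probAnswer_false_eq_one (hn : 1 ≤ n) (hT : 1 ≤ T) {G : SimpleGraph (Fin n)}
    {es : List (Fin n × Fin n)} (hes : IsEdgeStream G es) (hG : numFourCycles G = 0) :
    (algorithm c).probAnswer 2 (n, T) (streamItems es) false = 1 := by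
  rw [probAnswer_eq_pr, ← pr_true
    (Ω := Fin ((twoPasses (streamItems es)).length + 1) → Fin ((algorithm c).coin (n, T) + 1))]
  refine pr_congr fun w => ?_
  rw [iff_true, ← Bool.not_eq_true, (detRun_ofFn hn hT (length_le_of_isEdgeStream hes) w).1]
  rintro ⟨e, he, h⟩
  obtain ⟨f, hf⟩ := exists_isC4_of_closes hes he h
  exact not_isC4_of_numFourCycles_eq_zero hG f hf

/-- Since (31/32)³² ≤ 1/2, each block of 32 copies halves the failure probability, and `2 ^ bitLen
n` exceeds `n`. -/
theorem pow_fail_le (c : ℕ) (hn : 1 ≤ n) :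
    (1 - 1 / 32 : ℝ) ^ (32 * c * bitLen n) ≤ 1 / (n : ℝ) ^ c := by
  have h1 : (1 - 1 / 32 : ℝ) ^ 32 ≤ 1 / 2 := by norm_num
  have hn' : (0 : ℝ) < n := by exact_mod_cast hn
  have h2 : (n : ℝ) ≤ 2 ^ bitLen n := by exact_mod_cast (lt_two_pow_bitLen n).le
  calc (1 - 1 / 32 : ℝ) ^ (32 * c * bitLen n)
      = ((1 - 1 / 32 : ℝ) ^ 32) ^ (bitLen n * c) := by rw [← pow_mul]; ring_nf
    _ ≤ (1 / 2) ^ (bitLen n * c) := by gcongr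
    _ = 1 / (2 ^ bitLen n) ^ c := by rw [pow_mul, one_div_pow, one_div_pow]
    _ ≤ 1 / (n : ℝ) ^ c := by gcongr

theorem le_probAnswer_true (hn : 1 ≤ n) (hT : 1 ≤ T) {G : SimpleGraph (Fin n)}
    {es : List (Fin n × Fin n)} (hes : IsEdgeStream G es) (hG : T ≤ numFourCycles G) :
    1 - 1 / (n : ℝ) ^ c ≤ (algorithm c).probAnswer 2 (n, T) (streamItems es) true := by
  have : Fact (fieldSize n).Prime := ⟨(prime_fieldSize hn).1⟩
  have hN : es.length ≤ (twoPasses (streamItems es)).length := by simp [streamItems]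
  obtain ⟨i, hi, hS⟩ := le_pr_copySucceeds hn hT (hG.trans (numFourCycles_le_card_c4s G)) hes
    (Fin.castLE hN) (Fin.castLE_injective hN)
  have hfail := (pr_forall_fail_le (R := 32 * c * bitLen n) hi _ hS).trans (pow_fail_le c hn)
  -- Sorting the digits by copies turns the uniform measure on runs into a product over the copies,
  -- where independence can be used.
  let e : (Fin ((twoPasses (streamItems es)).length + 1) →
      Fin ((algorithm c).coin (n, T) + 1)) ≃ _ :=
    ((Equiv.refl _).arrowCongr (finCongr (coin_add_one hn))).trans
      (randomEquiv (fieldSize n) (copies c n) (twoPasses (streamItems es)).length)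
  have hpr := pr_equiv e fun g => ∀ j, j.1 % levels n = i →
    ¬ CopySucceeds G T i es (toNatFun (g j).1) fun t => toNatFun fun k =>
      (g j).2 (Fin.castLE hN t, k)
  rw [probAnswer_eq_pr]
  refine le_trans ?_ (pr_mono (p := fun w => ¬ ∀ j, j.1 % levels n = i →
    ¬ CopySucceeds G T i es (toNatFun (e w j).1) fun t => toNatFun fun k =>
      (e w j).2 (Fin.castLE hN t, k)) fun w hw => ?_)
  · rw [pr_not, hpr]
    exact sub_le_sub_left hfail 1
  · push Not at hw
    obtain ⟨j, rfl, hw⟩ := hw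
    rw [(detRun_ofFn hn hT (length_le_of_isEdgeStream hes) w).1]
    refine exists_closes_of_copySucceeds hes (by simpa using hN) j.2
      ((copySucceeds_congr ?_ ?_).1 hw)
    · intro k hk
      have : ((Fin.ofNat 4 k : Fin 4) : ℕ) = k := Nat.mod_eq_of_lt hk
      exact (digitEquiv_apply _ _ _ j (Fin.ofNat 4 k)).trans (by rw [this]; rfl)
    · intro t k hk
      have : ((Fin.ofNat 4 k : Fin 4) : ℕ) = k := Nat.mod_eq_of_lt hk
      refine (digitEquiv_apply _ _ _ j (Fin.ofNat 4 k)).trans ?_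
      rw [this]
      simp
      rfl

end Run

end FourCycle

theorem theorem5p1 (c : ℕ) :
    ∃ (A : StreamingAlgorithm (ℕ × ℕ)) (C : ℝ) (k : ℕ),
      ∀ (n T : ℕ), 2 ≤ n → 1 ≤ T →
        ∀ (G : SimpleGraph (Fin n)) (es : List (Fin n × Fin n)), IsEdgeStream G es →
          (∀ o ∈ (A.run 2 (n, T) (streamItems es)).support,
            (o.2 : ℝ) ≤ C * Real.log n ^ k * (G.edgeSet.ncard / Real.sqrt T + 1)) ∧
          (numFourCycles G = 0 →
            1 - 1 / (n : ℝ) ^ c ≤ A.probAnswer 2 (n, T) (streamItems es) false) ∧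
          (T ≤ numFourCycles G →
            1 - 1 / (n : ℝ) ^ c ≤ A.probAnswer 2 (n, T) (streamItems es) true) := by
  obtain ⟨C, hC⟩ := FourCycle.spaceBound_le c
  refine ⟨FourCycle.algorithm c, C, 17, fun n T hn hT G es hes => ⟨fun o ho => ?_, fun h => ?_,
    FourCycle.le_probAnswer_true (by omega) hT hes⟩⟩
  · rw [FourCycle.ncard_edgeSet hes]
    refine le_trans ?_ (hC n T es.length hn hT)
    exact_mod_cast FourCycle.space_le (by omega) hT (FourCycle.length_le_of_isEdgeStream hes) ho
  · rw [FourCycle.probAnswer_false_eq_one (by omega) hT hes h]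
    have : 0 ≤ 1 / (n : ℝ) ^ c := by positivity
    linarith
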